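/- Let $X$ be a complex Banach space with an unconditional Schauder basis $(x_n)_{n\ge 1}$, and let $0<T<\infty$. An operator $B$ on $X$ satisfies *maximal regularity* (MR) if the operator $\frac{d}{dt}+\mathcal B$ on $L^2([0,T);X)$ has a bounded inverse; here $\frac{d}{dt}$ has domain $\{u\in W^{1,2}([0,T);X): u(0)=0\}$, $\mathcal B$ has domain $L^2([0,T);D(B))$ and acts by $(\mathcal Bu)(t)=B(u(t))$, and the sum has as its domain the intersection of the two domains. The space $X$ has the *maximal regularity property* (MRP) if every operator $B$ such that $-B$ is the infinitesimal generator of a bounded analytic semigroup on $X$ (that is, a strongly continuous semigroup extending to a bounded, holomorphic semigroup on some sector $\{z\neq 0:|\arg z|<\delta\}$, $0<\delta\le\pi/2$, strongly continuous at $0$) satisfies (MR). Then $X$ has (MRP) if and only if $X$ is isomorphic (linearly homeomorphic) to $\ell_2$. Moreover, if $X$ has (MRP), then for every permutation $\pi$ of $\{1,2,\dots\}$ and every block basis $(u_j)_{j\ge1}$ of $(x_{\pi(n)})_{n\ge1}$ (nonzero vectors $u_j=\sum_{k=r_j}^{r_{j+1}-1}a_kx_{\pi(k)}$ with $r_1<r_2<\cdots$),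 the closed linear span of $(u_j)_{j\ge1}$ is complemented in $X$. -/

import Mathlib

open MeasureTheory Filter Topology

noncomputable section

namespace MaxReg

/-- The open sector `{z ≠ 0 : |arg z| < δ}` in the complex plane. -/
def sector (δ : ℝ) : Set ℂ := {z | z ≠ 0 ∧ |Complex.arg z| < δ}

variable {X : Type*} [NormedAddCommGroup X] [NormedSpace ℂ X]

/-- `S` is a bounded analytic semigroup on the sector of half-angle `δ`; the values of `S` outside
the sector and `0` are irrelevant. -/
structure IsBoundedAnalyticSemigroup (δ : ℝ) (S : ℂ → X →L[ℂ] X) : Prop where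
  angle_pos : 0 < δ
  angle_le : δ ≤ Real.pi / 2
  map_zero : S 0 = 1
  map_add : ∀ z ∈ sector δ, ∀ w ∈ sector δ, S (z + w) = S z * S w
  analytic : DifferentiableOn ℂ S (sector δ)
  tendsto_zero : ∀ x : X, Tendsto (fun z => S z x) (𝓝[sector δ] 0) (𝓝 x)
  bounded : ∃ M : ℝ, ∀ z ∈ sector δ, ‖S z‖ ≤ M

/-- `A` is the infinitesimal generator of `(S t)_{t > 0}`: its domain consists of the `x` for which
`(S t x - x) / t` converges as `t ↓ 0`, and `A x` is this limit. -/
def IsGenerator (A : X →ₗ.[ℂ] X) (S : ℂ → X →L[ℂ] X) : Prop :=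
  ∀ x y : X, (x, y) ∈ A.graph ↔
    Tendsto (fun t : ℝ => (t : ℂ)⁻¹ • (S (t : ℂ) x - x)) (𝓝[>] 0) (𝓝 y)

/-- The unbounded operator `A` generates a bounded analytic semigroup. -/
def GeneratesBoundedAnalyticSemigroup (A : X →ₗ.[ℂ] X) : Prop :=
  ∃ (δ : ℝ) (S : ℂ → X →L[ℂ] X), IsBoundedAnalyticSemigroup δ S ∧ IsGenerator A S

/-- The Bochner space `L²([0,T); X)`. -/
abbrev L2 (T : ℝ) (X : Type*) [NormedAddCommGroup X] : Type _ :=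
  Lp X 2 (volume.restrict (Set.Ico (0 : ℝ) T))

/-- The graph of `d/dt` on `L²([0,T); X)` with domain `{u ∈ W^{1,2}([0,T); X) : u 0 = 0}`:
`u` belongs to this domain with derivative `v ∈ L²` iff `u t = ∫₀ᵗ v`. -/
def DerivRel (T : ℝ) (u v : L2 T X) : Prop :=
  ∀ᵐ t ∂(volume.restrict (Set.Ico (0 : ℝ) T)), u t = ∫ s in (0 : ℝ)..t, v s

/-- The graph of the pointwise operator `(𝓑 u) t = B (u t)` on `L²([0,T); X)` with domain
`L²([0,T); D(B))`, where `D(B)` carries the graph norm. -/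
def PointwiseRel (T : ℝ) (B : X →ₗ.[ℂ] X) (u w : L2 T X) : Prop :=
  ∀ᵐ t ∂(volume.restrict (Set.Ico (0 : ℝ) T)), (u t, w t) ∈ B.graph

/-- `B` satisfies (L²-)maximal regularity on `[0,T)`: the operator `d/dt + 𝓑`, with domain the
intersection of the two domains, has a bounded inverse `R` on `L²([0,T); X)`, that is, its graph
is the transposed graph of an everywhere defined bounded operator `R`. -/
def MaximalRegularity (T : ℝ) (B : X →ₗ.[ℂ] X) : Prop :=
  ∃ R : L2 T X →L[ℂ] L2 T X, ∀ u f : L2 T X,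
    (∃ v w : L2 T X, DerivRel T u v ∧ PointwiseRel T B u w ∧ v + w = f) ↔ u = R f

/-- The maximal regularity property of `X` (tested on the interval `[0,T)`): every `B` such that
`-B` generates a bounded analytic semigroup on `X` satisfies maximal regularity. -/
def MRP (T : ℝ) (X : Type*) [NormedAddCommGroup X] [NormedSpace ℂ X] : Prop :=
  ∀ B : X →ₗ.[ℂ] X, GeneratesBoundedAnalyticSemigroup (-B) → MaximalRegularity T B

/-- `u` is a block basis of the sequence `x`: nonzero vectors that are linear combinations of
consecutive finite blocks of `x`. -/
def IsBlockBasis (x u : ℕ → X) : Prop :=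
  ∃ (r : ℕ → ℕ) (a : ℕ → ℂ), StrictMono r ∧
    ∀ j, u j ≠ 0 ∧ u j = ∑ k ∈ Finset.Ico (r j) (r (j + 1)), a k • x k

end MaxReg

end

/-! MRP forces a Hilbert space because maximal regularity can be tested on diagonal operators. For a
Schauder decomposition with summand projections `Q_j`, the operator `B = ∑ c 2^j Q_j` is minus the
generator of a bounded analytic semigroup, by Abel summation. If `B` has maximal regularity, then `f
↦ B u`, where `u' + B u = f`, is bounded, and on the summand `j` it solves a scalar equation with
rate `c 2^j`. A suitable scalar forcing produces responses at the rates `α` and `2α` whose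
difference is exactly `sin (α t)` (`exists_pair_response`). If a biorthogonal system is twisted,
with `y_a` replaced by `y_a + y_{τ a}` where `τ a` comes right after `a` in the order, the response
moves the coefficient at `a` to the position `τ a`, multiplied by a sine (`exists_twist_response`).
Thus MRP makes matchings between parts of one biorthogonal system bounded.

This is used twice. Applied to the normalized unconditional basis, it shows, with a gliding hump,
that the basis is symmetric (`exists_symmetricBound`). The basis can then be indexed by cubes
`{±1}^d`, each with `d` extra directions. On each cube the Walsh vectors, suitably ordered, have
bounded partial sum projections, since translations of the cube act boundedly and the kernels
involved are nonnegative. The second application matches the extra directions with the Rademacher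
vectors, both ways. Riesz products `∏ (1 + i c_k r_k)`, bounded by `exp (∑ c_k²)`, compare
Rademacher coefficients with the `ℓ₂` norm, so `∑ r_k e_k` has norm comparable to `(∑ r_k²)^{1/2}`
(`exists_lower_bound`, `exists_upper_bound`). Hence the basis is equivalent to that of `ℓ₂`.

Conversely (`MRP_of_equiv`), on a space isomorphic to a Hilbert space Plancherel's theorem bounds
convolution with an operator kernel by the supremum of its Fourier transform. Analyticity gives `‖S‖
≤ C`, `‖S'‖ ≤ C/t`, `‖S''‖ ≤ C/t²`, hence uniformly bounded Fourier transforms for the shifted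
kernels `S' (τ + ·)`. Letting `τ → 0` shows that the mild solution is a strong one.

The complementation statement follows since every closed subspace of a Hilbert space is
complemented. -/

open MeasureTheory Filter Topology

set_option linter.unusedSectionVars false

noncomputable section

/-! ### Diagonal analytic semigroups of Schauder decompositions. -/

namespace MaxReg

variable {X : Type*} [NormedAddCommGroup X] [NormedSpace ℂ X]

/-- An increasing sequence of commuting, uniformly bounded projections converging strongly to the
identity: the partial sum projections of a Schauder decomposition. -/
structure IsProjChain (P : ℕ → X →L[ℂ] X) (K : ℝ) : Prop where
  zero : P 0 = 0
  comp : ∀ i j x, P i (P j x) = P (min i j) x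
  bound : ∀ i, ‖P i‖ ≤ K
  tendsto : ∀ x, Tendsto (fun i => P i x) atTop (𝓝 x)

open SchauderBasis (succSub)

/-- Abel summation: only the partial sum projections are uniformly bounded, so sums over the
summands must be rewritten through them. -/
theorem sum_smul_succSub_eq (P : ℕ → X →L[ℂ] X) (h0 : P 0 = 0) (a : ℕ → ℂ) (N : ℕ) :
    ∑ j ∈ Finset.range N, a j • succSub P j =
      a N • P N + ∑ j ∈ Finset.range N, (a j - a (j + 1)) • P (j + 1) := by
  induction N with
  | zero => simp [h0]
  | succ N ih =>
    rw [Finset.sum_range_succ, ih, Finset.sum_range_succ]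
    simp only [succSub, smul_sub, sub_smul]
    abel

/-- The derivative of `exp (-z s)` has modulus `‖z‖ / z.re` times that of the derivative of `exp
(-z.re s)`. The right-hand side telescopes along `c 2^j`, which controls the total variation of the
coefficients in the Abel sum. -/
theorem norm_cexp_sub_cexp_le {z : ℂ} (hz : 0 < z.re) {a b : ℝ} (hab : a ≤ b) :
    ‖Complex.exp (-z * a) - Complex.exp (-z * b)‖ ≤
      ‖z‖ / z.re * (Real.exp (-z.re * a) - Real.exp (-z.re * b)) := by
  have key := image_norm_le_of_norm_deriv_right_le_deriv_boundary (a := a) (b := b)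
    (f := fun s : ℝ => Complex.exp (-z * a) - Complex.exp (-z * s))
    (f' := fun s : ℝ => z * Complex.exp (-z * s))
    (B := fun s : ℝ => ‖z‖ / z.re * (Real.exp (-z.re * a) - Real.exp (-z.re * s)))
    (B' := fun s : ℝ => ‖z‖ * Real.exp (-z.re * s)) (by fun_prop) ?_ (by simp) ?_ ?_
    (Set.right_mem_Icc.2 hab)
  · exact key
  · intro s _
    have h1 : HasDerivAt (fun s : ℝ => -z * (s : ℂ)) (-z) s := by
      simpa using (Complex.ofRealCLM.hasDerivAt (x := s)).const_mul (-z)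
    have := (h1.cexp.const_sub (Complex.exp (-z * a))).hasDerivWithinAt (s := Set.Ici s)
    convert this using 1
    ring
  · intro s
    have h1 : HasDerivAt (fun s : ℝ => -z.re * s) (-z.re) s := by
      simpa using (hasDerivAt_id s).const_mul (-z.re)
    have := ((h1.exp).const_sub (Real.exp (-z.re * a))).const_mul (‖z‖ / z.re)
    refine this.congr_deriv ?_
    field_simp
  · intro s _
    simp [Complex.norm_exp]

theorem norm_le_two_mul_re_of_mem_sector {z : ℂ} (hz : z ∈ sector (Real.pi / 3)) :
    0 < z.re ∧ ‖z‖ ≤ 2 * z.re := by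
  obtain ⟨h0, h1⟩ := hz
  have hn : 0 < ‖z‖ := norm_pos_iff.2 h0
  have hc : 1 / 2 ≤ Real.cos z.arg := by
    rw [← Real.cos_abs, ← Real.cos_pi_div_three]
    exact Real.cos_le_cos_of_nonneg_of_le_pi (abs_nonneg _) (by linarith [Real.pi_pos]) h1.le
  rw [Complex.cos_arg h0, le_div_iff₀ hn] at hc
  constructor <;> linarith

theorem isOpen_sector {δ : ℝ} (hδ : δ ≤ Real.pi / 2) : IsOpen (sector δ) := by
  rw [isOpen_iff_mem_nhds]
  rintro z ⟨hz, ha⟩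
  have hre : 0 < z.re := by
    rcases Complex.abs_arg_lt_pi_div_two_iff.1 (ha.trans_le hδ) with h | h
    · exact h
    · exact absurd h hz
  have hc : ContinuousAt (fun w : ℂ => |w.arg|) z :=
    (Complex.continuousAt_arg (Complex.mem_slitPlane_iff.2 (Or.inl hre))).abs
  filter_upwards [hc.eventually (gt_mem_nhds ha), isOpen_ne.mem_nhds hz] with w h1 h2
  exact ⟨h2, h1⟩

theorem ofReal_mem_sector {δ t : ℝ} (hδ : 0 < δ) (ht : 0 < t) : (t : ℂ) ∈ sector δ :=
  ⟨by exact_mod_cast ht.ne', by simpa [Complex.arg_ofReal_of_nonneg ht.le] using hδ⟩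

namespace IsProjChain

variable {P : ℕ → X →L[ℂ] X} {K : ℝ}

theorem nonneg (hP : IsProjChain P K) : 0 ≤ K := (norm_nonneg _).trans (hP.bound 0)

theorem norm_succSub_le (hP : IsProjChain P K) (j : ℕ) : ‖succSub P j‖ ≤ 2 * K := by
  have := norm_sub_le (P (j + 1)) (P j)
  have h1 := hP.bound (j + 1)
  have h2 := hP.bound j
  simp only [succSub]
  linarith

theorem succSub_succSub (hP : IsProjChain P K) (i j : ℕ) (x : X) :
    succSub P i (succSub P j x) = if i = j then succSub P j x else 0 :=
  SchauderBasis.succSub_ortho hP.comp i j x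

end IsProjChain

/-- The semigroup `∑ exp (-z c 2^j) Q_j` attached to a Schauder decomposition. -/
def chainSemigroup (P : ℕ → X →L[ℂ] X) (c : ℝ) (z : ℂ) : X →L[ℂ] X :=
  open Classical in
  -- At `z = 0` the series of the `Q_j` converges only strongly in general, so the identity is
  -- prescribed there.
  if z = 0 then 1 else ∑' j : ℕ, Complex.exp (-z * (c * 2 ^ j : ℝ)) • succSub P j

theorem summable_exp_neg_mul_two_pow {r : ℝ} (hr : 0 < r) :
    Summable fun j : ℕ => Real.exp (-r * 2 ^ j) := by
  refine Summable.of_nonneg_of_le (fun _ => (Real.exp_pos _).le) (fun j => ?_)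
    (Real.summable_exp_nat_mul_iff.2 (neg_lt_zero.2 hr))
  rw [Real.exp_le_exp]
  have : (j : ℝ) ≤ 2 ^ j := by exact_mod_cast (Nat.lt_two_pow_self (n := j)).le
  nlinarith

namespace IsProjChain

variable {P : ℕ → X →L[ℂ] X} {K c : ℝ}

theorem norm_term_le (hP : IsProjChain P K) {r : ℝ} (hc : 0 < c) {z : ℂ} (hz : r ≤ z.re) (j : ℕ) :
    ‖Complex.exp (-z * (c * 2 ^ j : ℝ)) • succSub P j‖ ≤
      Real.exp (-(r * c) * 2 ^ j) * (2 * K) := by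
  rw [norm_smul, Complex.norm_exp]
  gcongr
  · have : (-z * ((c * 2 ^ j : ℝ) : ℂ)).re = -z.re * (c * 2 ^ j) := by
      rw [Complex.re_mul_ofReal]; simp
    rw [this]
    have : (0 : ℝ) < c * 2 ^ j := by positivity
    nlinarith
  · exact hP.norm_succSub_le j

theorem summable_bound (K : ℝ) {r : ℝ} (hr : 0 < r) (hc : 0 < c) :
    Summable fun j : ℕ => Real.exp (-(r * c) * 2 ^ j) * (2 * K) :=
  (summable_exp_neg_mul_two_pow (mul_pos hr hc)).mul_right _

variable [CompleteSpace X]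

theorem summable_term (hP : IsProjChain P K) (hc : 0 < c) {z : ℂ} (hz : 0 < z.re) :
    Summable fun j : ℕ => Complex.exp (-z * (c * 2 ^ j : ℝ)) • succSub P j :=
  Summable.of_norm_bounded (summable_bound K hz hc) (hP.norm_term_le hc le_rfl)

theorem semigroup_hasSum (hP : IsProjChain P K) (hc : 0 < c) {z : ℂ} (hz : 0 < z.re) :
    HasSum (fun j : ℕ => Complex.exp (-z * (c * 2 ^ j : ℝ)) • succSub P j)
      (chainSemigroup P c z) := by
  have : z ≠ 0 := by rintro rfl; simp at hz
  rw [chainSemigroup, if_neg this]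
  exact (hP.summable_term hc hz).hasSum

theorem semigroup_apply_hasSum (hP : IsProjChain P K) (hc : 0 < c) {z : ℂ} (hz : 0 < z.re) (x : X) :
    HasSum (fun j : ℕ => Complex.exp (-z * (c * 2 ^ j : ℝ)) • succSub P j x)
      (chainSemigroup P c z x) := by
  simpa using (ContinuousLinearMap.apply ℂ X x).hasSum (hP.semigroup_hasSum hc hz)

theorem succSub_semigroup (hP : IsProjChain P K) (hc : 0 < c) {z : ℂ} (hz : 0 < z.re) (i : ℕ)
    (x : X) : succSub P i (chainSemigroup P c z x) =
      Complex.exp (-z * (c * 2 ^ i : ℝ)) • succSub P i x := by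
  have h := (succSub P i).hasSum (hP.semigroup_apply_hasSum hc hz x)
  refine h.unique ?_
  convert hasSum_ite_eq i (Complex.exp (-z * (c * 2 ^ i : ℝ)) • succSub P i x) using 2 with j
  rw [map_smul, hP.succSub_succSub]
  by_cases hij : i = j
  · subst hij; simp
  · simp [hij, Ne.symm hij]

theorem semigroup_add (hP : IsProjChain P K) (hc : 0 < c) {z w : ℂ} (hz : 0 < z.re)
    (hw : 0 < w.re) :
    chainSemigroup P c (z + w) = chainSemigroup P c z * chainSemigroup P c w := by
  ext x
  rw [mul_apply_eq_comp]
  have hzw : 0 < (z + w).re := by simpa using add_pos hz hw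
  refine (hP.semigroup_apply_hasSum hc hzw x).unique ?_
  convert hP.semigroup_apply_hasSum hc hz (chainSemigroup P c w x) using 2 with j
  rw [hP.succSub_semigroup hc hw, smul_smul, ← Complex.exp_add]
  ring_nf

/-- Bounding term by term would blow up as `z → 0`. After Abel summation the coefficient differences
telescope, with the factor `‖z‖ / z.re ≤ 2` valid on the sector of half-angle `π/3`, where the
cosine of the argument is at least `1/2`. -/
theorem norm_semigroup_le (hP : IsProjChain P K) (hc : 0 < c) {z : ℂ}
    (hz : z ∈ sector (Real.pi / 3)) : ‖chainSemigroup P c z‖ ≤ 3 * K := by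
  obtain ⟨hre, hn⟩ := norm_le_two_mul_re_of_mem_sector hz
  refine le_of_tendsto (hP.semigroup_hasSum hc hre).tendsto_sum_nat.norm
    (Eventually.of_forall fun N => ?_)
  rw [sum_smul_succSub_eq P hP.zero (fun j => Complex.exp (-z * (c * 2 ^ j : ℝ)))]
  have hK := hP.nonneg
  have h1 : ‖Complex.exp (-z * (c * 2 ^ N : ℝ)) • P N‖ ≤ Real.exp (-z.re * (c * 2 ^ N)) * K := by
    rw [norm_smul, Complex.norm_exp, Complex.re_mul_ofReal, Complex.neg_re]
    gcongr
    exact hP.bound N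
  have h2 : ‖∑ j ∈ Finset.range N, (Complex.exp (-z * (c * 2 ^ j : ℝ)) -
      Complex.exp (-z * (c * 2 ^ (j + 1) : ℝ))) • P (j + 1)‖ ≤
      2 * K * ∑ j ∈ Finset.range N, (Real.exp (-z.re * (c * 2 ^ j)) -
        Real.exp (-z.re * (c * 2 ^ (j + 1)))) := by
    rw [Finset.mul_sum]
    refine norm_sum_le_of_le _ fun j _ => ?_
    have hle : c * 2 ^ j ≤ c * 2 ^ (j + 1) := by
      have : (0 : ℝ) < c * 2 ^ j := by positivity
      rw [pow_succ]; nlinarith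
    have h3 := norm_cexp_sub_cexp_le hre hle
    have h4 : ‖z‖ / z.re ≤ 2 := by rw [div_le_iff₀ hre]; exact hn
    have h5 : 0 ≤ Real.exp (-z.re * (c * 2 ^ j)) - Real.exp (-z.re * (c * 2 ^ (j + 1))) := by
      rw [sub_nonneg, Real.exp_le_exp]; nlinarith
    rw [norm_smul]
    calc _ ≤ (2 * (Real.exp (-z.re * (c * 2 ^ j)) - Real.exp (-z.re * (c * 2 ^ (j + 1))))) * K := by
          gcongr
          · exact h3.trans (by gcongr)
          · exact hP.bound _
      _ = _ := by ring
  rw [Finset.sum_range_sub' (fun j => Real.exp (-z.re * (c * 2 ^ j)))] at h2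
  have h6 : Real.exp (-z.re * (c * 2 ^ 0)) ≤ 1 := by
    rw [Real.exp_le_one_iff]; simp; positivity
  have h7 := Real.exp_pos (-z.re * (c * 2 ^ N))
  refine (norm_add_le _ _).trans ((add_le_add h1 h2).trans ?_)
  nlinarith [mul_nonneg hK (sub_nonneg.2 h6), mul_nonneg hK h7.le]

theorem semigroup_proj (hP : IsProjChain P K) (hc : 0 < c) {z : ℂ} (hz : 0 < z.re) (N : ℕ)
    (x : X) : chainSemigroup P c z (P N x) =
      ∑ j ∈ Finset.range N, Complex.exp (-z * (c * 2 ^ j : ℝ)) • succSub P j x := by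
  refine (hP.semigroup_apply_hasSum hc hz (P N x)).unique ?_
  convert hasSum_sum_of_ne_finset_zero (s := Finset.range N)
    (L := SummationFilter.unconditional ℕ)
    (f := fun j => Complex.exp (-z * (c * 2 ^ j : ℝ)) • succSub P j (P N x)) ?_ using 1
  · refine Finset.sum_congr rfl fun j hj => ?_
    have := Finset.mem_range.1 hj
    simp [succSub, hP.comp, min_eq_left this.le, min_eq_left (Nat.succ_le_of_lt this)]
  · intro j hj
    have : N ≤ j := by simpa using hj
    simp [succSub, hP.comp, min_eq_right this, min_eq_right (this.trans (Nat.le_succ j))]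

/-- On the range of `P N` the semigroup is a finite sum of exponentials, hence continuous at `0`;
the uniform bound extends this to all vectors. -/
theorem tendsto_semigroup (hP : IsProjChain P K) (hc : 0 < c) (x : X) :
    Tendsto (fun z => chainSemigroup P c z x) (𝓝[sector (Real.pi / 3)] 0) (𝓝 x) := by
  have hK := hP.nonneg
  rw [Metric.tendsto_nhds]
  intro ε hε
  obtain ⟨N, hN⟩ : ∃ N, ‖P N x - x‖ * (3 * K + 1) < ε / 2 := by
    have h1 : Tendsto (fun N => ‖P N x - x‖ * (3 * K + 1)) atTop (𝓝 (0 * (3 * K + 1))) :=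
      (tendsto_iff_norm_sub_tendsto_zero.1 (hP.tendsto x)).mul_const _
    rw [zero_mul] at h1
    exact (h1.eventually (gt_mem_nhds (half_pos hε))).exists
  have h2 : Tendsto (fun z : ℂ =>
      ∑ j ∈ Finset.range N, Complex.exp (-z * (c * 2 ^ j : ℝ)) • succSub P j x)
      (𝓝[sector (Real.pi / 3)] 0) (𝓝 (P N x)) := by
    have h3 : Continuous (fun z : ℂ =>
      ∑ j ∈ Finset.range N, Complex.exp (-z * (c * 2 ^ j : ℝ)) • succSub P j x) := by fun_prop
    have h4 := (h3.tendsto 0).mono_left (nhdsWithin_le_nhds (s := sector (Real.pi / 3)))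
    convert h4 using 2
    conv_lhs => rw [← SchauderBasis.sum_succSub P hP.zero N]
    simp
  filter_upwards [(Metric.tendsto_nhds.1 h2) (ε / 2) (half_pos hε), self_mem_nhdsWithin]
    with z hz1 hz2
  have hre := (norm_le_two_mul_re_of_mem_sector hz2).1
  rw [← hP.semigroup_proj hc hre, dist_eq_norm] at hz1
  rw [dist_eq_norm]
  have h5 : chainSemigroup P c z x - x = (chainSemigroup P c z (P N x) - P N x) +
      (P N x - x) - chainSemigroup P c z (P N x - x) := by rw [map_sub]; abel
  have h6 : ‖chainSemigroup P c z (P N x - x)‖ ≤ 3 * K * ‖P N x - x‖ :=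
    (ContinuousLinearMap.le_opNorm _ _).trans (by gcongr; exact hP.norm_semigroup_le hc hz2)
  rw [h5]
  refine (norm_sub_le _ _).trans_lt ?_
  have := norm_add_le (chainSemigroup P c z (P N x) - P N x) (P N x - x)
  linarith

theorem differentiableOn_semigroup (hP : IsProjChain P K) (hc : 0 < c) :
    DifferentiableOn ℂ (chainSemigroup P c) (sector (Real.pi / 3)) := by
  intro z hz
  have hre := (norm_le_two_mul_re_of_mem_sector hz).1
  refine DifferentiableAt.differentiableWithinAt ?_
  -- On this half-plane the series is dominated by a convergent numerical series, so its sum is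
  -- holomorphic.
  have ho : IsOpen {w : ℂ | z.re / 2 < w.re} := isOpen_lt continuous_const Complex.continuous_re
  have h1 : DifferentiableOn ℂ (fun w : ℂ => ∑' j : ℕ,
      Complex.exp (-w * (c * 2 ^ j : ℝ)) • succSub P j) {w : ℂ | z.re / 2 < w.re} := by
    refine Complex.differentiableOn_tsum_of_summable_norm (summable_bound K (half_pos hre) hc) ?_ ho ?_
    · intro j
      fun_prop
    · intro j w hw
      exact hP.norm_term_le hc (le_of_lt hw) j
  have hmem : {w : ℂ | z.re / 2 < w.re} ∈ 𝓝 z := ho.mem_nhds (by simp; linarith)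
  refine (h1.differentiableAt hmem).congr_of_eventuallyEq ?_
  filter_upwards [hmem] with w hw
  have : w ≠ 0 := by
    rintro rfl
    simp at hw
    linarith
  rw [chainSemigroup, if_neg this]

theorem isBoundedAnalyticSemigroup (hP : IsProjChain P K) (hc : 0 < c) :
    IsBoundedAnalyticSemigroup (Real.pi / 3) (chainSemigroup P c) where
  angle_pos := by positivity
  angle_le := by linarith [Real.pi_pos]
  map_zero := by simp [chainSemigroup]
  map_add z hz w hw := hP.semigroup_add hc (norm_le_two_mul_re_of_mem_sector hz).1
    (norm_le_two_mul_re_of_mem_sector hw).1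
  analytic := hP.differentiableOn_semigroup hc
  tendsto_zero := hP.tendsto_semigroup hc
  bounded := ⟨3 * K, fun _ hz => hP.norm_semigroup_le hc hz⟩

end IsProjChain

/-- The graph of the infinitesimal generator of a family of operators. -/
def generatorGraph (S : ℂ → X →L[ℂ] X) : Submodule ℂ (X × X) where
  carrier := {p | Tendsto (fun t : ℝ => (t : ℂ)⁻¹ • (S (t : ℂ) p.1 - p.1)) (𝓝[>] 0) (𝓝 p.2)}
  zero_mem' := by simp
  add_mem' {p q} hp hq := by
    refine (Tendsto.add hp hq).congr fun t => ?_
    simp only [Prod.fst_add, map_add, ← smul_add]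
    congr 1
    abel
  smul_mem' a p hp := by
    refine (Tendsto.const_smul hp a).congr fun t => ?_
    simp only [Prod.smul_fst, map_smul, ← smul_sub]
    rw [smul_comm]

/-- The infinitesimal generator of a family of operators. -/
def generator (S : ℂ → X →L[ℂ] X) : X →ₗ.[ℂ] X := (generatorGraph S).toLinearPMap

theorem isGenerator_generator (S : ℂ → X →L[ℂ] X) : IsGenerator (generator S) S := by
  intro x y
  rw [generator, Submodule.toLinearPMap_graph_eq]
  · rfl
  -- The graph determines a partial linear map only if it is single-valued, that is, if `(0, b)` in
  -- it forces `b = 0`.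
  · rintro ⟨a, b⟩ hp (h0 : a = 0)
    subst h0
    have hp' : Tendsto (fun t : ℝ => (t : ℂ)⁻¹ • (S (t : ℂ) (0 : X) - 0)) (𝓝[>] 0) (𝓝 b) := hp
    simp only [map_zero, sub_zero, smul_zero] at hp'
    exact tendsto_nhds_unique hp' tendsto_const_nhds

theorem mem_graph_neg {A : X →ₗ.[ℂ] X} {x y : X} : (x, y) ∈ (-A).graph ↔ (x, -y) ∈ A.graph := by
  rw [LinearPMap.neg_graph]
  constructor
  · rintro ⟨⟨a, b⟩, h, he⟩
    simp at he
    obtain ⟨rfl, rfl⟩ := he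
    simpa using h
  · intro h
    exact ⟨(x, -y), h, by simp⟩

/-- Since `Q_j S(t) = exp (-t c 2^j) Q_j`, differentiating at `t = 0` identifies `B` on the summand
`j`. Nothing else about the domain of `B` is needed later. -/
theorem IsProjChain.succSub_of_mem_graph [CompleteSpace X] {P : ℕ → X →L[ℂ] X} {K c : ℝ}
    (hP : IsProjChain P K) (hc : 0 < c) {x y : X}
    (h : (x, y) ∈ (-generator (chainSemigroup P c)).graph) (j : ℕ) :
    succSub P j y = ((c * 2 ^ j : ℝ) : ℂ) • succSub P j x := by
  rw [mem_graph_neg, isGenerator_generator (chainSemigroup P c) x (-y)] at h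
  have h1 := ((succSub P j).continuous.tendsto _).comp h
  have h2 : Tendsto (fun t : ℝ => ((t : ℂ)⁻¹ * (Complex.exp (-(t : ℂ) * (c * 2 ^ j : ℝ)) - 1)) •
      succSub P j x) (𝓝[>] 0) (𝓝 ((-((c * 2 ^ j : ℝ) : ℂ)) • succSub P j x)) := by
    refine Tendsto.smul_const ?_ _
    have h3 : HasDerivAt (fun t : ℝ => Complex.exp (-(t : ℂ) * (c * 2 ^ j : ℝ)))
        (-((c * 2 ^ j : ℝ) : ℂ)) 0 := by
      have h4 : HasDerivAt (fun t : ℝ => -(t : ℂ) * (c * 2 ^ j : ℝ)) (-1 * ((c * 2 ^ j : ℝ) : ℂ)) 0 :=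
        ((Complex.ofRealCLM.hasDerivAt (x := (0 : ℝ))).neg).mul_const _
      simpa using h4.cexp
    have h5 := h3.tendsto_slope_zero_right
    refine h5.congr fun t => ?_
    simp [Complex.real_smul]
  have h6 : Tendsto (fun t : ℝ => ((t : ℂ)⁻¹ * (Complex.exp (-(t : ℂ) * (c * 2 ^ j : ℝ)) - 1)) •
      succSub P j x) (𝓝[>] 0) (𝓝 (succSub P j (-y))) := by
    refine h1.congr' ?_
    filter_upwards [self_mem_nhdsWithin] with t ht
    have ht' : 0 < ((t : ℂ)).re := by simpa using ht
    simp only [Function.comp, map_smul, map_sub, hP.succSub_semigroup hc ht', mul_smul, sub_smul,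
      one_smul]
  have h7 := tendsto_nhds_unique h2 h6
  rw [map_neg, neg_smul, neg_inj] at h7
  exact h7.symm

end MaxReg

/-! ### Maximal regularity on a single summand: scalar Cauchy problems. -/

namespace MaxReg

variable {X : Type*} [NormedAddCommGroup X] [NormedSpace ℂ X]

open SchauderBasis (succSub)

/-- Uniqueness for the scalar Cauchy problem `y' + α y = φ' + α φ`, `y 0 = φ 0 = 0`. -/
theorem ae_eq_of_integral_eq {T : ℝ} {α : ℂ} {y g φ φ' : ℝ → ℂ}
    (hφ : ∀ t, HasDerivAt φ (φ' t) t) (hφ' : Continuous φ') (h0 : φ 0 = 0)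
    (hg : IntegrableOn g (Set.Ico 0 T))
    (hy : ∀ᵐ t ∂(volume.restrict (Set.Ico (0 : ℝ) T)), y t = ∫ s in (0 : ℝ)..t, g s)
    (hgy : ∀ᵐ t ∂(volume.restrict (Set.Ico (0 : ℝ) T)), g t + α * y t = φ' t + α * φ t) :
    ∀ᵐ t ∂(volume.restrict (Set.Ico (0 : ℝ) T)), y t = φ t := by
  have hcφ : Continuous φ := continuous_iff_continuousAt.2 fun t => (hφ t).continuousAt
  -- Cutting `g` off outside the interval makes its primitive continuous on the whole line.
  set g₁ : ℝ → ℂ := (Set.Ico 0 T).indicator g with hg₁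
  have hg₁i : Integrable g₁ := (integrable_indicator_iff measurableSet_Ico).2 hg
  set Y : ℝ → ℂ := fun t => ∫ s in (0 : ℝ)..t, g₁ s with hY
  have hYc : Continuous Y :=
    intervalIntegral.continuous_primitive (fun a b => hg₁i.intervalIntegrable) 0
  have hYeq : ∀ t ∈ Set.Ico 0 T, ∫ s in (0 : ℝ)..t, g s = Y t := by
    intro t ht
    refine intervalIntegral.integral_congr fun s hs => ?_
    rw [Set.uIcc_of_le ht.1] at hs
    have : s ∈ Set.Ico 0 T := ⟨hs.1, hs.2.trans_lt ht.2⟩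
    simp [hg₁, this]
  set k : ℝ → ℂ := fun t => φ' t + α * φ t - α * Y t with hk
  have hkc : Continuous k := by fun_prop
  have hae : ∀ᵐ t, t ∈ Set.Ico (0 : ℝ) T → g₁ t = k t := by
    rw [ae_restrict_iff' measurableSet_Ico] at hy hgy
    filter_upwards [hy, hgy] with t h1 h2 ht
    have h3 := h2 ht
    rw [h1 ht, hYeq t ht] at h3
    simp only [hg₁, hk, Set.indicator_of_mem ht]
    linear_combination h3
  have hYk : ∀ t ∈ Set.Ico 0 T, Y t = ∫ s in (0 : ℝ)..t, k s := by
    intro t ht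
    refine intervalIntegral.integral_congr_ae ?_
    filter_upwards [hae] with s hs hst
    rw [Set.uIoc_of_le ht.1] at hst
    exact hs ⟨hst.1.le, hst.2.trans_lt ht.2⟩
  have hYd : ∀ t ∈ Set.Ico 0 T, HasDerivWithinAt Y (k t) (Set.Ici t) t := by
    intro t ht
    have h1 : HasDerivAt (fun u => ∫ s in (0 : ℝ)..u, k s) (k t) t :=
      intervalIntegral.integral_hasDerivAt_right (hkc.intervalIntegrable _ _)
        hkc.stronglyMeasurable.stronglyMeasurableAtFilter hkc.continuousAt
    refine h1.hasDerivWithinAt.congr_of_eventuallyEq ?_ (hYk t ht)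
    filter_upwards [self_mem_nhdsWithin, mem_nhdsWithin_of_mem_nhds (gt_mem_nhds ht.2)] with s hs1 hs2
    exact hYk s ⟨ht.1.trans hs1, hs2⟩
  have hfin : ∀ t ∈ Set.Ico 0 T, Y t = φ t := by
    intro t ht
    -- Integrating factor: `exp (α s) (Y s - φ s)` has right derivative zero and vanishes at `0`.
    have h2 := constant_of_has_deriv_right_zero (a := 0) (b := t)
      (f := fun s : ℝ => Complex.exp (α * s) * (Y s - φ s)) (by fun_prop) ?_ t
      (Set.right_mem_Icc.2 ht.1)
    · have h3 : Y 0 = 0 := by simp [hY]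
      simp only [h3, h0, sub_zero, mul_zero, mul_eq_zero, Complex.exp_ne_zero, false_or] at h2
      exact sub_eq_zero.1 h2
    · intro s hs
      have hs' : s ∈ Set.Ico 0 T := ⟨hs.1, hs.2.trans ht.2⟩
      have h4 : HasDerivAt (fun s : ℝ => α * (s : ℂ)) α s := by
        simpa using (Complex.ofRealCLM.hasDerivAt (x := s)).const_mul α
      have h5 := (h4.cexp.hasDerivWithinAt (s := Set.Ici s)).mul
        ((hYd s hs').sub (hφ s).hasDerivWithinAt)
      refine h5.congr_deriv ?_
      simp only [hk, Pi.sub_apply]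
      ring
  rw [ae_restrict_iff' measurableSet_Ico] at hy ⊢
  filter_upwards [hy] with t h1 ht
  rw [h1 ht, hYeq t ht, hfin t ht]

theorem exists_integral_norm_le (T : ℝ) (X : Type*) [NormedAddCommGroup X] :
    ∃ D : ℝ, 0 ≤ D ∧ ∀ w : L2 T X,
      IntegrableOn w (Set.Ico 0 T) ∧ ∫ t in Set.Ico (0 : ℝ) T, ‖w t‖ ≤ D * ‖w‖ := by
  set μ := volume.restrict (Set.Ico (0 : ℝ) T)
  refine ⟨(μ Set.univ ^ (1 / (1 : ENNReal).toReal - 1 / (2 : ENNReal).toReal)).toReal,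
    ENNReal.toReal_nonneg, fun w => ⟨(Lp.memLp w).integrable (by norm_num), ?_⟩⟩
  have h1 := eLpNorm_le_eLpNorm_mul_rpow_measure_univ (μ := μ) (p := 1) (q := 2) (by norm_num)
    (Lp.aestronglyMeasurable w)
  rw [integral_norm_eq_lintegral_enorm (Lp.aestronglyMeasurable w),
    ← eLpNorm_one_eq_lintegral_enorm, Lp.norm_def, ← ENNReal.toReal_mul, mul_comm]
  refine ENNReal.toReal_mono ?_ h1
  refine ENNReal.mul_ne_top (Lp.eLpNorm_ne_top w) (ENNReal.rpow_ne_top_of_nonneg ?_ ?_)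
  · norm_num
  · exact measure_ne_top _ _

/-- Maximal regularity for the operator `∑ c 2^j Q_j` of a Schauder decomposition, read off on
functionals that live on a single summand. -/
theorem IsProjChain.exists_response [CompleteSpace X] {T : ℝ} (hX : MRP T X)
    {P : ℕ → X →L[ℂ] X} {K c : ℝ} (hP : IsProjChain P K) (hc : 0 < c) :
    ∃ C : ℝ, 0 ≤ C ∧ ∀ (m : ℕ) (f : ℝ → X) (M : ℝ), Continuous f → 0 ≤ M →
      (∀ t ∈ Set.Ico 0 T, ‖f t‖ ≤ M) →
      ∃ w : ℝ → X, IntegrableOn w (Set.Ico 0 T) ∧ ∫ t in Set.Ico (0 : ℝ) T, ‖w t‖ ≤ C * M ∧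
        ∀ j < m, ∀ p : StrongDual ℂ X, (∀ x, p (succSub P j x) = p x) →
        ∀ φ φ' : ℝ → ℂ, (∀ t, HasDerivAt φ (φ' t) t) → Continuous φ' → φ 0 = 0 →
        (∀ t ∈ Set.Ico 0 T, p (f t) = φ' t + (c * 2 ^ j : ℝ) * φ t) →
        ∀ᵐ t ∂(volume.restrict (Set.Ico (0 : ℝ) T)), p (w t) = (c * 2 ^ j : ℝ) * φ t := by
  have hgen : GeneratesBoundedAnalyticSemigroup (-(-generator (chainSemigroup P c))) := by
    rw [neg_neg]
    exact ⟨_, _, hP.isBoundedAnalyticSemigroup hc, isGenerator_generator _⟩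
  obtain ⟨R, hR⟩ := hX _ hgen
  set μ := volume.restrict (Set.Ico (0 : ℝ) T) with hμ
  -- Bounded truncations of `B`: they agree with `B` on the summands below `m`, so `Cm m ∘ R` can
  -- replace the operator `B R`.
  let Cm : ℕ → X →L[ℂ] X := fun m =>
    ∑ j ∈ Finset.range m, ((c * 2 ^ j : ℝ) : ℂ) • succSub P j
  let F : ℕ → L2 T X →L[ℂ] L2 T X := fun m => ((Cm m).compLpL 2 μ).comp R
  -- With `w = B (R f)`, one has `F m f = P m w`, which is bounded in `m` for each `f`; the uniform
  -- boundedness principle makes the bound independent of both `m` and `f`.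
  have hF : ∃ C', ∀ m, ‖F m‖ ≤ C' := by
    refine banach_steinhaus fun f => ?_
    obtain ⟨v, w, -, hw, -⟩ := (hR (R f) f).2 rfl
    refine ⟨K * ‖w‖, fun m => ?_⟩
    refine Lp.norm_le_mul_norm_of_ae_le_mul ?_
    filter_upwards [(Cm m).coeFn_compLpL (p := 2) (μ := μ) (R f), hw] with t h1 h2
    have h3 : (F m f) t = P m (w t) := by
      refine h1.trans ?_
      rw [← SchauderBasis.sum_succSub P hP.zero m]
      simp only [Cm, _root_.sum_apply, _root_.smul_apply]
      exact Finset.sum_congr rfl fun j _ => (hP.succSub_of_mem_graph hc h2 j).symm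
    rw [h3]
    exact (P m).le_of_opNorm_le (hP.bound m) _
  obtain ⟨C₁, hC₁⟩ := hF
  obtain ⟨D, hD0, hD⟩ := exists_integral_norm_le T X
  have hC₁0 : 0 ≤ C₁ := (norm_nonneg _).trans (hC₁ 0)
  refine ⟨D * (C₁ * ((measureUnivNNReal μ : ℝ) ^ (2 : ENNReal).toReal⁻¹)), by positivity, ?_⟩
  intro m f M hf hM hfM
  have hfM' : ∀ᵐ t ∂μ, ‖f t‖ ≤ M :=
    (ae_restrict_iff' measurableSet_Ico).2 (Eventually.of_forall hfM)
  have hfm : MemLp f 2 μ := MemLp.of_bound hf.aestronglyMeasurable M hfM'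
  set f' : L2 T X := hfm.toLp f with hf'
  have hff : f' =ᵐ[μ] f := hfm.coeFn_toLp
  have hfn : ‖f'‖ ≤ (measureUnivNNReal μ : ℝ) ^ (2 : ENNReal).toReal⁻¹ * M := by
    refine Lp.norm_le_of_ae_bound hM ?_
    filter_upwards [hff, hfM'] with t h1 h2
    rwa [h1]
  obtain ⟨hi, hn⟩ := hD (F m f')
  refine ⟨F m f', hi, hn.trans ?_, ?_⟩
  · rw [mul_assoc, mul_assoc]
    gcongr
    exact ((F m).le_of_opNorm_le (hC₁ m) _).trans (by gcongr)
  · intro j hj p hp φ φ' hφ hφ' h0 hpf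
    obtain ⟨v, w, hv, hw, hvw⟩ := (hR (R f') f').2 rfl
    have hvi : Integrable v μ := (Lp.memLp v).integrable (by norm_num)
    have hu : ∀ᵐ t ∂μ, p (R f' t) = φ t := by
      refine ae_eq_of_integral_eq (g := fun t => p (v t)) (α := (c * 2 ^ j : ℝ)) hφ hφ' h0
        (p.integrable_comp hvi) ?_ ?_
      · have hmem : ∀ᵐ t ∂μ, t ∈ Set.Ico 0 T := ae_restrict_mem measurableSet_Ico
        filter_upwards [hv, hmem] with t h1 ht
        rw [h1, ContinuousLinearMap.intervalIntegral_comp_comm]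
        rw [intervalIntegrable_iff_integrableOn_Ioo_of_le ht.1]
        exact IntegrableOn.mono_set hvi (fun s hs => ⟨hs.1.le, hs.2.trans ht.2⟩)
      · have hmem : ∀ᵐ t ∂μ, t ∈ Set.Ico 0 T := ae_restrict_mem measurableSet_Ico
        filter_upwards [hw, hmem, hff, Lp.coeFn_add v w] with t h1 ht h2 h3
        have h4 : f t = v t + w t := by rw [← h2, ← hvw, h3, Pi.add_apply]
        rw [← hpf t ht, h4, map_add, ← hp (w t), hP.succSub_of_mem_graph hc h1, map_smul, hp,
          smul_eq_mul]
    filter_upwards [hu, (Cm m).coeFn_compLpL (p := 2) (μ := μ) (R f')] with t h1 h2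
    have h3 : (F m f') t = Cm m (R f' t) := h2
    rw [h3, ← h1, ← hp]
    simp only [Cm, _root_.sum_apply, _root_.smul_apply, map_sum, map_smul,
      hP.succSub_succSub]
    rw [Finset.sum_eq_single j]
    · simp [hp]
    · intro i _ hij
      simp [Ne.symm hij]
    · intro h
      exact absurd (Finset.mem_range.2 hj) h

end MaxReg

/-! ### A forcing with sinusoidal net response, and decompositions from biorthogonal systems. -/

namespace MaxReg

variable {X : Type*} [NormedAddCommGroup X] [NormedSpace ℂ X]

open SchauderBasis (succSub)

theorem tendsto_of_dense_of_norm_le {ι : Type*} {l : Filter ι} {P : ι → X →L[ℂ] X} {K : ℝ}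
    (hK : ∀ i, ‖P i‖ ≤ K) {s : Set X} (hs : Dense s)
    (h : ∀ x ∈ s, Tendsto (fun i => P i x) l (𝓝 x)) (x : X) :
    Tendsto (fun i => P i x) l (𝓝 x) := by
  rcases isEmpty_or_nonempty ι with hι | ⟨⟨i₀⟩⟩
  · rw [Filter.filter_eq_bot_of_isEmpty l]
    exact tendsto_bot
  have hK0 : 0 ≤ K := (norm_nonneg _).trans (hK i₀)
  rw [Metric.tendsto_nhds]
  intro ε hε
  obtain ⟨y, hy, hxy⟩ := Metric.mem_closure_iff.1 (hs x) (ε / 2 / (K + 1)) (by positivity)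
  rw [lt_div_iff₀ (by positivity), dist_eq_norm] at hxy
  filter_upwards [Metric.tendsto_nhds.1 (h y hy) (ε / 2) (half_pos hε)] with i hi
  rw [dist_eq_norm] at hi ⊢
  have h1 : P i x - x = P i (x - y) + (P i y - y) - (x - y) := by rw [map_sub]; abel
  have h2 := (P i).le_of_opNorm_le (hK i) (x - y)
  rw [h1]
  have h3 := norm_sub_le (P i (x - y) + (P i y - y)) (x - y)
  have h4 := norm_add_le (P i (x - y)) (P i y - y)
  linarith

/-- The forcing term whose responses at the decay rates `α` and `2α` differ by `sin (α t)`. -/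
def pairForcing (α t : ℝ) : ℝ := Real.cos (α * t) - 3 * Real.sin (α * t) - 2

theorem abs_pairForcing_le (α t : ℝ) : |pairForcing α t| ≤ 6 := by
  have h1 := Real.cos_le_one (α * t)
  have h2 := Real.neg_one_le_cos (α * t)
  have h3 := Real.sin_le_one (α * t)
  have h4 := Real.neg_one_le_sin (α * t)
  rw [pairForcing, abs_le]
  constructor <;> linarith

@[fun_prop]
theorem continuous_pairForcing (α : ℝ) : Continuous (pairForcing α) := by
  unfold pairForcing
  fun_prop

/-- For `κ = 2` this function solves `φ' + α φ = μ * pairForcing α`, and for `κ = 1` it solves `φ' +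
2α φ = μ * pairForcing α`, both with `φ 0 = 0`. -/
theorem hasDerivAt_response (κ α t : ℝ) (hα : α ≠ 0) (μ : ℂ) :
    HasDerivAt (fun t : ℝ => μ * (((-κ * (1 - Real.cos (α * t)) - Real.sin (α * t)) / α : ℝ) : ℂ))
      (μ * ((-κ * Real.sin (α * t) - Real.cos (α * t) : ℝ) : ℂ)) t := by
  have h0 : HasDerivAt (fun t : ℝ => α * t) α t := by
    simpa using (hasDerivAt_id t).const_mul α
  have h1 := (((h0.cos.const_sub 1).const_mul (-κ)).sub h0.sin).div_const α
  refine (h1.ofReal_comp.const_mul μ).congr_deriv ?_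
  congr 2
  field_simp

/-- Consecutive summands have rates `α` and `2α`. With opposite forcings on the two, the constant
and cosine parts of the outputs `α φ` and `2α φ` cancel, and only `sin (α t)` remains. -/
theorem IsProjChain.exists_pair_response [CompleteSpace X] {T : ℝ} (hX : MRP T X)
    {P : ℕ → X →L[ℂ] X} {K c : ℝ} (hP : IsProjChain P K) (hc : 0 < c) :
    ∃ C : ℝ, 0 ≤ C ∧ ∀ (m : ℕ) (f : ℝ → X) (M : ℝ), Continuous f → 0 ≤ M →
      (∀ t ∈ Set.Ico 0 T, ‖f t‖ ≤ M) →
      ∃ w : ℝ → X, IntegrableOn w (Set.Ico 0 T) ∧ ∫ t in Set.Ico (0 : ℝ) T, ‖w t‖ ≤ C * M ∧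
        (∀ j < m, ∀ p q : StrongDual ℂ X, (∀ x, p (succSub P j x) = p x) →
        (∀ x, q (succSub P (j + 1) x) = q x) → ∀ μ : ℂ,
        (∀ t ∈ Set.Ico 0 T, p (f t) = μ * pairForcing (c * 2 ^ j) t) →
        (∀ t ∈ Set.Ico 0 T, q (f t) = -(μ * pairForcing (c * 2 ^ j) t)) →
        ∀ᵐ t ∂(volume.restrict (Set.Ico (0 : ℝ) T)),
          p (w t) + q (w t) = μ * Real.sin (c * 2 ^ j * t)) ∧
        (∀ j < m, ∀ p : StrongDual ℂ X, (∀ x, p (succSub P j x) = p x) →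
          (∀ t ∈ Set.Ico 0 T, p (f t) = 0) →
          ∀ᵐ t ∂(volume.restrict (Set.Ico (0 : ℝ) T)), p (w t) = 0) := by
  obtain ⟨C, hC, H⟩ := hP.exists_response hX hc
  refine ⟨C, hC, fun m f M hf hM hfM => ?_⟩
  -- A pair starting at `j < m` also uses the summand `j + 1`.
  obtain ⟨w, hw1, hw2, hw3⟩ := H (m + 1) f M hf hM hfM
  refine ⟨w, hw1, hw2, ?_, ?_⟩
  · intro j hj p q hp hq μ hpf hqf
    set α : ℝ := c * 2 ^ j with hα
    have hα0 : α ≠ 0 := by positivity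
    have hα2 : c * 2 ^ (j + 1) = 2 * α := by rw [hα]; ring
    have e1 := hw3 j (by omega) p hp _ _ (fun t => hasDerivAt_response 2 α t hα0 μ)
      (by fun_prop) (by simp) ?_
    · have e2 := hw3 (j + 1) (by omega) q hq _ _ (fun t => hasDerivAt_response 1 α t hα0 (-μ))
        (by fun_prop) (by simp) ?_
      · filter_upwards [e1, e2] with t h1 h2
        rw [h1, h2, hα2, ← hα]
        have : (α : ℂ) ≠ 0 := by exact_mod_cast hα0
        push_cast
        field_simp
        ring
      · intro t ht
        rw [hqf t ht, pairForcing, hα2]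
        have : (α : ℂ) ≠ 0 := by exact_mod_cast hα0
        push_cast
        field_simp
        ring
    · intro t ht
      rw [hpf t ht, pairForcing, ← hα]
      have : (α : ℂ) ≠ 0 := by exact_mod_cast hα0
      push_cast
      field_simp
      ring
  · intro j hj p hp hpf
    have := hw3 j (by omega) p hp (fun _ => 0) (fun _ => 0) (fun t => hasDerivAt_const t 0)
      continuous_const rfl (by simpa using hpf)
    simpa using this

section Biorthogonal

variable {Λ : Type*} [DecidableEq Λ]

theorem apply_sum_smulRight {x : Λ → X} {xs : Λ → StrongDual ℂ X}
    (hbi : ∀ a b, xs a (x b) = if a = b then 1 else 0) (F : Finset Λ) (a : Λ) (z : X) :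
    xs a ((∑ b ∈ F, (xs b).smulRight (x b)) z) = if a ∈ F then xs a z else 0 := by
  simp [_root_.sum_apply, hbi]

/-- Elements with equal `ord` form one summand, so the order need not be injective. This allows many
Walsh characters to share a position. -/
theorem isProjChain_of_biorthogonal {x : Λ → X} {xs : Λ → StrongDual ℂ X}
    (hbi : ∀ a b, xs a (x b) = if a = b then 1 else 0)
    (hd : Dense (Submodule.span ℂ (Set.range x) : Set X)) {ord : Λ → ℕ} {F : ℕ → Finset Λ}
    (hF : ∀ j a, a ∈ F j ↔ ord a < j) {K : ℝ}
    (hK : ∀ j, ‖∑ a ∈ F j, (xs a).smulRight (x a)‖ ≤ K) :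
    IsProjChain (fun j => ∑ a ∈ F j, (xs a).smulRight (x a)) K where
  zero := by
    have : F 0 = ∅ := by ext a; simp [hF]
    simp [this]
  bound := hK
  comp i j z := by
    have hij : F (min i j) = (F j).filter (· ∈ F i) := by ext a; simp [hF, and_comm]
    rw [hij, Finset.sum_filter]
    simp only [_root_.sum_apply, ContinuousLinearMap.smulRight_apply, map_sum, map_smul, hbi]
    refine Finset.sum_congr rfl fun a ha => ?_
    by_cases h : a ∈ F i <;> simp [h]
  tendsto := by
    refine tendsto_of_dense_of_norm_le hK hd fun z hz => ?_
    induction hz using Submodule.span_induction with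
    | mem z hz =>
      obtain ⟨b, rfl⟩ := hz
      refine tendsto_const_nhds.congr' ?_
      filter_upwards [eventually_gt_atTop (ord b)] with j hj
      simp [_root_.sum_apply, hbi, hF, hj]
    | zero => simp
    | add u v _ _ hu hv => simpa only [map_add] using hu.add hv
    | smul r u _ hu => simpa only [map_smul] using hu.const_smul r

theorem apply_succSub_of_biorthogonal {x : Λ → X} {xs : Λ → StrongDual ℂ X}
    (hbi : ∀ a b, xs a (x b) = if a = b then 1 else 0) {ord : Λ → ℕ} {F : ℕ → Finset Λ}
    (hF : ∀ j a, a ∈ F j ↔ ord a < j) (a : Λ) (z : X) :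
    xs a (succSub (fun j => ∑ a ∈ F j, (xs a).smulRight (x a)) (ord a) z) = xs a z := by
  rw [succSub, _root_.sub_apply, map_sub, apply_sum_smulRight hbi, apply_sum_smulRight hbi]
  simp [hF]

end Biorthogonal

end MaxReg

/-! ### Twisting a biorthogonal system along a matching. -/

namespace MaxReg

variable {X : Type*} [NormedAddCommGroup X] [NormedSpace ℂ X]
variable {Λ : Type*}

open scoped Classical in
/-- The vectors of the biorthogonal system twisted along `τ : A → Aᶜ`. -/
def twist (y : Λ → X) (A : Set Λ) (τ : Λ → Λ) (a : Λ) : X := if a ∈ A then y a + y (τ a) else y a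

open scoped Classical in
/-- The functionals of the biorthogonal system twisted along `τ : A → Aᶜ`. -/
def cotwist (ys : Λ → StrongDual ℂ X) (A : Set Λ) (τ : Λ → Λ) (b : Λ) : StrongDual ℂ X :=
  if h : ∃ a ∈ A, τ a = b then ys b - ys h.choose else ys b

theorem twist_of_mem {y : Λ → X} {A : Set Λ} {τ : Λ → Λ} {a : Λ} (h : a ∈ A) :
    twist y A τ a = y a + y (τ a) := if_pos h

theorem twist_of_notMem {y : Λ → X} {A : Set Λ} {τ : Λ → Λ} {a : Λ} (h : a ∉ A) :
    twist y A τ a = y a := if_neg h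

theorem cotwist_of_mem {ys : Λ → StrongDual ℂ X} {A : Set Λ} {τ : Λ → Λ} (hτ : Set.InjOn τ A)
    {a : Λ} (h : a ∈ A) : cotwist ys A τ (τ a) = ys (τ a) - ys a := by
  have h1 : ∃ a' ∈ A, τ a' = τ a := ⟨a, h, rfl⟩
  rw [cotwist, dif_pos h1, hτ h1.choose_spec.1 h h1.choose_spec.2]

theorem cotwist_of_notMem {ys : Λ → StrongDual ℂ X} {A : Set Λ} {τ : Λ → Λ} {b : Λ}
    (h : b ∉ τ '' A) : cotwist ys A τ b = ys b := by
  rw [cotwist, dif_neg]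
  exact fun h' => h h'

variable [DecidableEq Λ]

theorem twist_biorthogonal {y : Λ → X} {ys : Λ → StrongDual ℂ X}
    (hbi : ∀ a b, ys a (y b) = if a = b then 1 else 0) {A : Set Λ} {τ : Λ → Λ}
    (hτ : Set.InjOn τ A) (hτA : ∀ a ∈ A, τ a ∉ A) (b a : Λ) :
    cotwist ys A τ b (twist y A τ a) = if b = a then 1 else 0 := by
  by_cases hb : b ∈ τ '' A
  · obtain ⟨c, hc, rfl⟩ := hb
    rw [cotwist_of_mem hτ hc, _root_.sub_apply]
    by_cases ha : a ∈ A
    · have h1 : τ c ≠ a := fun h => hτA c hc (h ▸ ha)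
      have h2 : c ≠ τ a := fun h => hτA a ha (h ▸ hc)
      have h3 : τ c = τ a ↔ c = a := hτ.eq_iff hc ha
      simp [twist_of_mem ha, hbi, h1, h2, h3]
    · have h1 : c ≠ a := fun h => ha (h ▸ hc)
      simp [twist_of_notMem ha, hbi, h1]
  · rw [cotwist_of_notMem hb]
    by_cases ha : a ∈ A
    · have h1 : b ≠ τ a := fun h => hb ⟨a, ha, h.symm⟩
      simp [twist_of_mem ha, hbi, h1]
    · simp [twist_of_notMem ha, hbi]

theorem dense_span_twist {y : Λ → X} {A : Set Λ} {τ : Λ → Λ} (hτA : ∀ a ∈ A, τ a ∉ A)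
    (hd : Dense (Submodule.span ℂ (Set.range y) : Set X)) :
    Dense (Submodule.span ℂ (Set.range (twist y A τ)) : Set X) := by
  refine hd.mono (Submodule.span_le.2 ?_)
  have h0 : ∀ a ∉ A, y a ∈ Submodule.span ℂ (Set.range (twist y A τ)) := fun a ha =>
    Submodule.subset_span ⟨a, twist_of_notMem ha⟩
  rintro _ ⟨a, rfl⟩
  by_cases ha : a ∈ A
  · have h1 : y a = twist y A τ a - y (τ a) := by rw [twist_of_mem ha]; abel
    rw [h1]
    exact Submodule.sub_mem _ (Submodule.subset_span ⟨a, rfl⟩) (h0 _ (hτA a ha))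
  · exact h0 a ha

/-- When `F` contains both `a` and `τ a`, the extra vector `y (τ a)` and the extra functional `-ys
a` cancel. Only the pairs that `F` separates leave a rank-one remainder. -/
theorem sum_twist_eq {y : Λ → X} {ys : Λ → StrongDual ℂ X} {A : Set Λ} [DecidablePred (· ∈ A)]
    {τ : Λ → Λ} (hτ : Set.InjOn τ A) (hτA : ∀ a ∈ A, τ a ∉ A) {F : Finset Λ}
    (hF : ∀ a ∈ A, τ a ∈ F → a ∈ F) :
    ∑ a ∈ F, (cotwist ys A τ a).smulRight (twist y A τ a) =
      ∑ a ∈ F, (ys a).smulRight (y a) +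
        ∑ a ∈ F with a ∈ A ∧ τ a ∉ F, (ys a).smulRight (y (τ a)) := by
  classical
  have h1 : ∀ a ∈ F, (cotwist ys A τ a).smulRight (twist y A τ a) =
      (ys a).smulRight (y a) + (if a ∈ A then (ys a).smulRight (y (τ a)) else 0) -
        (if a ∈ τ '' A then (ys a - cotwist ys A τ a).smulRight (y a) else 0) := by
    intro a _
    by_cases hb : a ∈ τ '' A
    · have ha : a ∉ A := by
        obtain ⟨c, hc, rfl⟩ := hb
        exact hτA c hc
      ext z
      simp [hb, ha, twist_of_notMem ha, sub_smul]
    · rw [cotwist_of_notMem hb]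
      by_cases ha : a ∈ A
      · ext z
        simp [hb, ha, twist_of_mem ha]
      · ext z
        simp [hb, ha, twist_of_notMem ha]
  rw [Finset.sum_congr rfl h1, Finset.sum_sub_distrib, Finset.sum_add_distrib, add_sub_assoc]
  congr 1
  rw [← Finset.sum_filter, ← Finset.sum_filter]
  have h2 : ∑ b ∈ F with b ∈ τ '' A, (ys b - cotwist ys A τ b).smulRight (y b) =
      ∑ a ∈ F with a ∈ A ∧ τ a ∈ F, (ys a).smulRight (y (τ a)) := by
    symm
    refine Finset.sum_bij (fun a _ => τ a) ?_ ?_ ?_ ?_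
    · intro a ha
      simp only [Finset.mem_filter] at ha ⊢
      exact ⟨ha.2.2, a, ha.2.1, rfl⟩
    · intro a ha b hb hab
      simp only [Finset.mem_filter] at ha hb
      exact hτ ha.2.1 hb.2.1 hab
    · intro b hb
      simp only [Finset.mem_filter] at hb
      obtain ⟨hbF, a, ha, rfl⟩ := hb
      exact ⟨a, by simp [hF a ha hbF, ha, hbF], rfl⟩
    · intro a ha
      simp only [Finset.mem_filter] at ha
      rw [cotwist_of_mem hτ ha.2.1, sub_sub_cancel]
  rw [h2, sub_eq_iff_eq_add, ← Finset.sum_filter_add_sum_filter_not (F.filter (· ∈ A))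
    (fun a => τ a ∉ F)]
  simp [Finset.filter_filter]

/-- The response of the maximal regularity problem for a twisted biorthogonal system. -/
theorem exists_twist_response [CompleteSpace X] {T : ℝ} (hX : MRP T X) {c : ℝ} (hc : 0 < c)
    {y : Λ → X} {ys : Λ → StrongDual ℂ X}
    (hbi : ∀ a b, ys a (y b) = if a = b then 1 else 0)
    (hd : Dense (Submodule.span ℂ (Set.range y) : Set X)) {ord : Λ → ℕ} {F : ℕ → Finset Λ}
    (hF : ∀ j a, a ∈ F j ↔ ord a < j) {K : ℝ}
    (hK : ∀ j, ‖∑ a ∈ F j, (ys a).smulRight (y a)‖ ≤ K)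
    {A : Set Λ} {τ : Λ → Λ} (hτ : ∀ a ∈ A, ord (τ a) = ord a + 1) (hτA : ∀ a ∈ A, τ a ∉ A)
    (hord : Set.InjOn ord A) (hK' : ∀ a ∈ A, ‖ys a‖ * ‖y (τ a)‖ ≤ K) :
    ∃ C : ℝ, 0 ≤ C ∧ ∀ (s : Finset Λ) (f : ℝ → X) (M : ℝ), Continuous f → 0 ≤ M →
      (∀ t ∈ Set.Ico 0 T, ‖f t‖ ≤ M) →
      ∃ w : ℝ → X, IntegrableOn w (Set.Ico 0 T) ∧ ∫ t in Set.Ico (0 : ℝ) T, ‖w t‖ ≤ C * M ∧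
        (∀ a ∈ s, a ∈ A → ∀ μ : ℂ,
          (∀ t ∈ Set.Ico 0 T, ys a (f t) = μ * pairForcing (c * 2 ^ ord a) t) →
          (∀ t ∈ Set.Ico 0 T, ys (τ a) (f t) = 0) →
          ∀ᵐ t ∂(volume.restrict (Set.Ico (0 : ℝ) T)),
            ys (τ a) (w t) = μ * Real.sin (c * 2 ^ ord a * t)) ∧
        (∀ b ∈ s, b ∉ A → b ∉ τ '' A → (∀ t ∈ Set.Ico 0 T, ys b (f t) = 0) →
          ∀ᵐ t ∂(volume.restrict (Set.Ico (0 : ℝ) T)), ys b (w t) = 0) := by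
  classical
  have hτi : Set.InjOn τ A := fun a ha b hb h => hord ha hb (by
    have h1 := hτ a ha
    have h2 := hτ b hb
    rw [h] at h1
    omega)
  have hbi' := twist_biorthogonal hbi hτi hτA
  have hK0 : 0 ≤ K := (norm_nonneg _).trans (hK 0)
  have hP := isProjChain_of_biorthogonal (K := K + K) hbi' (dense_span_twist hτA hd) hF ?_
  · obtain ⟨C, hC, H⟩ := hP.exists_pair_response hX hc
    refine ⟨C, hC, fun s f M hf hM hfM => ?_⟩
    obtain ⟨w, hw1, hw2, hw3, hw4⟩ := H (s.sup ord + 1) f M hf hM hfM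
    refine ⟨w, hw1, hw2, ?_, ?_⟩
    · intro a has ha μ h1 h2
      have haA : a ∉ τ '' A := by
        rintro ⟨b, hb, rfl⟩
        exact hτA b hb ha
      -- The twisted functionals are `ys a` and `ys (τ a) - ys a`. They see the forcings `h` and
      -- `-h`, with `h = μ * pairForcing`, and their sum is `ys (τ a)`.
      have h3 := hw3 (ord a) (Nat.lt_succ_of_le (Finset.le_sup (f := ord) has))
        (cotwist ys A τ a) (cotwist ys A τ (τ a))
        (apply_succSub_of_biorthogonal hbi' hF a)
        (by rw [← hτ a ha]; exact apply_succSub_of_biorthogonal hbi' hF (τ a)) μ ?_ ?_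
      · filter_upwards [h3] with t ht
        rw [cotwist_of_notMem haA, cotwist_of_mem hτi ha] at ht
        simpa using ht
      · intro t ht
        rw [cotwist_of_notMem haA, h1 t ht]
      · intro t ht
        rw [cotwist_of_mem hτi ha, _root_.sub_apply, h1 t ht, h2 t ht, zero_sub]
    · intro b hbs hbA hbτ h1
      have h2 := hw4 (ord b) (Nat.lt_succ_of_le (Finset.le_sup (f := ord) hbs))
        (cotwist ys A τ b) (apply_succSub_of_biorthogonal hbi' hF b) ?_
      · rwa [cotwist_of_notMem hbτ] at h2
      · rwa [cotwist_of_notMem hbτ]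
  · intro j
    rw [sum_twist_eq hτi hτA]
    · refine (norm_add_le _ _).trans (add_le_add (hK j) ?_)
      -- Since `τ a` sits at `ord a + 1`, an initial segment separates only a pair with `ord a = j -
      -- 1`, and `ord` is injective on `A`.
      have hcard : (F j |>.filter fun a => a ∈ A ∧ τ a ∉ F j).card ≤ 1 := by
        rw [Finset.card_le_one]
        intro a ha b hb
        simp only [Finset.mem_filter, hF] at ha hb
        refine hord ha.2.1 hb.2.1 ?_
        have h1 := hτ a ha.2.1
        have h2 := hτ b hb.2.1
        omega
      refine (norm_sum_le_of_le (f := fun a => (ys a).smulRight (y (τ a))) (n := fun _ => K) _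
        fun a ha => ?_).trans ?_
      · rw [ContinuousLinearMap.norm_smulRight_apply]
        exact hK' a (Finset.mem_filter.1 ha).2.1
      · rw [Finset.sum_const, nsmul_eq_mul]
        have : ((F j |>.filter fun a => a ∈ A ∧ τ a ∉ F j).card : ℝ) ≤ 1 := by exact_mod_cast hcard
        nlinarith
    · intro a ha h
      rw [hF] at h ⊢
      rw [hτ a ha] at h
      omega

end MaxReg

/-! ### Multipliers of an unconditional basis and averaging against sines. -/

namespace MaxReg

variable {X : Type*} [NormedAddCommGroup X] [NormedSpace ℂ X]

theorem sum_abs_le_of_subset_sums {ι : Type*} (s : Finset ι) (z : ι → ℝ) {B : ℝ}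
    (h : ∀ t ⊆ s, |∑ i ∈ t, z i| ≤ B) : ∑ i ∈ s, |z i| ≤ 2 * B := by
  classical
  rw [← Finset.sum_filter_add_sum_filter_not s (fun i => 0 ≤ z i)]
  have h1 : ∑ i ∈ s with 0 ≤ z i, |z i| = ∑ i ∈ s with 0 ≤ z i, z i :=
    Finset.sum_congr rfl fun i hi => abs_of_nonneg (Finset.mem_filter.1 hi).2
  have h2 : ∑ i ∈ s with ¬ 0 ≤ z i, |z i| = -∑ i ∈ s with ¬ 0 ≤ z i, z i := by
    rw [← Finset.sum_neg_distrib]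
    exact Finset.sum_congr rfl fun i hi => abs_of_neg (not_le.1 (Finset.mem_filter.1 hi).2)
  have h3 := (abs_le.1 (h _ (Finset.filter_subset (fun i => 0 ≤ z i) s))).2
  have h4 := (abs_le.1 (h _ (Finset.filter_subset (fun i => ¬ 0 ≤ z i) s))).1
  rw [h1, h2]
  linarith

/-- Among the subsets are those on which the real or the imaginary parts have a constant sign: a
factor 2 for the signs and a factor 2 for the two parts. -/
theorem sum_norm_le_of_subset_sums {ι : Type*} (s : Finset ι) (z : ι → ℂ) {B : ℝ}
    (h : ∀ t ⊆ s, ‖∑ i ∈ t, z i‖ ≤ B) : ∑ i ∈ s, ‖z i‖ ≤ 4 * B := by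
  have h1 := sum_abs_le_of_subset_sums s (fun i => (z i).re) fun t ht => by
    rw [← Complex.re_sum]
    exact (Complex.abs_re_le_norm _).trans (h t ht)
  have h2 := sum_abs_le_of_subset_sums s (fun i => (z i).im) fun t ht => by
    rw [← Complex.im_sum]
    exact (Complex.abs_im_le_norm _).trans (h t ht)
  have h3 : ∑ i ∈ s, ‖z i‖ ≤ ∑ i ∈ s, (|(z i).re| + |(z i).im|) :=
    Finset.sum_le_sum fun i _ => Complex.norm_le_abs_re_add_abs_im _
  rw [Finset.sum_add_distrib] at h3
  linarith

variable {β : Type*}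

/-- `K` bounds all finite multipliers with coefficients in the unit disc. -/
def MultiplierBound (e : UnconditionalSchauderBasis β ℂ X) (K : ℝ) : Prop :=
  ∀ (s : Finset β) (c : β → ℂ), (∀ i ∈ s, ‖c i‖ ≤ 1) → ∀ x : X,
    ‖∑ i ∈ s, (c i * e.coord i x) • e i‖ ≤ K * ‖x‖

/-- A norming functional reduces the multiplier to a scalar sum. Its absolute convergence is
controlled by the uniformly bounded coordinate projections. -/
theorem exists_multiplierBound [CompleteSpace X] (e : UnconditionalSchauderBasis β ℂ X) :
    ∃ K : ℝ, 1 ≤ K ∧ MultiplierBound e K := by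
  obtain ⟨C, hC⟩ := UnconditionalSchauderBasis.exists_norm_proj_le e
  refine ⟨max 1 (4 * C), le_max_left _ _, fun s c hc x => ?_⟩
  obtain ⟨g, hg1, hg2⟩ := exists_dual_vector'' ℂ (∑ i ∈ s, (c i * e.coord i x) • e i)
  have h1 : ∑ i ∈ s, ‖g (e.coord i x • e i)‖ ≤ 4 * (C * ‖x‖) := by
    refine sum_norm_le_of_subset_sums s _ fun t _ => ?_
    rw [← map_sum, ← GeneralSchauderBasis.proj_apply]
    calc _ ≤ 1 * ‖e.proj t x‖ := g.le_of_opNorm_le hg1 _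
      _ ≤ _ := by rw [one_mul]; exact (e.proj t).le_of_opNorm_le (hC t) x
  calc ‖∑ i ∈ s, (c i * e.coord i x) • e i‖ = ‖g (∑ i ∈ s, (c i * e.coord i x) • e i)‖ := by
        rw [hg2]; simp
    _ = ‖∑ i ∈ s, c i * g (e.coord i x • e i)‖ := by
        simp [map_sum, mul_assoc]
    _ ≤ ∑ i ∈ s, ‖g (e.coord i x • e i)‖ := by
        refine norm_sum_le_of_le _ fun i hi => ?_
        rw [norm_mul]
        exact mul_le_of_le_one_left (norm_nonneg _) (hc i hi)
    _ ≤ 4 * C * ‖x‖ := by linarith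
    _ ≤ _ := by gcongr; exact le_max_right _ _

theorem coord_apply_self [DecidableEq β] (e : UnconditionalSchauderBasis β ℂ X) (i j : β) :
    e.coord i (e j) = if i = j then 1 else 0 := by
  rw [e.ortho]
  simp [Pi.single_apply]

theorem coord_sum [DecidableEq β] (e : UnconditionalSchauderBasis β ℂ X) (s : Finset β)
    (a : β → ℂ) (i : β) : e.coord i (∑ j ∈ s, a j • e j) = if i ∈ s then a i else 0 := by
  simp [map_sum, coord_apply_self]

theorem dense_span_range (e : UnconditionalSchauderBasis β ℂ X) :
    Dense (Submodule.span ℂ (Set.range e) : Set X) := by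
  intro x
  refine mem_closure_of_tendsto (e.tendsto_proj x) (Eventually.of_forall fun s => ?_)
  rw [GeneralSchauderBasis.proj_apply]
  exact Submodule.sum_mem _ fun i _ => Submodule.smul_mem _ _ (Submodule.subset_span ⟨i, rfl⟩)

namespace MultiplierBound

variable {e : UnconditionalSchauderBasis β ℂ X} {K : ℝ}

theorem sum_mul_le (hK : MultiplierBound e K) (s : Finset β) (c a : β → ℂ)
    (hc : ∀ i ∈ s, ‖c i‖ ≤ 1) :
    ‖∑ i ∈ s, (c i * a i) • e i‖ ≤ K * ‖∑ i ∈ s, a i • e i‖ := by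
  classical
  refine le_trans (le_of_eq ?_) (hK s c hc _)
  congr 1
  refine Finset.sum_congr rfl fun i hi => ?_
  rw [coord_sum, if_pos hi]

theorem sum_mul_le_mul (hK : MultiplierBound e K) (s : Finset β) (c a : β → ℂ) {M : ℝ} (hM : 0 < M)
    (hc : ∀ i ∈ s, ‖c i‖ ≤ M) :
    ‖∑ i ∈ s, (c i * a i) • e i‖ ≤ M * (K * ‖∑ i ∈ s, a i • e i‖) := by
  have h1 := hK.sum_mul_le s (fun i => (M : ℂ)⁻¹ * c i) a fun i hi => by
    rw [norm_mul, norm_inv, Complex.norm_real, Real.norm_of_nonneg hM.le, inv_mul_le_iff₀ hM,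
      mul_one]
    exact hc i hi
  have h2 : ∑ i ∈ s, (c i * a i) • e i =
      (M : ℂ) • ∑ i ∈ s, ((M : ℂ)⁻¹ * c i * a i) • e i := by
    rw [Finset.smul_sum]
    refine Finset.sum_congr rfl fun i _ => ?_
    have : (M : ℂ) ≠ 0 := by exact_mod_cast hM.ne'
    rw [smul_smul]
    congr 1
    field_simp
  rw [h2, norm_smul, Complex.norm_real, Real.norm_of_nonneg hM.le]
  gcongr

theorem norm_proj_le (hK : MultiplierBound e K) (hK0 : 0 ≤ K) (s : Finset β) : ‖e.proj s‖ ≤ K :=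
  ContinuousLinearMap.opNorm_le_bound _ hK0 fun x => by
    simpa using hK s (fun _ => 1) (by simp) x

theorem norm_coord_le (hK : MultiplierBound e K) (hK0 : 0 ≤ K) (he : ∀ i, ‖e i‖ = 1) (i : β) :
    ‖e.coord i‖ ≤ K :=
  ContinuousLinearMap.opNorm_le_bound _ hK0 fun x => by
    simpa [norm_smul, he] using hK {i} (fun _ => 1) (by simp) x

theorem sum_subset_le (hK : MultiplierBound e K) {s t : Finset β} (h : s ⊆ t) (a : β → ℂ) :
    ‖∑ i ∈ s, a i • e i‖ ≤ K * ‖∑ i ∈ t, a i • e i‖ := by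
  classical
  have := hK.sum_mul_le t (fun i => if i ∈ s then 1 else 0) a fun i _ => by split_ifs <;> simp
  simp only [ite_mul, one_mul, zero_mul, ite_smul, zero_smul] at this
  rw [← Finset.sum_filter, Finset.filter_mem_eq_inter, Finset.inter_eq_right.2 h] at this
  exact this

theorem norm_coeff_le (hK : MultiplierBound e K) (he : ∀ i, ‖e i‖ = 1) {t : Finset β} (a : β → ℂ)
    {i : β} (hi : i ∈ t) : ‖a i‖ ≤ K * ‖∑ j ∈ t, a j • e j‖ := by
  have := hK.sum_subset_le (Finset.singleton_subset_iff.2 hi) a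
  simpa [norm_smul, he] using this

end MultiplierBound

/-- The scale `c = 2π/T` is chosen so that `[0,T)` contains whole periods of every frequency `c
2^n`; hence the mean of the squared sine is exactly `1/2`. -/
theorem integral_sin_sq_period {T : ℝ} (hT : 0 < T) (n : ℕ) :
    ∫ t in Set.Ico (0 : ℝ) T, Real.sin (2 * Real.pi / T * 2 ^ n * t) ^ 2 = T / 2 := by
  rw [integral_Ico_eq_integral_Ioc, ← intervalIntegral.integral_of_le hT.le,
    intervalIntegral.integral_comp_mul_left (fun x => Real.sin x ^ 2) (by positivity),
    integral_sin_sq]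
  have h1 : 2 * Real.pi / T * 2 ^ n * T = ((2 ^ n : ℕ) : ℝ) * (2 * Real.pi) := by
    push_cast
    field_simp
  have h2 : Real.sin (((2 ^ n : ℕ) : ℝ) * (2 * Real.pi)) = 0 := by
    have := Real.sin_nat_mul_two_pi_sub 0 (2 ^ n)
    simpa using this
  rw [h1, h2]
  have hpi := Real.pi_pos
  push_cast
  simp only [mul_zero, Real.sin_zero, zero_mul, sub_zero, smul_eq_mul, zero_add]
  field_simp

/-- Multiplying each coordinate by its own sine once more costs the factor `K` and turns the
oscillating coefficients into `μ i` times squared sines, whose integrals are all `T/2`. -/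
theorem norm_sum_le_of_coord_eq_sin [CompleteSpace X] {T : ℝ} (hT : 0 < T)
    {e : UnconditionalSchauderBasis β ℂ X}
    {K : ℝ} (hK : MultiplierBound e K) {ι : Type*} (s : Finset ι) {σ : ι → β}
    (hσ : Set.InjOn σ s) (μ : ι → ℂ) (n : ι → ℕ) {w : ℝ → X} (hw : IntegrableOn w (Set.Ico 0 T))
    (h : ∀ i ∈ s, ∀ᵐ t ∂(volume.restrict (Set.Ico (0 : ℝ) T)),
      e.coord (σ i) (w t) = μ i * Real.sin (2 * Real.pi / T * 2 ^ n i * t)) :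
    T / 2 * ‖∑ i ∈ s, μ i • e (σ i)‖ ≤ K * ∫ t in Set.Ico (0 : ℝ) T, ‖w t‖ := by
  classical
  set g : ι → ℝ → ℝ := fun i t => Real.sin (2 * Real.pi / T * 2 ^ n i * t) with hg
  have hgi : ∀ i, IntegrableOn (fun t => ((g i t ^ 2 : ℝ) : ℂ)) (Set.Ico 0 T) := fun i =>
    ((by fun_prop : Continuous fun t => ((g i t ^ 2 : ℝ) : ℂ)).integrableOn_Icc).mono_set
      Set.Ico_subset_Icc_self
  have h1 : ∫ t in Set.Ico (0 : ℝ) T, ∑ i ∈ s, ((g i t ^ 2 : ℝ) : ℂ) • μ i • e (σ i) =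
      ((T / 2 : ℝ) : ℂ) • ∑ i ∈ s, μ i • e (σ i) := by
    rw [integral_finsetSum _ fun i _ => (hgi i).smul_const _, Finset.smul_sum]
    refine Finset.sum_congr rfl fun i _ => ?_
    rw [integral_smul_const, integral_complex_ofReal, integral_sin_sq_period hT]
  have h2 : ‖((T / 2 : ℝ) : ℂ) • ∑ i ∈ s, μ i • e (σ i)‖ = T / 2 * ‖∑ i ∈ s, μ i • e (σ i)‖ := by
    rw [norm_smul, Complex.norm_real, Real.norm_of_nonneg (by positivity)]
  rw [← h2, ← h1, ← integral_const_mul]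
  refine norm_integral_le_of_norm_le (hw.norm.const_mul K) ?_
  rw [← Finset.eventually_all] at h
  filter_upwards [h] with t ht
  -- The multiplier is indexed by basis positions: it equals the sine belonging to `i` at `σ i`, and
  -- `0` off the image.
  have h3 : ∃ d : β → ℝ, (∀ b, ‖(d b : ℂ)‖ ≤ 1) ∧ ∀ i ∈ s, d (σ i) = g i t := by
    refine ⟨fun b => if hb : ∃ i ∈ s, σ i = b then g hb.choose t else 0, fun b => ?_, fun i hi => ?_⟩
    · dsimp only
      split_ifs
      · rw [Complex.norm_real, Real.norm_eq_abs]
        exact Real.abs_sin_le_one _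
      · simp
    · have hb : ∃ j ∈ s, σ j = σ i := ⟨i, hi, rfl⟩
      dsimp only
      rw [dif_pos hb, hσ hb.choose_spec.1 hi hb.choose_spec.2]
  obtain ⟨d, hd1, hd2⟩ := h3
  refine le_trans (le_of_eq ?_) (hK (s.image σ) (fun b => d b) (fun b _ => hd1 b) (w t))
  rw [Finset.sum_image hσ]
  congr 1
  refine Finset.sum_congr rfl fun i hi => ?_
  have ht' : e.coord (σ i) (w t) = μ i * (g i t : ℂ) := ht i hi
  rw [ht', hd2 i hi, smul_smul, sq]
  push_cast
  congr 1
  ring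

end MaxReg

/-! ### Under MRP the normalized basis is symmetric. -/

namespace MaxReg

variable {X : Type*} [NormedAddCommGroup X] [NormedSpace ℂ X]

theorem exists_matching_bound [CompleteSpace X] {T : ℝ} (hT : 0 < T) (hX : MRP T X)
    {e : UnconditionalSchauderBasis ℕ ℂ X} (he : ∀ i, ‖e i‖ = 1) {K : ℝ} (hK1 : 1 ≤ K)
    (hK : MultiplierBound e K) {A : Set ℕ} {τ : ℕ → ℕ} (hτ : Set.InjOn τ A)
    (hτA : ∀ a ∈ A, τ a ∉ A) :
    ∃ C : ℝ, ∀ s : Finset ℕ, ↑s ⊆ A → ∀ a : ℕ → ℂ,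
      ‖∑ i ∈ s, a i • e (τ i)‖ ≤ C * ‖∑ i ∈ s, a i • e i‖ := by
  classical
  have hK0 : 0 ≤ K := zero_le_one.trans hK1
  -- Each `τ a` goes to the position `2a + 1`, directly after `a` at `2a`; unmatched indices keep
  -- even positions.
  set ord : ℕ → ℕ := fun b => if h : ∃ a ∈ A, τ a = b then 2 * h.choose + 1 else 2 * b with hord
  have hord1 : ∀ a ∈ A, ord (τ a) = 2 * a + 1 := by
    intro a ha
    have h1 : ∃ a' ∈ A, τ a' = τ a := ⟨a, ha, rfl⟩
    simp only [hord]
    rw [dif_pos h1, hτ h1.choose_spec.1 ha h1.choose_spec.2]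
  have hord2 : ∀ b, (∀ a ∈ A, τ a ≠ b) → ord b = 2 * b := by
    intro b hb
    simp only [hord]
    rw [dif_neg]
    rintro ⟨a, ha, h⟩
    exact hb a ha h
  have hordA : ∀ a ∈ A, ord a = 2 * a := fun a ha =>
    hord2 a fun b hb h => hτA b hb (h ▸ ha)
  set F : ℕ → Finset ℕ := fun j =>
    (Finset.range j ∪ (Finset.range j).image τ).filter fun i => ord i < j with hFdef
  have hF : ∀ j a, a ∈ F j ↔ ord a < j := by
    intro j b
    simp only [hFdef, Finset.mem_filter, Finset.mem_union, Finset.mem_range, Finset.mem_image,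
      and_iff_right_iff_imp]
    intro h
    by_cases hb : ∃ a ∈ A, τ a = b
    · obtain ⟨a, ha, rfl⟩ := hb
      rw [hord1 a ha] at h
      exact Or.inr ⟨a, by omega, rfl⟩
    · rw [hord2 b fun a ha h' => hb ⟨a, ha, h'⟩] at h
      exact Or.inl (by omega)
  obtain ⟨C, hC, H⟩ := exists_twist_response hX (c := 2 * Real.pi / T) (by positivity)
    (y := e) (ys := e.coord) (coord_apply_self e) (dense_span_range e) hF (K := K)
    (fun j => hK.norm_proj_le hK0 (F j)) (A := A) (τ := τ)
    (fun a ha => by rw [hord1 a ha, hordA a ha]) hτA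
    (fun a ha b hb h => by rw [hordA a ha, hordA b hb] at h; omega)
    (fun a _ => by rw [he, mul_one]; exact hK.norm_coord_le hK0 he a)
  -- The `6` bounds `pairForcing`, the inner `K` is paid for inserting it as a multiplier, the outer
  -- `K` for the second sine, and `2 / T` undoes the mean of its square.
  refine ⟨2 / T * (K * (C * (6 * K))), fun s hs a => ?_⟩
  set M : ℝ := 6 * (K * ‖∑ i ∈ s, a i • e i‖) with hM
  obtain ⟨w, hw1, hw2, hw3, -⟩ := H s
    (fun t => ∑ i ∈ s, ((pairForcing (2 * Real.pi / T * 2 ^ ord i) t : ℂ) * a i) • e i) M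
    (by fun_prop) (by positivity)
    (fun t _ => hK.sum_mul_le_mul s _ a (by norm_num) fun i _ => by
      rw [Complex.norm_real]; exact abs_pairForcing_le _ _)
  have h1 := norm_sum_le_of_coord_eq_sin hT hK s (σ := τ) (hτ.mono hs) a ord hw1 ?_
  · have h2 : K * ∫ t in Set.Ico (0 : ℝ) T, ‖w t‖ ≤ K * (C * M) := by gcongr
    have h3 := h1.trans h2
    rw [hM] at h3
    calc ‖∑ i ∈ s, a i • e (τ i)‖ = 2 / T * (T / 2 * ‖∑ i ∈ s, a i • e (τ i)‖) := by field_simp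
      _ ≤ 2 / T * (K * (C * (6 * (K * ‖∑ i ∈ s, a i • e i‖)))) := by gcongr
      _ = _ := by ring
  · intro i hi
    refine hw3 i hi (hs hi) (a i) ?_ ?_
    · intro t _
      rw [coord_sum, if_pos hi, mul_comm]
    · intro t _
      rw [coord_sum, if_neg fun h : τ i ∈ s => hτA i (hs hi) (hs h)]

/-- At most `2N` pairs meet the indices below `N`, and each coefficient is at most `K` times the
norm of the whole vector. A sufficiently bad matching therefore stays bad after these pairs are
removed. -/
theorem exists_bad_matching_above {e : UnconditionalSchauderBasis ℕ ℂ X} (he : ∀ i, ‖e i‖ = 1)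
    {K : ℝ} (hK1 : 1 ≤ K) (hK : MultiplierBound e K)
    (h : ∀ C : ℝ, 0 ≤ C → ∃ (s : Finset ℕ) (τ : ℕ → ℕ) (a : ℕ → ℂ), Set.InjOn τ s ∧
      (∀ i ∈ s, τ i ∉ s) ∧ C * ‖∑ i ∈ s, a i • e i‖ < ‖∑ i ∈ s, a i • e (τ i)‖) (N : ℕ)
    (C : ℝ) (hC : 0 ≤ C) :
    ∃ (s : Finset ℕ) (τ : ℕ → ℕ) (a : ℕ → ℂ), Set.InjOn τ s ∧
      (∀ i ∈ s, τ i ∉ s) ∧ C * ‖∑ i ∈ s, a i • e i‖ < ‖∑ i ∈ s, a i • e (τ i)‖ ∧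
      ∀ i ∈ s, N ≤ i ∧ N ≤ τ i := by
  classical
  have hK0 : 0 ≤ K := zero_le_one.trans hK1
  -- The part `2 * N * K` pays for the discarded terms; the factor `K` in `C * K` pays for
  -- restricting the right-hand vector to the remaining ones.
  obtain ⟨s, τ, a, h1, h2, h3⟩ := h (C * K + 2 * N * K) (by positivity)
  refine ⟨s.filter fun i => N ≤ i ∧ N ≤ τ i, τ, a, h1.mono (Finset.coe_subset.2 (Finset.filter_subset _ _)), ?_, ?_, ?_⟩
  · intro i hi h'
    exact h2 i (Finset.mem_filter.1 hi).1 (Finset.mem_filter.1 h').1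
  · set S := ‖∑ i ∈ s, a i • e i‖
    have h4 : ‖∑ i ∈ s with ¬ (N ≤ i ∧ N ≤ τ i), a i • e (τ i)‖ ≤ 2 * N * (K * S) := by
      refine (norm_sum_le_of_le (n := fun _ => K * S) _ fun i hi => ?_).trans ?_
      · rw [norm_smul, he, mul_one]
        exact hK.norm_coeff_le he a (Finset.mem_filter.1 hi).1
      · rw [Finset.sum_const, nsmul_eq_mul]
        gcongr
        have h5 : (s.filter fun i => ¬ (N ≤ i ∧ N ≤ τ i)).card ≤ 2 * N := by
          have h6 : (s.filter fun i => ¬ (N ≤ i ∧ N ≤ τ i)) ⊆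
              (s.filter fun i => i < N) ∪ (s.filter fun i => τ i < N) := by
            intro i
            simp only [Finset.mem_filter, Finset.mem_union]
            rintro ⟨hi, h⟩
            rcases lt_or_ge i N with h' | h'
            · exact Or.inl ⟨hi, h'⟩
            · exact Or.inr ⟨hi, by by_contra h''; exact h ⟨h', not_lt.1 h''⟩⟩
          have h7 : (s.filter fun i => i < N).card ≤ N := by
            calc _ ≤ (Finset.range N).card := Finset.card_le_card fun i hi => by
                  simpa using (Finset.mem_filter.1 hi).2
              _ = N := Finset.card_range N
          have h8 : (s.filter fun i => τ i < N).card ≤ N := by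
            calc _ ≤ (Finset.range N).card := Finset.card_le_card_of_injOn τ
                  (fun i hi => by simpa using (Finset.mem_filter.1 hi).2)
                  (h1.mono (Finset.coe_subset.2 (Finset.filter_subset _ _)))
              _ = N := Finset.card_range N
          have := (Finset.card_le_card h6).trans (Finset.card_union_le _ _)
          omega
        exact_mod_cast h5
    have h9 := hK.sum_subset_le (Finset.filter_subset (fun i => N ≤ i ∧ N ≤ τ i) s) a
    have h10 : ‖∑ i ∈ s, a i • e (τ i)‖ ≤ ‖∑ i ∈ s with (N ≤ i ∧ N ≤ τ i), a i • e (τ i)‖ +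
        ‖∑ i ∈ s with ¬ (N ≤ i ∧ N ≤ τ i), a i • e (τ i)‖ := by
      rw [← Finset.sum_filter_add_sum_filter_not s (fun i => N ≤ i ∧ N ≤ τ i)]
      exact norm_add_le _ _
    have h11 := mul_le_mul_of_nonneg_left h9 hC
    linarith
  · intro i hi
    exact (Finset.mem_filter.1 hi).2

/-- Gliding hump: if no uniform constant existed, finite matchings of growing badness could be
placed in disjoint intervals and glued into one infinite matching, contradicting
`exists_matching_bound`. -/
theorem exists_uniform_matching_bound [CompleteSpace X] {T : ℝ} (hT : 0 < T) (hX : MRP T X)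
    {e : UnconditionalSchauderBasis ℕ ℂ X} (he : ∀ i, ‖e i‖ = 1) :
    ∃ C : ℝ, 0 ≤ C ∧ ∀ (s : Finset ℕ) (τ : ℕ → ℕ) (a : ℕ → ℂ), Set.InjOn τ s →
      (∀ i ∈ s, τ i ∉ s) → ‖∑ i ∈ s, a i • e (τ i)‖ ≤ C * ‖∑ i ∈ s, a i • e i‖ := by
  classical
  obtain ⟨K, hK1, hK⟩ := exists_multiplierBound e
  by_contra hcon
  push Not at hcon
  have key := fun (N n : ℕ) => exists_bad_matching_above he hK1 hK hcon N n (Nat.cast_nonneg n)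
  choose s τ a h1 h2 h3 h4 using key
  -- The next interval starts beyond all indices and images used by the `n`-th bad matching.
  let nxt : ℕ → ℕ → ℕ := fun N n => N + ((s N n ∪ (s N n).image (τ N n)).sup id + 1)
  let Ns : ℕ → ℕ := fun n => Nat.rec 0 (fun n N => nxt N n) n
  have hNs : ∀ n, Ns (n + 1) = nxt (Ns n) n := fun n => rfl
  have hmono : Monotone Ns := monotone_nat_of_le_succ fun n => by
    rw [hNs]; exact Nat.le_add_right _ _
  have huniq : ∀ {x n m : ℕ}, Ns n ≤ x → x < Ns (n + 1) → Ns m ≤ x → x < Ns (m + 1) → n = m := by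
    intro x n m a1 a2 b1 b2
    by_contra hne
    rcases lt_or_gt_of_ne hne with hlt | hlt
    · have := hmono (Nat.succ_le_of_lt hlt)
      simp only [Nat.succ_eq_add_one] at this
      omega
    · have := hmono (Nat.succ_le_of_lt hlt)
      simp only [Nat.succ_eq_add_one] at this
      omega
  let S : ℕ → Finset ℕ := fun n => s (Ns n) n
  have hS1 : ∀ n, ∀ i ∈ S n, Ns n ≤ i ∧ i < Ns (n + 1) := by
    intro n i hi
    refine ⟨(h4 _ _ i hi).1, ?_⟩
    rw [hNs]
    have : i ≤ (s (Ns n) n ∪ (s (Ns n) n).image (τ (Ns n) n)).sup id :=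
      Finset.le_sup (f := id) (Finset.mem_union_left _ hi)
    simp only [nxt]
    omega
  have hS2 : ∀ n, ∀ i ∈ S n, Ns n ≤ τ (Ns n) n i ∧ τ (Ns n) n i < Ns (n + 1) := by
    intro n i hi
    refine ⟨(h4 _ _ i hi).2, ?_⟩
    rw [hNs]
    have : τ (Ns n) n i ≤ (s (Ns n) n ∪ (s (Ns n) n).image (τ (Ns n) n)).sup id :=
      Finset.le_sup (f := id) (Finset.mem_union_right _ (Finset.mem_image_of_mem _ hi))
    simp only [nxt]
    omega
  let A : Set ℕ := {i | ∃ n, i ∈ S n}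
  let σ : ℕ → ℕ := fun i => if h : ∃ n, i ∈ S n then τ (Ns h.choose) h.choose i else i
  have hσ : ∀ n, ∀ i ∈ S n, σ i = τ (Ns n) n i := by
    intro n i hi
    have h : ∃ n, i ∈ S n := ⟨n, hi⟩
    have hn : h.choose = n := huniq (hS1 _ i h.choose_spec).1 (hS1 _ i h.choose_spec).2
      (hS1 _ i hi).1 (hS1 _ i hi).2
    simp only [σ]
    rw [dif_pos h, hn]
  have hinj : Set.InjOn σ A := by
    rintro i ⟨n, hi⟩ j ⟨m, hj⟩ hij
    rw [hσ n i hi, hσ m j hj] at hij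
    have hnm : n = m := huniq (hS2 n i hi).1 (hS2 n i hi).2 (hij ▸ (hS2 m j hj).1)
      (hij ▸ (hS2 m j hj).2)
    subst hnm
    exact h1 _ _ hi hj hij
  have hdisj : ∀ i ∈ A, σ i ∉ A := by
    rintro i ⟨n, hi⟩ ⟨m, hm⟩
    rw [hσ n i hi] at hm
    have hnm : n = m := huniq (hS2 n i hi).1 (hS2 n i hi).2 (hS1 m _ hm).1 (hS1 m _ hm).2
    subst hnm
    exact h2 _ _ i hi hm
  obtain ⟨C, hC⟩ := exists_matching_bound hT hX he hK1 hK hinj hdisj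
  obtain ⟨n, hn⟩ := exists_nat_ge C
  have h5 := hC (S n) (fun i hi => ⟨n, hi⟩) (a (Ns n) n)
  have h5' : ∑ i ∈ S n, a (Ns n) n i • e (σ i) = ∑ i ∈ S n, a (Ns n) n i • e (τ (Ns n) n i) :=
    Finset.sum_congr rfl fun i hi => by rw [hσ n i hi]
  rw [h5'] at h5
  have h6 := h3 (Ns n) n
  have h7 : C * ‖∑ i ∈ S n, a (Ns n) n i • e i‖ ≤ n * ‖∑ i ∈ S n, a (Ns n) n i • e i‖ := by
    gcongr
  exact absurd (h6.trans_le (h5.trans h7)) (lt_irrefl _)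

/-- `L` bounds all rearrangements of finitely supported vectors. -/
def SymmetricBound {β : Type*} (e : UnconditionalSchauderBasis β ℂ X) (L : ℝ) : Prop :=
  ∀ (s : Finset β) (σ : β → β) (a : β → ℂ), Set.InjOn σ s →
    ‖∑ i ∈ s, a i • e (σ i)‖ ≤ L * ‖∑ i ∈ s, a i • e i‖

/-- An injection `σ` may map `s` into itself, so it is factored through a translate `s + N` disjoint
from both `s` and its image; each factor is an admissible matching. -/
theorem exists_symmetricBound [CompleteSpace X] {T : ℝ} (hT : 0 < T) (hX : MRP T X)
    {e : UnconditionalSchauderBasis ℕ ℂ X} (he : ∀ i, ‖e i‖ = 1) :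
    ∃ L : ℝ, 1 ≤ L ∧ SymmetricBound e L := by
  classical
  obtain ⟨C, hC, H⟩ := exists_uniform_matching_bound hT hX he
  refine ⟨max 1 (C * C), le_max_left _ _, fun s σ a hσ => ?_⟩
  set N := (s ∪ s.image σ).sup id + 1 with hN
  have hN1 : ∀ i ∈ s, i < N := fun i hi => Nat.lt_succ_of_le
    (Finset.le_sup (f := id) (Finset.mem_union_left _ hi))
  have hN2 : ∀ i ∈ s, σ i < N := fun i hi => Nat.lt_succ_of_le
    (Finset.le_sup (f := id) (Finset.mem_union_right _ (Finset.mem_image_of_mem _ hi)))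
  have h1 := H s (· + N) a (fun i _ j _ h => by simpa using h) fun i _ h => by
    have := hN1 _ h
    omega
  have h2 := H (s.map (addRightEmbedding N)) (fun i => σ (i - N)) (fun i => a (i - N)) ?_ ?_
  · simp only [Finset.sum_map, addRightEmbedding_apply, Nat.add_sub_cancel] at h2
    calc _ ≤ C * ‖∑ i ∈ s, a i • e (i + N)‖ := h2
      _ ≤ C * (C * ‖∑ i ∈ s, a i • e i‖) := by gcongr
      _ = C * C * ‖∑ i ∈ s, a i • e i‖ := by ring
      _ ≤ _ := by gcongr; exact le_max_right _ _
  · intro i hi j hj hij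
    simp only [Finset.coe_map, addRightEmbedding_apply, Set.mem_image, Finset.mem_coe] at hi hj
    obtain ⟨i, hi, rfl⟩ := hi
    obtain ⟨j, hj, rfl⟩ := hj
    simp only [Nat.add_sub_cancel] at hij
    rw [hσ hi hj hij]
  · intro i hi h
    simp only [Finset.mem_map, addRightEmbedding_apply] at hi h
    obtain ⟨i, hi, rfl⟩ := hi
    obtain ⟨j, hj, hj'⟩ := h
    simp only [Nat.add_sub_cancel] at hj'
    have := hN2 i hi
    omega

end MaxReg

/-! ### Walsh functions and Riesz products on cubes of basis vectors. -/

namespace MaxReg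

section Walsh

variable {d : ℕ}

/-- The Walsh character of the cube `{±1}^d` attached to `S`. -/
def walsh (S : Finset (Fin d)) (g : Fin d → ℤˣ) : ℂ := ∏ i ∈ S, (((g i : ℤˣ) : ℤ) : ℂ)

theorem walsh_mul (S : Finset (Fin d)) (g h : Fin d → ℤˣ) :
    walsh S (g * h) = walsh S g * walsh S h := by
  simp [walsh, Finset.prod_mul_distrib]

theorem norm_sign (u : ℤˣ) : ‖((u : ℤ) : ℂ)‖ = 1 := by
  rcases Int.units_eq_one_or u with rfl | rfl <;> simp

theorem norm_walsh (S : Finset (Fin d)) (g : Fin d → ℤˣ) : ‖walsh S g‖ = 1 := by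
  rw [walsh, norm_prod]
  exact Finset.prod_eq_one fun i _ => norm_sign _

theorem cube_mul_self (g : Fin d → ℤˣ) : g * g = 1 := by
  ext i
  simp [Int.units_mul_self]

theorem walsh_mul_self (S : Finset (Fin d)) (g : Fin d → ℤˣ) : walsh S g * walsh S g = 1 := by
  rw [← walsh_mul, cube_mul_self]
  simp [walsh]

theorem sum_powerset_walsh (A : Finset (Fin d)) (g : Fin d → ℤˣ) :
    ∑ S ∈ A.powerset, walsh S g = ∏ i ∈ A, (1 + (((g i : ℤˣ) : ℤ) : ℂ)) := by
  rw [Finset.prod_one_add]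
  rfl

theorem sum_walsh (g : Fin d → ℤˣ) :
    ∑ S : Finset (Fin d), walsh S g = if g = 1 then 2 ^ d else 0 := by
  rw [← Finset.powerset_univ, sum_powerset_walsh]
  split_ifs with h
  · subst h
    norm_num
  · obtain ⟨i, hi⟩ := Function.ne_iff.1 h
    refine Finset.prod_eq_zero (Finset.mem_univ i) ?_
    rcases Int.units_eq_one_or (g i) with h1 | h1
    · exact absurd h1 hi
    · simp [h1]

theorem sum_cube_walsh_mul (S S' : Finset (Fin d)) :
    ∑ g : Fin d → ℤˣ, walsh S g * walsh S' g = if S = S' then 2 ^ d else 0 := by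
  have h1 : ∀ g : Fin d → ℤˣ, walsh S g * walsh S' g = ∏ i : Fin d,
      ((if i ∈ S then (((g i : ℤˣ) : ℤ) : ℂ) else 1) *
        (if i ∈ S' then (((g i : ℤˣ) : ℤ) : ℂ) else 1)) := by
    intro g
    rw [Finset.prod_mul_distrib, Finset.prod_ite_mem, Finset.prod_ite_mem]
    simp [walsh]
  simp_rw [h1]
  rw [← Fintype.prod_sum (fun (i : Fin d) (u : ℤˣ) =>
    ((if i ∈ S then ((u : ℤ) : ℂ) else 1) * (if i ∈ S' then ((u : ℤ) : ℂ) else 1)))]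
  have h2 : (Finset.univ : Finset ℤˣ) = {1, -1} := rfl
  split_ifs with h
  · subst h
    rw [Finset.prod_eq_pow_card (b := (2 : ℂ))]
    · simp
    · intro i _
      rw [h2, Finset.sum_pair (by decide)]
      by_cases hi : i ∈ S
      · simp [hi]; norm_num
      · simp [hi]; norm_num
  · obtain ⟨i, hi⟩ : ∃ i, ¬ (i ∈ S ↔ i ∈ S') := by
      by_contra hcon
      push Not at hcon
      exact h (Finset.ext hcon)
    refine Finset.prod_eq_zero (Finset.mem_univ i) ?_
    rw [h2, Finset.sum_pair (by decide)]
    by_cases h3 : i ∈ S <;> by_cases h4 : i ∈ S' <;> simp [h3, h4] at hi ⊢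

/-- The first `k` coordinates of the cube. -/
def lowBits (d k : ℕ) : Finset (Fin d) := Finset.univ.filter fun i => i.val < k

/-- The kernel is the product of the factors `1 + g i ≥ 0`, so its `L¹` norm is its integral, to
which only the empty set contributes. -/
theorem sum_norm_sum_powerset_walsh (A : Finset (Fin d)) :
    ∑ g : Fin d → ℤˣ, ‖∑ S ∈ A.powerset, walsh S g‖ = 2 ^ d := by
  have h1 : ∀ g : Fin d → ℤˣ, ((‖∑ S ∈ A.powerset, walsh S g‖ : ℝ) : ℂ) =
      ∑ S ∈ A.powerset, walsh S g := by
    intro g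
    rw [sum_powerset_walsh, norm_prod, Complex.ofReal_prod]
    refine Finset.prod_congr rfl fun i _ => ?_
    rcases Int.units_eq_one_or (g i) with h | h
    · rw [h]; norm_num
    · rw [h]; norm_num
  have h2 : ((∑ g : Fin d → ℤˣ, ‖∑ S ∈ A.powerset, walsh S g‖ : ℝ) : ℂ) = 2 ^ d := by
    rw [Complex.ofReal_sum, Finset.sum_congr rfl fun g _ => h1 g, Finset.sum_comm]
    have h3 : ∀ S ∈ A.powerset, ∑ g : Fin d → ℤˣ, walsh S g = if S = ∅ then 2 ^ d else 0 := by
      intro S _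
      rw [← sum_cube_walsh_mul S ∅]
      simp [walsh]
    rw [Finset.sum_congr rfl h3, Finset.sum_ite_eq']
    simp
  exact_mod_cast h2

/-- The Riesz product on the cube. -/
def riesz (c : Fin d → ℝ) (g : Fin d → ℤˣ) : ℂ :=
  ∏ k, (1 + Complex.I * c k * (((g k : ℤˣ) : ℤ) : ℂ))

/-- The Walsh coefficients of the Riesz product. -/
def rieszCoeff (c : Fin d → ℝ) (S : Finset (Fin d)) : ℂ := ∏ k ∈ S, (Complex.I * c k)

theorem riesz_eq_sum (c : Fin d → ℝ) (g : Fin d → ℤˣ) :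
    riesz c g = ∑ S, rieszCoeff c S * walsh S g := by
  rw [riesz, Finset.prod_one_add, Finset.powerset_univ]
  exact Finset.sum_congr rfl fun S _ => Finset.prod_mul_distrib

/-- The imaginary unit makes each factor have squared modulus `1 + c k ^ 2`, quadratic rather than
linear in `c k`. Hence the product is controlled by the `ℓ₂` norm of `c`, in any dimension. -/
theorem norm_riesz_le (c : Fin d → ℝ) (g : Fin d → ℤˣ) :
    ‖riesz c g‖ ≤ Real.exp (∑ k, c k ^ 2) := by
  rw [riesz, norm_prod, Real.exp_sum]
  refine Finset.prod_le_prod (fun _ _ => norm_nonneg _) fun k _ => ?_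
  have h1 : ‖1 + Complex.I * c k * (((g k : ℤˣ) : ℤ) : ℂ)‖ ^ 2 = 1 + c k ^ 2 := by
    rw [Complex.sq_norm, Complex.normSq_apply]
    rcases Int.units_eq_one_or (g k) with h | h
    · rw [h]; simp; ring
    · rw [h]; simp; ring
  have h2 : ‖1 + Complex.I * c k * (((g k : ℤˣ) : ℤ) : ℂ)‖ ≤ 1 + c k ^ 2 := by
    refine abs_le_of_sq_le_sq' ?_ (by positivity) |>.2
    rw [h1]
    nlinarith [sq_nonneg (c k), sq_nonneg (c k ^ 2)]
  have := Real.add_one_le_exp (c k ^ 2)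
  linarith

end Walsh

variable {X : Type*} [NormedAddCommGroup X] [NormedSpace ℂ X] {β : Type*}
variable {e : UnconditionalSchauderBasis β ℂ X} {K L : ℝ}

theorem SymmetricBound.sum_le (hL : SymmetricBound e L) {ι : Type*} [Fintype ι] {p q : ι → β}
    (hp : Function.Injective p) (hq : Function.Injective q) (a : ι → ℂ) :
    ‖∑ i, a i • e (q i)‖ ≤ L * ‖∑ i, a i • e (p i)‖ := by
  classical
  have h := hL (Finset.univ.map ⟨p, hp⟩) (Function.extend p q id) (Function.extend p a 0) ?_
  · simpa [Finset.sum_map, hp.extend_apply] using h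
  · intro x hx y hy hxy
    simp only [Finset.coe_map, Function.Embedding.coeFn_mk, Finset.coe_univ, Set.image_univ,
      Set.mem_range] at hx hy
    obtain ⟨i, rfl⟩ := hx
    obtain ⟨j, rfl⟩ := hy
    rw [hp.extend_apply, hp.extend_apply] at hxy
    rw [hq hxy]

theorem MultiplierBound.sum_mul_le_mul_univ (hK : MultiplierBound e K) {ι : Type*} [Fintype ι]
    {p : ι → β} (hp : Function.Injective p) (c a : ι → ℂ) {M : ℝ} (hM : 0 < M)
    (hc : ∀ i, ‖c i‖ ≤ M) :
    ‖∑ i, (c i * a i) • e (p i)‖ ≤ M * (K * ‖∑ i, a i • e (p i)‖) := by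
  classical
  have h := hK.sum_mul_le_mul (Finset.univ.map ⟨p, hp⟩) (Function.extend p c 0)
    (Function.extend p a 0) hM ?_
  · simpa [Finset.sum_map, hp.extend_apply] using h
  · intro x hx
    simp only [Finset.mem_map, Finset.mem_univ, Function.Embedding.coeFn_mk, true_and] at hx
    obtain ⟨i, rfl⟩ := hx
    rw [hp.extend_apply]
    exact hc i

theorem MultiplierBound.apply_le_univ (hK : MultiplierBound e K) {ι : Type*} [Fintype ι]
    {p : ι → β} (hp : Function.Injective p) (c : ι → ℂ) {M : ℝ} (hM : 0 < M)
    (hc : ∀ i, ‖c i‖ ≤ M) (x : X) :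
    ‖∑ i, (c i * e.coord (p i) x) • e (p i)‖ ≤ M * (K * ‖x‖) := by
  classical
  have h := hK (Finset.univ.map ⟨p, hp⟩) (fun b => (M : ℂ)⁻¹ * Function.extend p c 0 b) ?_ x
  · simp only [Finset.sum_map, Function.Embedding.coeFn_mk, hp.extend_apply] at h
    have h2 : ∑ i, (c i * e.coord (p i) x) • e (p i) =
        (M : ℂ) • ∑ i, ((M : ℂ)⁻¹ * c i * e.coord (p i) x) • e (p i) := by
      rw [Finset.smul_sum]
      refine Finset.sum_congr rfl fun i _ => ?_
      have : (M : ℂ) ≠ 0 := by exact_mod_cast hM.ne'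
      rw [smul_smul]
      congr 1
      field_simp
    rw [h2, norm_smul, Complex.norm_real, Real.norm_of_nonneg hM.le]
    gcongr
  · intro x hx
    simp only [Finset.mem_map, Finset.mem_univ, Function.Embedding.coeFn_mk, true_and] at hx
    obtain ⟨i, rfl⟩ := hx
    rw [hp.extend_apply, norm_mul, norm_inv, Complex.norm_real, Real.norm_of_nonneg hM.le,
      inv_mul_le_iff₀ hM, mul_one]
    exact hc i

section Block

variable {d : ℕ} {pos : (Fin d → ℤˣ) → β}

/-- The norm of the sum of the basis vectors placed on a cube. -/
def cubeNorm (e : UnconditionalSchauderBasis β ℂ X) (pos : (Fin d → ℤˣ) → β) : ℝ :=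
  ‖∑ g, e (pos g)‖

/-- The normalized Walsh vectors on a cube of basis vectors. -/
def walshVec (e : UnconditionalSchauderBasis β ℂ X) (pos : (Fin d → ℤˣ) → β)
    (S : Finset (Fin d)) : X := (cubeNorm e pos : ℂ)⁻¹ • ∑ g, walsh S g • e (pos g)

/-- The functionals biorthogonal to the Walsh vectors. -/
def walshDual (e : UnconditionalSchauderBasis β ℂ X) (pos : (Fin d → ℤˣ) → β)
    (S : Finset (Fin d)) : StrongDual ℂ X :=
  ((cubeNorm e pos : ℂ) / 2 ^ d) • ∑ g, walsh S g • e.coord (pos g)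

theorem walshDual_apply (S : Finset (Fin d)) (x : X) : walshDual e pos S x =
    (cubeNorm e pos : ℂ) / 2 ^ d * ∑ g, walsh S g * e.coord (pos g) x := by
  simp [walshDual]

theorem cubeNorm_pos (hpos : Function.Injective pos) : 0 < cubeNorm e pos := by
  classical
  rw [cubeNorm, norm_pos_iff]
  intro h
  have := congrArg (e.coord (pos 1)) h
  simp [map_sum, coord_apply_self, hpos.eq_iff] at this

theorem walshDual_walshVec (hpos : Function.Injective pos) (S S' : Finset (Fin d)) :
    walshDual e pos S (walshVec e pos S') = if S = S' then 1 else 0 := by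
  classical
  have hM : (cubeNorm e pos : ℂ) ≠ 0 := by exact_mod_cast (cubeNorm_pos hpos).ne'
  have h1 : ∀ g, e.coord (pos g) (walshVec e pos S') = (cubeNorm e pos : ℂ)⁻¹ * walsh S' g := by
    intro g
    simp [walshVec, map_sum, coord_apply_self, hpos.eq_iff]
  rw [walshDual_apply]
  simp_rw [h1, mul_left_comm _ (cubeNorm e pos : ℂ)⁻¹]
  rw [← Finset.mul_sum, sum_cube_walsh_mul]
  split_ifs
  · field_simp
  · simp

theorem sum_walsh_smul_walshVec (hpos : Function.Injective pos) (g : Fin d → ℤˣ) :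
    ((cubeNorm e pos : ℂ) / 2 ^ d) • ∑ S, walsh S g • walshVec e pos S = e (pos g) := by
  have hM : (cubeNorm e pos : ℂ) ≠ 0 := by exact_mod_cast (cubeNorm_pos hpos).ne'
  simp only [walshVec, Finset.smul_sum, smul_smul]
  rw [Finset.sum_comm]
  have h1 : ∀ h : Fin d → ℤˣ, ∑ S, ((cubeNorm e pos : ℂ) / 2 ^ d * (walsh S g *
      ((cubeNorm e pos : ℂ)⁻¹ * walsh S h))) • e (pos h) = if h = g then e (pos g) else 0 := by
    intro h
    rw [← Finset.sum_smul]
    have h2 : ∀ S, (cubeNorm e pos : ℂ) / 2 ^ d * (walsh S g *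
        ((cubeNorm e pos : ℂ)⁻¹ * walsh S h)) = (1 / 2 ^ d) * walsh S (g * h) := by
      intro S
      rw [walsh_mul]
      field_simp
    simp_rw [h2]
    rw [← Finset.mul_sum, sum_walsh]
    have h3 : g * h = 1 ↔ h = g := by
      constructor
      · intro h'
        have := congrArg (g * ·) h'
        simp only [← mul_assoc, cube_mul_self, one_mul, mul_one] at this
        exact this
      · rintro rfl
        exact cube_mul_self _
    by_cases hgh : h = g
    · subst hgh
      simp [cube_mul_self]
    · simp [h3, hgh]
  rw [Finset.sum_congr rfl fun h _ => h1 h]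
  simp

/-- The projection onto the characters in `F` is an average of the translations of the cube,
weighted by the kernel `∑ S ∈ F, walsh S h`. Symmetry bounds the translations by `L`, so only the
`L¹` norm of the kernel matters. -/
theorem norm_sum_walsh_le (hpos : Function.Injective pos) (hK0 : 0 ≤ K) (hL0 : 0 ≤ L)
    (hK : MultiplierBound e K) (hL : SymmetricBound e L) (F : Finset (Finset (Fin d)))
    (hF : ∑ g : Fin d → ℤˣ, ‖∑ S ∈ F, walsh S g‖ ≤ 2 ^ d) :
    ‖∑ S ∈ F, (walshDual e pos S).smulRight (walshVec e pos S)‖ ≤ L * K := by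
  have hM : (cubeNorm e pos : ℂ) ≠ 0 := by exact_mod_cast (cubeNorm_pos hpos).ne'
  refine ContinuousLinearMap.opNorm_le_bound _ (by positivity) fun x => ?_
  have h1 : (∑ S ∈ F, (walshDual e pos S).smulRight (walshVec e pos S)) x =
      ∑ h : Fin d → ℤˣ, ((1 / 2 ^ d : ℂ) * ∑ S ∈ F, walsh S h) •
        ∑ g, e.coord (pos g) x • e (pos (g * h)) := by
    have h2 : ∀ S, (walshDual e pos S).smulRight (walshVec e pos S) x =
        ∑ h : Fin d → ℤˣ, ((1 / 2 ^ d : ℂ) * walsh S h) •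
          ∑ g, e.coord (pos g) x • e (pos (g * h)) := by
      intro S
      have h3 : ∀ g, ∑ h, walsh S h • e (pos (g * h)) = walsh S g • ∑ h, walsh S h • e (pos h) := by
        intro g
        rw [← Equiv.sum_comp (Equiv.mulLeft g) (fun h => walsh S h • e (pos h)), Finset.smul_sum]
        refine Finset.sum_congr rfl fun h _ => ?_
        simp only [Equiv.coe_mulLeft, smul_smul]
        rw [walsh_mul, ← mul_assoc, walsh_mul_self, one_mul]
      simp only [Finset.smul_sum, smul_smul]
      rw [Finset.sum_comm]
      have h4 : ∀ g, ∑ h, ((1 / 2 ^ d : ℂ) * walsh S h * e.coord (pos g) x) • e (pos (g * h)) =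
          ((1 / 2 ^ d : ℂ) * (walsh S g * e.coord (pos g) x)) •
            ∑ h, walsh S h • e (pos h) := by
        intro g
        rw [mul_left_comm, mul_comm (walsh S g), mul_smul, ← h3, Finset.smul_sum]
        refine Finset.sum_congr rfl fun h _ => ?_
        rw [smul_smul]
        congr 1
        ring
      rw [Finset.sum_congr rfl fun g _ => h4 g, ← Finset.sum_smul, ← Finset.mul_sum,
        ContinuousLinearMap.smulRight_apply, walshDual_apply, walshVec, smul_smul]
      congr 1
      field_simp
    rw [_root_.sum_apply, Finset.sum_congr rfl fun S _ => h2 S, Finset.sum_comm]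
    refine Finset.sum_congr rfl fun h _ => ?_
    rw [← Finset.sum_smul, Finset.mul_sum]
  have h5 : ∀ h : Fin d → ℤˣ, ‖∑ g, e.coord (pos g) x • e (pos (g * h))‖ ≤ L * (K * ‖x‖) := by
    intro h
    refine (hL.sum_le hpos (hpos.comp (mul_left_injective h)) _).trans ?_
    gcongr
    have := hK.apply_le_univ hpos (fun _ => 1) one_pos (by simp) x
    simpa using this
  rw [h1]
  calc _ ≤ ∑ h : Fin d → ℤˣ, (1 / 2 ^ d * ‖∑ S ∈ F, walsh S h‖) * (L * (K * ‖x‖)) := by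
        refine norm_sum_le_of_le _ fun h _ => ?_
        rw [norm_smul, norm_mul]
        gcongr
        · simp
        · exact h5 h
    _ = (1 / 2 ^ d * ∑ h : Fin d → ℤˣ, ‖∑ S ∈ F, walsh S h‖) * (L * (K * ‖x‖)) := by
        rw [← Finset.sum_mul, ← Finset.mul_sum]
    _ ≤ (1 / 2 ^ d * 2 ^ d) * (L * (K * ‖x‖)) := by gcongr
    _ = L * K * ‖x‖ := by field_simp

theorem norm_smulRight_walsh_le (hpos : Function.Injective pos) (hK0 : 0 ≤ K) (hL0 : 0 ≤ L)
    (hK : MultiplierBound e K) (hL : SymmetricBound e L) (S : Finset (Fin d)) :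
    ‖(walshDual e pos S).smulRight (walshVec e pos S)‖ ≤ L * K := by
  have := norm_sum_walsh_le hpos hK0 hL0 hK hL {S} (by simp [norm_walsh])
  simpa using this

theorem norm_walshVec_le (hpos : Function.Injective pos) (hK : MultiplierBound e K)
    (S : Finset (Fin d)) : ‖walshVec e pos S‖ ≤ K := by
  have hM := cubeNorm_pos (e := e) hpos
  have h := hK.sum_mul_le_mul_univ hpos (walsh S) (fun _ => 1) one_pos
    (fun g => (norm_walsh S g).le)
  simp only [mul_one, one_mul, one_smul] at h
  rw [walshVec, norm_smul, norm_inv, Complex.norm_real, Real.norm_of_nonneg hM.le,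
    inv_mul_le_iff₀ hM, mul_comm]
  exact h

theorem one_le_mul_norm_walshVec (hpos : Function.Injective pos) (hK : MultiplierBound e K)
    (S : Finset (Fin d)) : 1 ≤ K * ‖walshVec e pos S‖ := by
  have hM := cubeNorm_pos (e := e) hpos
  have h := hK.sum_mul_le_mul_univ hpos (walsh S) (walsh S) one_pos
    (fun g => (norm_walsh S g).le)
  simp only [walsh_mul_self, one_mul, one_smul] at h
  rw [walshVec, norm_smul, norm_inv, Complex.norm_real, Real.norm_of_nonneg hM.le,
    mul_left_comm, ← div_eq_inv_mul, le_div_iff₀ hM, one_mul]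
  exact h

theorem norm_walshDual_le (hpos : Function.Injective pos) (hK0 : 0 ≤ K) (hL0 : 0 ≤ L)
    (hK : MultiplierBound e K) (hL : SymmetricBound e L) (S : Finset (Fin d)) :
    ‖walshDual e pos S‖ ≤ L * K ^ 2 := by
  have h1 := norm_smulRight_walsh_le hpos hK0 hL0 hK hL S
  rw [ContinuousLinearMap.norm_smulRight_apply] at h1
  have h2 := one_le_mul_norm_walshVec hpos hK S
  calc ‖walshDual e pos S‖ ≤ ‖walshDual e pos S‖ * (K * ‖walshVec e pos S‖) :=
        le_mul_of_one_le_right (norm_nonneg _) h2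
    _ = K * (‖walshDual e pos S‖ * ‖walshVec e pos S‖) := by ring
    _ ≤ K * (L * K) := by gcongr
    _ = _ := by ring

theorem sum_rieszCoeff_walshVec (c : Fin d → ℝ) :
    ∑ S, rieszCoeff c S • walshVec e pos S =
      (cubeNorm e pos : ℂ)⁻¹ • ∑ g, riesz c g • e (pos g) := by
  simp only [walshVec, riesz_eq_sum, Finset.sum_smul, Finset.smul_sum, smul_smul]
  rw [Finset.sum_comm]
  refine Finset.sum_congr rfl fun g _ => Finset.sum_congr rfl fun S _ => ?_
  congr 1
  ring

/-- This vector is the constant function on the cube, normalized, multiplied pointwise by the Riesz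
product. -/
theorem norm_sum_rieszCoeff_walshVec_le (hpos : Function.Injective pos)
    (hK : MultiplierBound e K) (c : Fin d → ℝ) :
    ‖∑ S, rieszCoeff c S • walshVec e pos S‖ ≤ Real.exp (∑ k, c k ^ 2) * K := by
  have hM := cubeNorm_pos (e := e) hpos
  have h := hK.sum_mul_le_mul_univ hpos (riesz c) (fun _ => 1) (Real.exp_pos (∑ k, c k ^ 2))
    (norm_riesz_le c)
  simp only [mul_one, one_smul] at h
  rw [sum_rieszCoeff_walshVec, norm_smul, norm_inv, Complex.norm_real, Real.norm_of_nonneg hM.le,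
    inv_mul_le_iff₀ hM]
  refine h.trans (le_of_eq ?_)
  rw [← cubeNorm]
  ring

/-- Dual form: the sum is the functional of the trivial character evaluated at `x` multiplied
pointwise by the Riesz product. -/
theorem norm_sum_rieszCoeff_walshDual_le (hpos : Function.Injective pos) (hK0 : 0 ≤ K) (hL0 : 0 ≤ L)
    (hK : MultiplierBound e K) (hL : SymmetricBound e L) (c : Fin d → ℝ) (x : X) :
    ‖∑ S, rieszCoeff c S * walshDual e pos S x‖ ≤
      L * K ^ 2 * (Real.exp (∑ k, c k ^ 2) * (K * ‖x‖)) := by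
  classical
  have h1 : ∑ S, rieszCoeff c S * walshDual e pos S x =
      walshDual e pos ∅ (∑ g, (riesz c g * e.coord (pos g) x) • e (pos g)) := by
    have h2 : ∀ g, e.coord (pos g) (∑ h, (riesz c h * e.coord (pos h) x) • e (pos h)) =
        riesz c g * e.coord (pos g) x := by
      intro g
      simp [map_sum, coord_apply_self, hpos.eq_iff]
    simp only [walshDual_apply, h2]
    simp only [riesz_eq_sum, Finset.sum_mul, Finset.mul_sum]
    rw [Finset.sum_comm]
    refine Finset.sum_congr rfl fun g _ => Finset.sum_congr rfl fun S _ => ?_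
    simp only [walsh, Finset.prod_empty]
    ring
  rw [h1]
  refine ((walshDual e pos ∅).le_of_opNorm_le (norm_walshDual_le hpos hK0 hL0 hK hL ∅) _).trans ?_
  gcongr
  exact hK.apply_le_univ hpos _ (Real.exp_pos _) (norm_riesz_le c) x

end Block

end MaxReg

/-! ### Ordering of the Walsh system and bounds for its partial sums. -/

namespace MaxReg

/-- A disjoint union of cubes of all dimensions, each with its coordinate directions added. -/
abbrev CubeIndex : Type := Σ n : ℕ, Fin (n - 4) ⊕ (Fin (n - 4) → ℤˣ)

/-- The dual index set, with cubes replaced by their Walsh characters. -/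
abbrev WalshIndex : Type := Σ n : ℕ, Fin (n - 4) ⊕ Finset (Fin (n - 4))

/-- The inclusion of the `n`-th cube. -/
def cubePos (n : ℕ) (g : Fin (n - 4) → ℤˣ) : CubeIndex := ⟨n, Sum.inr g⟩

theorem cubePos_injective (n : ℕ) : Function.Injective (cubePos n) := fun g h hgh => by
  simpa [cubePos] using hgh

/-- The position of a Walsh character in the ordering of a block. -/
def charOrder {d : ℕ} (v : ℕ) (S : Finset (Fin d)) : ℕ :=
  -- The slots `3k + 1` and `3k + 2` are meant for the singleton `{k}` and the coordinate direction
  -- `k`, in either order; all other sets with maximum `k` share the slot `3k + 3`.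
  if S = ∅ then 0 else if S.card = 1 then 3 * S.sup Fin.val + v else 3 * S.sup Fin.val + 3

/-- The position of an element in the ordering of a block. -/
def blockOrder {d : ℕ} (u v : ℕ) : Fin d ⊕ Finset (Fin d) → ℕ :=
  Sum.elim (fun k => 3 * k.val + u) (charOrder v)

theorem charOrder_singleton {d : ℕ} (v : ℕ) (k : Fin d) : charOrder v {k} = 3 * k.val + v := by
  simp [charOrder]

theorem blockOrder_le {d u v : ℕ} (hu : u ≤ 2) (hv : v ≤ 2) (a : Fin d ⊕ Finset (Fin d)) :
    blockOrder u v a ≤ 3 * d := by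
  rcases a with k | S
  · have := k.isLt
    simp only [blockOrder, Sum.elim_inl]
    omega
  · simp only [blockOrder, Sum.elim_inr, charOrder]
    split_ifs with h1 h2
    · omega
    all_goals
      obtain ⟨i, hi, h3⟩ := Finset.exists_mem_eq_sup S (Finset.nonempty_iff_ne_empty.2 h1) Fin.val
      have := i.isLt
      omega

/-- Lowering the dimension to `n - 4` leaves enough room for the `n`-th block in the positions from
`2 ^ n` up to `2 ^ (n + 1)`, so distinct blocks never interleave. -/
theorem blockOrder_lt_two_pow {n u v : ℕ} (hu : u ≤ 2) (hv : v ≤ 2)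
    (a : Fin (n - 4) ⊕ Finset (Fin (n - 4))) : blockOrder u v a < 2 ^ n := by
  have h1 := blockOrder_le hu hv a
  rcases lt_or_ge n 4 with h | h
  · have : 0 < 2 ^ n := by positivity
    omega
  · obtain ⟨m, rfl⟩ := Nat.exists_eq_add_of_le' h
    have h2 : m < 2 ^ m := Nat.lt_two_pow_self
    rw [pow_add]
    omega

/-- The ordering of the whole system. -/
def walshOrd (u v : ℕ) (a : WalshIndex) : ℕ := 2 ^ a.1 + blockOrder u v a.2

/-- The initial segments of the system. -/
def walshInit (u v j : ℕ) : Finset WalshIndex :=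
  -- Blocks with `n ≥ j` cannot contribute, because `n < 2 ^ n`.
  (Finset.range j).sigma fun n => Finset.univ.filter fun a => 2 ^ n + blockOrder u v a < j

theorem mem_walshInit {u v j : ℕ} {a : WalshIndex} : a ∈ walshInit u v j ↔ walshOrd u v a < j := by
  simp only [walshInit, Finset.mem_sigma, Finset.mem_range, Finset.mem_filter, Finset.mem_univ,
    true_and, walshOrd, and_iff_right_iff_imp]
  intro h
  have := Nat.lt_two_pow_self (n := a.1)
  omega

theorem eq_of_walshOrd_eq {u v : ℕ} (hu : u ≤ 2) (hv : v ≤ 2) {a b : WalshIndex}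
    (h : walshOrd u v a = walshOrd u v b) :
    a.1 = b.1 ∧ blockOrder u v a.2 = blockOrder u v b.2 := by
  have h1 := blockOrder_lt_two_pow hu hv a.2
  have h2 := blockOrder_lt_two_pow hu hv b.2
  simp only [walshOrd] at h
  have h3 : a.1 = b.1 := by
    by_contra hne
    rcases lt_or_gt_of_ne hne with hlt | hlt
    · have := Nat.pow_le_pow_right (n := 2) two_pos (Nat.succ_le_of_lt hlt)
      rw [Nat.succ_eq_add_one, pow_succ] at this
      omega
    · have := Nat.pow_le_pow_right (n := 2) two_pos (Nat.succ_le_of_lt hlt)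
      rw [Nat.succ_eq_add_one, pow_succ] at this
      omega
  have h4 : 2 ^ a.1 = 2 ^ b.1 := by rw [h3]
  exact ⟨h3, by omega⟩

/-- Initial segments are powersets of the low coordinates, whose kernels are nonnegative, up to at
most one Rademacher singleton, whose projection has rank one. -/
theorem filter_charOrder_lt {d v L : ℕ} (hv : v ≤ 2) (hL : 0 < L) :
    (Finset.univ.filter fun S : Finset (Fin d) => charOrder v S < L) =
      (lowBits d ((L - 1) / 3)).powerset ∪
        (Finset.univ.filter fun S : Finset (Fin d) => S.card = 1 ∧ S.sup Fin.val = (L - 1) / 3 ∧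
          3 * ((L - 1) / 3) + v < L) := by
  set k := (L - 1) / 3 with hk
  ext S
  simp only [Finset.mem_filter, Finset.mem_univ, true_and, Finset.mem_union, Finset.mem_powerset]
  have h0 : S ⊆ lowBits d k ↔ S = ∅ ∨ (S ≠ ∅ ∧ S.sup Fin.val < k) := by
    constructor
    · intro h
      by_cases hS : S = ∅
      · exact Or.inl hS
      · obtain ⟨i, hi, h3⟩ := Finset.exists_mem_eq_sup S (Finset.nonempty_iff_ne_empty.2 hS) Fin.val
        refine Or.inr ⟨hS, ?_⟩
        rw [h3]
        simpa [lowBits] using h hi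
    · rintro (rfl | ⟨-, h⟩)
      · simp
      · intro i hi
        have : i.val ≤ S.sup Fin.val := Finset.le_sup (f := Fin.val) hi
        simp only [lowBits, Finset.mem_filter, Finset.mem_univ, true_and]
        omega
  rw [h0, charOrder]
  by_cases hS : S = ∅
  · simp [hS, hL]
  · by_cases hc : S.card = 1
    · simp only [hS, hc, if_false, if_true, ne_eq, not_false_eq_true, true_and, false_or]
      omega
    · simp only [hS, hc, if_false, ne_eq, not_false_eq_true, true_and, false_or, false_and, or_false]
      omega

variable {X : Type*} [NormedAddCommGroup X] [NormedSpace ℂ X]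
variable {e : UnconditionalSchauderBasis CubeIndex ℂ X} {K L : ℝ}

theorem norm_sum_charOrder_le {β : Type*} {e : UnconditionalSchauderBasis β ℂ X} {d : ℕ}
    {pos : (Fin d → ℤˣ) → β}
    (hpos : Function.Injective pos) (hK0 : 0 ≤ K) (hL0 : 0 ≤ L)
    (hK : MultiplierBound e K) (hL : SymmetricBound e L) {v : ℕ} (hv : v ≤ 2) (J : ℕ) :
    ‖∑ S : Finset (Fin d) with charOrder v S < J,
      (walshDual e pos S).smulRight (walshVec e pos S)‖ ≤ L * K + L * K := by
  rcases Nat.eq_zero_or_pos J with rfl | hJ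
  · simp only [not_lt_zero, Finset.filter_false, Finset.sum_empty, norm_zero]
    positivity
  rw [filter_charOrder_lt hv hJ, Finset.sum_union]
  · refine (norm_add_le _ _).trans (add_le_add ?_ ?_)
    · exact norm_sum_walsh_le hpos hK0 hL0 hK hL _ (sum_norm_sum_powerset_walsh _).le
    · refine (norm_sum_le_of_le (n := fun _ => L * K) _
        fun S _ => norm_smulRight_walsh_le hpos hK0 hL0 hK hL S).trans ?_
      rw [Finset.sum_const, nsmul_eq_mul]
      have hcard : (Finset.univ.filter fun S : Finset (Fin d) => S.card = 1 ∧
          S.sup Fin.val = (J - 1) / 3 ∧ 3 * ((J - 1) / 3) + v < J).card ≤ 1 := by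
        rw [Finset.card_le_one]
        intro S hS S' hS'
        simp only [Finset.mem_filter, Finset.mem_univ, true_and] at hS hS'
        obtain ⟨i, rfl⟩ := Finset.card_eq_one.1 hS.1
        obtain ⟨i', rfl⟩ := Finset.card_eq_one.1 hS'.1
        simp only [Finset.sup_singleton] at hS hS'
        rw [Fin.ext (hS.2.1.trans hS'.2.1.symm)]
      have : ((Finset.univ.filter fun S : Finset (Fin d) => S.card = 1 ∧
          S.sup Fin.val = (J - 1) / 3 ∧ 3 * ((J - 1) / 3) + v < J).card : ℝ) ≤ 1 := by
        exact_mod_cast hcard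
      exact mul_le_of_le_one_left (by positivity) this
  · rw [Finset.disjoint_left]
    intro S hS hS'
    simp only [Finset.mem_filter, Finset.mem_univ, true_and, Finset.mem_powerset] at hS hS'
    obtain ⟨i, rfl⟩ := Finset.card_eq_one.1 hS'.1
    have := hS (Finset.mem_singleton_self i)
    simp only [lowBits, Finset.mem_filter, Finset.mem_univ, true_and] at this
    simp only [Finset.sup_singleton] at hS'
    omega

/-- The vectors of the Walsh system. -/
def sysVec (e : UnconditionalSchauderBasis CubeIndex ℂ X) : WalshIndex → X
  | ⟨n, Sum.inl k⟩ => e ⟨n, Sum.inl k⟩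
  | ⟨n, Sum.inr S⟩ => walshVec e (cubePos n) S

/-- The functionals of the Walsh system. -/
def sysDual (e : UnconditionalSchauderBasis CubeIndex ℂ X) : WalshIndex → StrongDual ℂ X
  | ⟨n, Sum.inl k⟩ => e.coord ⟨n, Sum.inl k⟩
  | ⟨n, Sum.inr S⟩ => walshDual e (cubePos n) S

theorem sys_biorthogonal (e : UnconditionalSchauderBasis CubeIndex ℂ X) (a b : WalshIndex) :
    sysDual e a (sysVec e b) = if a = b then 1 else 0 := by
  obtain ⟨n, a⟩ := a
  obtain ⟨m, b⟩ := b
  by_cases hnm : n = m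
  · subst hnm
    rcases a with k | S <;> rcases b with l | S'
    · simp [sysDual, sysVec, coord_apply_self]
    · simp [sysDual, sysVec, coord_apply_self, walshVec, cubePos]
    · simp [sysDual, sysVec, coord_apply_self, walshDual_apply, cubePos]
    · simp [sysDual, sysVec, walshDual_walshVec (cubePos_injective n)]
  · have h0 : (⟨n, a⟩ : WalshIndex) ≠ ⟨m, b⟩ := fun h => hnm (congrArg Sigma.fst h)
    have h1 : ∀ p q, e.coord ⟨n, p⟩ (e ⟨m, q⟩) = 0 := fun p q => by
      rw [coord_apply_self, if_neg fun h => hnm (congrArg Sigma.fst h)]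
    rw [if_neg h0]
    rcases a with k | S <;> rcases b with l | S'
    · simp [sysDual, sysVec, h1]
    · simp [sysDual, sysVec, h1, walshVec, cubePos]
    · simp [sysDual, sysVec, h1, walshDual_apply, cubePos]
    · simp [sysDual, sysVec, h1, walshDual_apply, walshVec, cubePos]

theorem dense_span_sysVec (e : UnconditionalSchauderBasis CubeIndex ℂ X) :
    Dense (Submodule.span ℂ (Set.range (sysVec e)) : Set X) := by
  refine (dense_span_range e).mono (Submodule.span_le.2 ?_)
  rintro _ ⟨⟨n, k | g⟩, rfl⟩
  · exact Submodule.subset_span ⟨⟨n, Sum.inl k⟩, rfl⟩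
  · have h := sum_walsh_smul_walshVec (e := e) (cubePos_injective n) g
    rw [cubePos] at h
    rw [← h]
    exact Submodule.smul_mem _ _ (Submodule.sum_mem _ fun S _ => Submodule.smul_mem _ _
      (Submodule.subset_span ⟨⟨n, Sum.inr S⟩, rfl⟩))

/-- A complete block of the Walsh system spans the same vectors as the basis block. Any number of
complete blocks therefore adds up to a single coordinate projection of the basis. -/
theorem sum_block_eq (e : UnconditionalSchauderBasis CubeIndex ℂ X) (n : ℕ) :
    ∑ a, (sysDual e ⟨n, a⟩).smulRight (sysVec e ⟨n, a⟩) =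
      ∑ a, (e.coord ⟨n, a⟩).smulRight (e ⟨n, a⟩) := by
  rw [Fintype.sum_sum_type, Fintype.sum_sum_type]
  congr 1
  simp only [sysDual, sysVec]
  ext x
  have hM : (cubeNorm e (cubePos n) : ℂ) ≠ 0 := by
    exact_mod_cast (cubeNorm_pos (cubePos_injective n)).ne'
  simp only [_root_.sum_apply, ContinuousLinearMap.smulRight_apply, walshDual_apply]
  have h1 : ∀ g : Fin (n - 4) → ℤˣ, e.coord ⟨n, Sum.inr g⟩ x • e ⟨n, Sum.inr g⟩ =
      ∑ S, ((cubeNorm e (cubePos n) : ℂ) / 2 ^ (n - 4) *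
        (walsh S g * e.coord (cubePos n g) x)) • walshVec e (cubePos n) S := by
    intro g
    have h := sum_walsh_smul_walshVec (e := e) (cubePos_injective n) g
    rw [cubePos] at h
    rw [← h, smul_smul, Finset.smul_sum]
    refine Finset.sum_congr rfl fun S _ => ?_
    rw [smul_smul, cubePos]
    congr 1
    ring
  rw [Finset.sum_congr rfl fun g _ => h1 g, Finset.sum_comm]
  refine Finset.sum_congr rfl fun S _ => ?_
  rw [← Finset.sum_smul, Finset.mul_sum]

theorem norm_sum_block_le (hK0 : 0 ≤ K) (hL0 : 0 ≤ L) (hK : MultiplierBound e K)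
    (hL : SymmetricBound e L) {u v : ℕ} (hv : v ≤ 2) (n J : ℕ) :
    ‖∑ a : Fin (n - 4) ⊕ Finset (Fin (n - 4)) with blockOrder u v a < J,
      (sysDual e ⟨n, a⟩).smulRight (sysVec e ⟨n, a⟩)‖ ≤ K + (L * K + L * K) := by
  classical
  rw [Finset.sum_filter, Fintype.sum_sum_type, ← Finset.sum_filter, ← Finset.sum_filter]
  refine (norm_add_le _ _).trans (add_le_add ?_ ?_)
  · have h := hK.norm_proj_le hK0 ((Finset.univ.filter fun k : Fin (n - 4) =>
      blockOrder u v (Sum.inl k : Fin (n - 4) ⊕ Finset (Fin (n - 4))) < J).map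
        ⟨fun k => (⟨n, Sum.inl k⟩ : CubeIndex), fun a b h => by simpa using h⟩)
    rw [GeneralSchauderBasis.proj, Finset.sum_map] at h
    exact h
  · exact norm_sum_charOrder_le (cubePos_injective n) hK0 hL0 hK hL hv J

theorem norm_sum_walshInit_le (hK0 : 0 ≤ K) (hL0 : 0 ≤ L) (hK : MultiplierBound e K)
    (hL : SymmetricBound e L) {u v : ℕ} (hu : u ≤ 2) (hv : v ≤ 2) (j : ℕ) :
    ‖∑ a ∈ walshInit u v j, (sysDual e a).smulRight (sysVec e a)‖ ≤
      K + (K + (L * K + L * K)) := by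
  classical
  rcases Nat.eq_zero_or_pos j with rfl | hj
  · have h0 : walshInit u v 0 = ∅ := by ext a; simp [mem_walshInit]
    rw [h0, Finset.sum_empty, norm_zero]
    positivity
  -- Only the block `m` is cut by the segment: earlier blocks are complete, later ones are absent.
  set m := Nat.log 2 j with hm
  have hm1 : 2 ^ m ≤ j := Nat.pow_log_le_self 2 hj.ne'
  have hm2 : j < 2 ^ (m + 1) := Nat.lt_pow_succ_log_self one_lt_two j
  have hmj : m < j := (Nat.lt_two_pow_self (n := m)).trans_le hm1
  rw [walshInit, Finset.sum_sigma]
  have h1 : ∑ n ∈ Finset.range j, ∑ a : Fin (n - 4) ⊕ Finset (Fin (n - 4)) with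
      2 ^ n + blockOrder u v a < j, (sysDual e ⟨n, a⟩).smulRight (sysVec e ⟨n, a⟩) =
      ∑ n ∈ Finset.range (m + 1), ∑ a : Fin (n - 4) ⊕ Finset (Fin (n - 4)) with
      2 ^ n + blockOrder u v a < j, (sysDual e ⟨n, a⟩).smulRight (sysVec e ⟨n, a⟩) := by
    symm
    refine Finset.sum_subset (fun n hn => by simp at hn ⊢; omega) fun n _ hn => ?_
    have h2 : m + 1 ≤ n := by simpa using hn
    have h3 := Nat.pow_le_pow_right (n := 2) two_pos h2
    rw [Finset.filter_false_of_mem (fun a _ => by omega), Finset.sum_empty]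
  rw [h1, Finset.sum_range_succ]
  refine (norm_add_le _ _).trans (add_le_add ?_ ?_)
  · have h4 : ∑ n ∈ Finset.range m, ∑ a : Fin (n - 4) ⊕ Finset (Fin (n - 4)) with
        2 ^ n + blockOrder u v a < j, (sysDual e ⟨n, a⟩).smulRight (sysVec e ⟨n, a⟩) =
        e.proj ((Finset.range m).sigma fun _ => Finset.univ) := by
      rw [GeneralSchauderBasis.proj, Finset.sum_sigma]
      refine Finset.sum_congr rfl fun n hn => ?_
      rw [Finset.filter_true_of_mem, sum_block_eq]
      intro a _
      have h5 := blockOrder_lt_two_pow hu hv a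
      have h6 := Nat.pow_le_pow_right (n := 2) two_pos (Nat.succ_le_of_lt (Finset.mem_range.1 hn))
      rw [Nat.succ_eq_add_one, pow_succ] at h6
      omega
    rw [h4]
    exact hK.norm_proj_le hK0 _
  · have h7 : (Finset.univ.filter fun a : Fin (m - 4) ⊕ Finset (Fin (m - 4)) =>
        2 ^ m + blockOrder u v a < j) =
        Finset.univ.filter fun a => blockOrder u v a < j - 2 ^ m :=
      Finset.filter_congr fun a _ => by omega
    rw [h7]
    exact norm_sum_block_le hK0 hL0 hK hL hv m _

end MaxReg

/-! ### Comparing coordinate directions with Rademacher vectors. -/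

namespace MaxReg

variable {X : Type*} [NormedAddCommGroup X] [NormedSpace ℂ X]
variable {e : UnconditionalSchauderBasis CubeIndex ℂ X} {K L : ℝ}

/-- The matching sending a coordinate direction to the corresponding Rademacher function. -/
def toChar : WalshIndex → WalshIndex
  | ⟨n, Sum.inl k⟩ => ⟨n, Sum.inr {k}⟩
  | ⟨n, Sum.inr S⟩ => ⟨n, Sum.inr S⟩

open scoped Classical in
/-- The matching sending a Rademacher function to the corresponding coordinate direction. -/
def toCoord : WalshIndex → WalshIndex
  | ⟨n, Sum.inl k⟩ => ⟨n, Sum.inl k⟩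
  | ⟨n, Sum.inr S⟩ => if h : ∃ k, S = {k} then ⟨n, Sum.inl h.choose⟩ else ⟨n, Sum.inr S⟩

theorem toCoord_singleton {n : ℕ} (k : Fin (n - 4)) :
    toCoord ⟨n, Sum.inr {k}⟩ = ⟨n, Sum.inl k⟩ := by
  have h : ∃ l : Fin (n - 4), ({k} : Finset (Fin (n - 4))) = {l} := ⟨k, rfl⟩
  rw [toCoord, dif_pos h, ← Finset.singleton_injective h.choose_spec]

theorem sum_finset_eq_sum_singleton {d : ℕ} {M : Type*} [AddCommMonoid M] (F : Finset (Fin d) → M)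
    (h : ∀ S, (∀ k, S ≠ {k}) → F S = 0) : ∑ S, F S = ∑ k, F {k} := by
  classical
  rw [← Finset.sum_image (f := F) (s := Finset.univ) (g := fun k : Fin d => {k})
    (fun a _ b _ h => Finset.singleton_injective h)]
  symm
  refine Finset.sum_subset (Finset.subset_univ _) fun S _ hS => h S fun k hk => hS ?_
  exact Finset.mem_image.2 ⟨k, Finset.mem_univ k, hk.symm⟩

theorem const_bound (hK1 : 1 ≤ K) (hL1 : 1 ≤ L) :
    K + (K + (L * K + L * K)) ≤ 4 * (L * K ^ 2) ∧ K * K ≤ 4 * (L * K ^ 2) ∧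
      L * K ^ 2 ≤ 4 * (L * K ^ 2) := by
  have h1 : K ≤ K ^ 2 := by nlinarith
  have h2 : K ^ 2 ≤ L * K ^ 2 := le_mul_of_one_le_left (by positivity) hL1
  have h3 : L * K ≤ L * K ^ 2 := by gcongr
  have h4 : 0 < L * K ^ 2 := by positivity
  refine ⟨by linarith, ?_, by linarith⟩
  nlinarith

/-- Forcing along the coordinate directions gives an output whose Walsh coefficients are `r k * sin`
at the singletons and zero elsewhere. Testing it against a Riesz product bounds its norm below by `∑
r k ^ 2 * sin ^ 2`, up to a constant. -/
theorem exists_lower_bound [CompleteSpace X] {T : ℝ} (hT : 0 < T) (hX : MRP T X)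
    (he : ∀ i, ‖e i‖ = 1) (hK1 : 1 ≤ K) (hL1 : 1 ≤ L) (hK : MultiplierBound e K)
    (hL : SymmetricBound e L) :
    ∃ C : ℝ, 0 ≤ C ∧ ∀ (n : ℕ) (r : Fin (n - 4) → ℝ), ∑ k, r k ^ 2 = 1 →
      1 ≤ C * ‖∑ k, (r k : ℂ) • e ⟨n, Sum.inl k⟩‖ := by
  classical
  have hK0 : 0 ≤ K := zero_le_one.trans hK1
  have hL0 : 0 ≤ L := zero_le_one.trans hL1
  obtain ⟨hc1, hc2, -⟩ := const_bound hK1 hL1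
  obtain ⟨C, hC, H⟩ := exists_twist_response hX (c := 2 * Real.pi / T) (by positivity)
    (sys_biorthogonal e) (dense_span_sysVec e) (ord := walshOrd 1 2) (F := walshInit 1 2)
    (fun j a => mem_walshInit) (K := 4 * (L * K ^ 2))
    (fun j => (norm_sum_walshInit_le hK0 hL0 hK hL (by norm_num) (by norm_num) j).trans hc1)
    (A := {a | ∃ n k, a = ⟨n, Sum.inl k⟩}) (τ := toChar)
    (by
      rintro _ ⟨n, k, rfl⟩
      simp [toChar, walshOrd, blockOrder, charOrder_singleton]
      ring)
    (by
      rintro _ ⟨n, k, rfl⟩ ⟨m, l, h⟩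
      simp only [toChar] at h
      obtain ⟨rfl, h⟩ := Sigma.mk.inj h
      simp at h)
    (by
      rintro _ ⟨n, k, rfl⟩ _ ⟨m, l, rfl⟩ h
      obtain ⟨h1, h2⟩ := eq_of_walshOrd_eq (by norm_num) (by norm_num) h
      simp only at h1
      subst h1
      simp only [blockOrder, Sum.elim_inl] at h2
      have : k = l := Fin.ext (by omega)
      rw [this])
    (by
      rintro _ ⟨n, k, rfl⟩
      refine le_trans ?_ hc2
      simp only [toChar, sysDual, sysVec]
      gcongr
      · exact hK.norm_coord_le hK0 he _
      · exact norm_walshVec_le (cubePos_injective n) hK _)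
  refine ⟨2 / T * (L * K ^ 2 * (Real.exp 1 * K) * (C * (6 * K))), by positivity, fun n r hr => ?_⟩
  set p : Fin (n - 4) → CubeIndex := fun k => ⟨n, Sum.inl k⟩ with hp
  have hpi : Function.Injective p := fun a b h => by simpa [hp] using h
  set α : Fin (n - 4) → ℝ := fun k => 2 * Real.pi / T * 2 ^ walshOrd 1 2 ⟨n, Sum.inl k⟩ with hα
  set S₀ : ℝ := ‖∑ k, (r k : ℂ) • e ⟨n, Sum.inl k⟩‖ with hS₀
  have hcoord : ∀ (t : ℝ) (k : Fin (n - 4)), e.coord ⟨n, Sum.inl k⟩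
      (∑ k, ((pairForcing (α k) t : ℂ) * r k) • e (p k)) = (pairForcing (α k) t : ℂ) * r k := by
    intro t k
    simp [map_sum, coord_apply_self, hp]
  have hcoord' : ∀ (t : ℝ) (g : Fin (n - 4) → ℤˣ), e.coord ⟨n, Sum.inr g⟩
      (∑ k, ((pairForcing (α k) t : ℂ) * r k) • e (p k)) = 0 := by
    intro t g
    simp [map_sum, coord_apply_self, hp]
  obtain ⟨w, hw1, hw2, hw3, hw4⟩ := H (Finset.univ.map ⟨Sigma.mk n, sigma_mk_injective⟩)
    (fun t => ∑ k, ((pairForcing (α k) t : ℂ) * r k) • e (p k)) (6 * (K * S₀))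
    (by fun_prop) (by positivity)
    (fun t _ => hK.sum_mul_le_mul_univ hpi _ _ (by norm_num) fun k => by
      rw [Complex.norm_real]; exact abs_pairForcing_le _ _)
  have hdual0 : ∀ (t : ℝ) S, walshDual e (cubePos n) S
      (∑ k, ((pairForcing (α k) t : ℂ) * r k) • e (p k)) = 0 := by
    intro t S
    rw [walshDual_apply]
    simp [cubePos, hcoord']
  have h1 : ∀ k, ∀ᵐ t ∂(volume.restrict (Set.Ico (0 : ℝ) T)),
      walshDual e (cubePos n) {k} (w t) = r k * Real.sin (α k * t) := by
    intro k
    refine hw3 ⟨n, Sum.inl k⟩ (by simp) ⟨n, k, rfl⟩ (r k) (fun t _ => ?_) (fun t _ => ?_)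
    · exact (hcoord t k).trans (mul_comm _ _)
    · exact hdual0 t {k}
  have h2 : ∀ S, (∀ k, S ≠ {k}) → ∀ᵐ t ∂(volume.restrict (Set.Ico (0 : ℝ) T)),
      walshDual e (cubePos n) S (w t) = 0 := by
    intro S hS
    refine hw4 ⟨n, Sum.inr S⟩ (by simp) ?_ ?_ (fun t _ => hdual0 t S)
    · rintro ⟨m, l, h⟩
      obtain ⟨rfl, h⟩ := Sigma.mk.inj h
      simp at h
    · rintro ⟨_, ⟨m, l, rfl⟩, h⟩
      simp only [toChar] at h
      obtain ⟨rfl, h⟩ := Sigma.mk.inj h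
      simp only [heq_eq_eq, Sum.inr.injEq] at h
      exact hS l h.symm
  have h1' := ae_all_iff.2 h1
  have h2' : ∀ᵐ t ∂(volume.restrict (Set.Ico (0 : ℝ) T)), ∀ S, (∀ k, S ≠ {k}) →
      walshDual e (cubePos n) S (w t) = 0 := by
    rw [ae_all_iff]
    intro S
    by_cases hS : ∀ k, S ≠ {k}
    · filter_upwards [h2 S hS] with t ht _ using ht
    · exact Eventually.of_forall fun t h => absurd h hS
  have h3 : ∀ᵐ t ∂(volume.restrict (Set.Ico (0 : ℝ) T)),
      ∑ k, r k ^ 2 * Real.sin (α k * t) ^ 2 ≤ L * K ^ 2 * (Real.exp 1 * K) * ‖w t‖ := by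
    filter_upwards [h1', h2'] with t ht1 ht2
    set c : Fin (n - 4) → ℝ := fun k => r k * Real.sin (α k * t) with hc
    -- The Riesz product is adapted to the coefficients of `w t` themselves. The non-singleton terms
    -- vanish, and the rest is `i` times a sum of squares.
    have h4 := norm_sum_rieszCoeff_walshDual_le (cubePos_injective n) hK0 hL0 hK hL c (w t)
    rw [sum_finset_eq_sum_singleton _ fun S hS => by rw [ht2 S hS, mul_zero]] at h4
    have h5 : ∑ k, rieszCoeff c {k} * walshDual e (cubePos n) {k} (w t) =
        Complex.I * ((∑ k, r k ^ 2 * Real.sin (α k * t) ^ 2 : ℝ) : ℂ) := by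
      rw [Complex.ofReal_sum, Finset.mul_sum]
      refine Finset.sum_congr rfl fun k _ => ?_
      rw [ht1 k, rieszCoeff, Finset.prod_singleton, hc]
      push_cast
      ring
    have h6 : ∑ k, c k ^ 2 ≤ 1 := by
      rw [← hr]
      refine Finset.sum_le_sum fun k _ => ?_
      rw [hc, mul_pow]
      exact mul_le_of_le_one_right (sq_nonneg _) (Real.sin_sq_le_one _)
    rw [h5, norm_mul, Complex.norm_I, one_mul, Complex.norm_real] at h4
    calc _ ≤ _ := (le_abs_self _).trans h4
      _ ≤ L * K ^ 2 * (Real.exp 1 * (K * ‖w t‖)) := by gcongr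
      _ = _ := by ring
  have hintg : ∀ k, IntegrableOn (fun t => r k ^ 2 * Real.sin (α k * t) ^ 2) (Set.Ico 0 T) :=
    fun k => ((by fun_prop : Continuous fun t => r k ^ 2 * Real.sin (α k * t) ^
      2).integrableOn_Icc).mono_set Set.Ico_subset_Icc_self
  have h7 := integral_mono_ae (integrable_finsetSum _ fun k _ => hintg k) (hw1.norm.const_mul _) h3
  rw [integral_finsetSum _ fun k _ => hintg k, integral_const_mul] at h7
  simp_rw [integral_const_mul, hα, integral_sin_sq_period hT] at h7
  rw [← Finset.sum_mul, hr, one_mul] at h7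
  calc (1 : ℝ) = 2 / T * (T / 2) := by field_simp
    _ ≤ 2 / T * (L * K ^ 2 * (Real.exp 1 * K) * (C * (6 * (K * S₀)))) := by
        gcongr
        exact h7.trans (by gcongr)
    _ = _ := by ring

/-- A Riesz product vector is bounded and has prescribed Rademacher coefficients. Used as forcing,
it transfers them to the coordinate directions; its other Walsh coefficients play no role. -/
theorem exists_upper_bound [CompleteSpace X] {T : ℝ} (hT : 0 < T) (hX : MRP T X)
    (he : ∀ i, ‖e i‖ = 1) (hK1 : 1 ≤ K) (hL1 : 1 ≤ L) (hK : MultiplierBound e K)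
    (hL : SymmetricBound e L) :
    ∃ C : ℝ, 0 ≤ C ∧ ∀ (n : ℕ) (r : Fin (n - 4) → ℝ), ∑ k, r k ^ 2 = 1 →
      ‖∑ k, (r k : ℂ) • e ⟨n, Sum.inl k⟩‖ ≤ C := by
  classical
  have hK0 : 0 ≤ K := zero_le_one.trans hK1
  have hL0 : 0 ≤ L := zero_le_one.trans hL1
  obtain ⟨hc1, -, hc3⟩ := const_bound hK1 hL1
  obtain ⟨C, hC, H⟩ := exists_twist_response hX (c := 2 * Real.pi / T) (by positivity)
    (sys_biorthogonal e) (dense_span_sysVec e) (ord := walshOrd 2 1) (F := walshInit 2 1)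
    (fun j a => mem_walshInit) (K := 4 * (L * K ^ 2))
    (fun j => (norm_sum_walshInit_le hK0 hL0 hK hL (by norm_num) (by norm_num) j).trans hc1)
    (A := {a | ∃ n k, a = ⟨n, Sum.inr {k}⟩}) (τ := toCoord)
    (by
      rintro _ ⟨n, k, rfl⟩
      rw [toCoord_singleton]
      simp [walshOrd, blockOrder, charOrder_singleton]
      ring)
    (by
      rintro _ ⟨n, k, rfl⟩ ⟨m, l, h⟩
      rw [toCoord_singleton] at h
      obtain ⟨rfl, h⟩ := Sigma.mk.inj h
      simp at h)
    (by
      rintro _ ⟨n, k, rfl⟩ _ ⟨m, l, rfl⟩ h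
      obtain ⟨h1, h2⟩ := eq_of_walshOrd_eq (by norm_num) (by norm_num) h
      simp only at h1
      subst h1
      simp only [blockOrder, Sum.elim_inr, charOrder_singleton] at h2
      have : k = l := Fin.ext (by omega)
      rw [this])
    (by
      rintro _ ⟨n, k, rfl⟩
      refine le_trans ?_ hc3
      rw [toCoord_singleton]
      simp only [sysDual, sysVec, he, mul_one]
      exact norm_walshDual_le (cubePos_injective n) hK0 hL0 hK hL _)
  refine ⟨2 / T * (K * (C * (Real.exp 36 * K))), by positivity, fun n r hr => ?_⟩
  set α : Fin (n - 4) → ℝ := fun k => 2 * Real.pi / T * 2 ^ walshOrd 2 1 ⟨n, Sum.inr {k}⟩ with hα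
  set c : ℝ → Fin (n - 4) → ℝ := fun t k => r k * pairForcing (α k) t with hc
  -- Here `36 = 6 ^ 2`, from the bound on `pairForcing` and the normalization of `r`.
  have hc36 : ∀ t, ∑ k, c t k ^ 2 ≤ 36 := by
    intro t
    calc ∑ k, c t k ^ 2 ≤ ∑ k, r k ^ 2 * 36 := by
          refine Finset.sum_le_sum fun k _ => ?_
          rw [hc, mul_pow]
          gcongr
          have := abs_pairForcing_le (α k) t
          calc pairForcing (α k) t ^ 2 = |pairForcing (α k) t| ^ 2 := (sq_abs _).symm
            _ ≤ 6 ^ 2 := by gcongr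
            _ = 36 := by norm_num
      _ = 36 := by rw [← Finset.sum_mul, hr, one_mul]
  -- The factor `-i` cancels the `i` in the singleton coefficients `i c_k` of the Riesz product.
  have hcont : Continuous fun t => (-Complex.I) • ∑ S, rieszCoeff (c t) S •
      walshVec e (cubePos n) S := by
    simp only [rieszCoeff, hc]
    fun_prop
  obtain ⟨w, hw1, hw2, hw3, -⟩ := H (Finset.univ.map ⟨Sigma.mk n, sigma_mk_injective⟩)
    (fun t => (-Complex.I) • ∑ S, rieszCoeff (c t) S • walshVec e (cubePos n) S)
    (Real.exp 36 * K) hcont (by positivity)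
    (fun t _ => by
      rw [norm_smul, norm_neg, Complex.norm_I, one_mul]
      refine (norm_sum_rieszCoeff_walshVec_le (cubePos_injective n) hK (c t)).trans ?_
      gcongr
      exact hc36 t)
  have hinj : Set.InjOn (fun k : Fin (n - 4) => (⟨n, Sum.inl k⟩ : CubeIndex))
      (Finset.univ : Finset (Fin (n - 4))) := fun a _ b _ h => by simpa using h
  have h1 := norm_sum_le_of_coord_eq_sin hT hK Finset.univ hinj (fun k => (r k : ℂ))
    (fun k => walshOrd 2 1 ⟨n, Sum.inr {k}⟩) hw1 ?_
  · calc _ = 2 / T * (T / 2 * ‖∑ k, (r k : ℂ) • e ⟨n, Sum.inl k⟩‖) := by field_simp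
      _ ≤ _ := mul_le_mul_of_nonneg_left (h1.trans (mul_le_mul_of_nonneg_left hw2 (by positivity)))
          (by positivity)
  · intro k _
    have h2 := hw3 ⟨n, Sum.inr {k}⟩ (by simp) ⟨n, k, rfl⟩ (r k) (fun t _ => ?_) (fun t _ => ?_)
    · rw [toCoord_singleton] at h2
      exact h2
    · change walshDual e (cubePos n) {k} _ = _
      rw [map_smul, map_sum]
      simp only [map_smul, walshDual_walshVec (cubePos_injective n), smul_eq_mul, mul_ite, mul_one,
        mul_zero, Finset.sum_ite_eq, Finset.mem_univ, if_true, rieszCoeff, Finset.prod_singleton]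
      rw [← mul_assoc, neg_mul, Complex.I_mul_I, neg_neg, one_mul, hc]
      push_cast
      rfl
    · rw [toCoord_singleton]
      change e.coord ⟨n, Sum.inl k⟩ _ = _
      simp [map_sum, walshVec, coord_apply_self, cubePos]

end MaxReg

/-! ### Isomorphism with `ℓ₂` and complemented subspaces. -/

namespace MaxReg

variable {X : Type*} [NormedAddCommGroup X] [NormedSpace ℂ X]

theorem basis_ne_zero {β : Type*} (b : UnconditionalSchauderBasis β ℂ X) (i : β) : b i ≠ 0 :=
  b.linearIndependent.ne_zero i

/-- The unconditional basis obtained by normalizing the basis vectors. -/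
def normalizedBasis {β : Type*} (b : UnconditionalSchauderBasis β ℂ X) :
    UnconditionalSchauderBasis β ℂ X where
  basis i := ((‖b i‖ : ℂ)⁻¹) • b i
  coord i := (‖b i‖ : ℂ) • b.coord i
  ortho i j := by
    classical
    have h : (‖b j‖ : ℂ) ≠ 0 := by exact_mod_cast norm_ne_zero_iff.2 (basis_ne_zero b j)
    rw [_root_.smul_apply, map_smul, coord_apply_self]
    by_cases hij : i = j
    · subst hij
      simp [basis_ne_zero b i]
    · simp [hij]
  expansion x := by
    convert b.expansion x using 2 with i
    have h : (‖b i‖ : ℂ) ≠ 0 := by exact_mod_cast norm_ne_zero_iff.2 (basis_ne_zero b i)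
    rw [_root_.smul_apply, smul_smul, smul_eq_mul]
    congr 1
    field_simp

theorem norm_normalizedBasis {β : Type*} (b : UnconditionalSchauderBasis β ℂ X) (i : β) :
    ‖normalizedBasis b i‖ = 1 := by
  change ‖((‖b i‖ : ℂ)⁻¹) • b i‖ = 1
  rw [norm_smul, norm_inv, Complex.norm_real, norm_norm,
    inv_mul_cancel₀ (norm_ne_zero_iff.2 (basis_ne_zero b i))]

/-- The unconditional basis reindexed along an equivalence. -/
def reindexBasis {β γ : Type*} (b : UnconditionalSchauderBasis β ℂ X) (σ : γ ≃ β) :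
    UnconditionalSchauderBasis γ ℂ X where
  basis i := b (σ i)
  coord i := b.coord (σ i)
  ortho i j := by
    classical
    rw [coord_apply_self]
    simp [Pi.single_apply]
  expansion x := (σ.hasSum_iff (f := fun i => b.coord i x • b i)).2 (b.expansion x)

theorem SymmetricBound.reindexBasis {β γ : Type*} {b : UnconditionalSchauderBasis β ℂ X} {L : ℝ}
    (hL : SymmetricBound b L) (σ : γ ≃ β) : SymmetricBound (reindexBasis b σ) L := by
  classical
  intro s τ a hτ
  have h := hL.sum_le (ι := s) (p := fun i => σ i) (q := fun i => σ (τ i))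
    (fun i j h => Subtype.ext (σ.injective h))
    (fun i j h => Subtype.ext (hτ i.2 j.2 (σ.injective h))) (fun i => a i)
  rwa [Finset.sum_coe_sort s fun i => a i • b (σ (τ i)),
    Finset.sum_coe_sort s fun i => a i • b (σ i)] at h

theorem exists_equiv_lp [CompleteSpace X] (e : UnconditionalSchauderBasis ℕ ℂ X) {C : ℝ}
    (hC : 0 ≤ C)
    (hup : ∀ (s : Finset ℕ) (a : ℕ → ℂ), ‖∑ i ∈ s, a i • e i‖ ^ 2 ≤ C * ∑ i ∈ s, ‖a i‖ ^ 2)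
    (hlow : ∀ (s : Finset ℕ) (a : ℕ → ℂ), ∑ i ∈ s, ‖a i‖ ^ 2 ≤ C * ‖∑ i ∈ s, a i • e i‖ ^ 2) :
    Nonempty (X ≃L[ℂ] lp (fun _ : ℕ => ℂ) 2) := by
  classical
  obtain ⟨K, hK1, hK⟩ := exists_multiplierBound e
  have hK0 : 0 ≤ K := zero_le_one.trans hK1
  have hsum : ∀ (s : Finset ℕ) (x : X), ∑ i ∈ s, ‖e.coord i x‖ ^ 2 ≤ (√C * K * ‖x‖) ^ 2 := by
    intro s x
    refine (hlow s _).trans ?_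
    rw [mul_assoc, mul_pow, Real.sq_sqrt hC]
    gcongr
    simpa using hK s (fun _ => 1) (by simp) x
  have htwo : (2 : ENNReal).toReal = 2 := by simp
  have hmem : ∀ x : X, Memℓp (fun i => e.coord i x) 2 := fun x =>
    memℓp_gen' (C := (√C * K * ‖x‖) ^ 2) fun s => by
      rw [htwo]; exact_mod_cast hsum s x
  let φ : X →ₗ[ℂ] lp (fun _ : ℕ => ℂ) 2 :=
    { toFun := fun x => ⟨fun i => e.coord i x, hmem x⟩
      map_add' := fun x y => by ext i; exact map_add (e.coord i) x y
      map_smul' := fun c x => by ext i; simp }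
  have hφ : ∀ x i, φ x i = e.coord i x := fun _ _ => rfl
  have hb1 : ∀ x, ‖φ x‖ ≤ √C * K * ‖x‖ := by
    intro x
    refine lp.norm_le_of_forall_sum_le (by simp) (by positivity) fun s => ?_
    rw [htwo]
    exact_mod_cast hsum s x
  have hfin : ∀ (a : lp (fun _ : ℕ => ℂ) 2) (s : Finset ℕ), ∑ i ∈ s, ‖a i‖ ^ 2 ≤ ‖a‖ ^ 2 := by
    intro a s
    have := lp.sum_rpow_le_norm_rpow (p := 2) (by simp) a s
    rw [htwo] at this
    exact_mod_cast this
  have hb2 : ∀ x, ‖x‖ ≤ √C * ‖φ x‖ := by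
    intro x
    refine le_of_tendsto (e.tendsto_proj x).norm (Eventually.of_forall fun s => ?_)
    rw [GeneralSchauderBasis.proj_apply]
    refine le_of_sq_le_sq ?_ (by positivity)
    rw [mul_pow, Real.sq_sqrt hC]
    exact (hup s _).trans (by gcongr; exact hfin (φ x) s)
  have hinj : Function.Injective φ := by
    rw [injective_iff_map_eq_zero]
    intro x hx
    have := hb2 x
    rw [hx, norm_zero, mul_zero] at this
    exact norm_le_zero_iff.1 this
  have hsurj : Function.Surjective φ := by
    intro a
    have hs2 : Summable fun i => ‖a i‖ ^ 2 := by
      have := (lp.memℓp a).summable (by simp)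
      rw [htwo] at this
      exact_mod_cast this
    have hs : Summable fun i => a i • e i := by
      rw [summable_iff_vanishing_norm]
      intro ε hε
      obtain ⟨s, hs⟩ := summable_iff_vanishing_norm.1 hs2 (ε ^ 2 / (C + 1)) (by positivity)
      refine ⟨s, fun t ht => ?_⟩
      have h1 := hs t ht
      rw [Real.norm_of_nonneg (Finset.sum_nonneg fun _ _ => by positivity),
        lt_div_iff₀ (by positivity)] at h1
      have h2 := hup t a
      have h3 : 0 ≤ ∑ i ∈ t, ‖a i‖ ^ 2 := Finset.sum_nonneg fun _ _ => by positivity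
      refine lt_of_pow_lt_pow_left₀ 2 hε.le ?_
      nlinarith
    refine ⟨∑' i, a i • e i, ?_⟩
    ext i
    rw [hφ, (e.coord i).map_tsum hs, tsum_eq_single i fun j hj => ?_]
    · simp [coord_apply_self]
    · simp [coord_apply_self, hj.symm]
  exact ⟨(LinearEquiv.ofBijective φ ⟨hinj, hsurj⟩).toContinuousLinearEquivOfBounds (√C * K) √C
    hb1 fun y => by
      obtain ⟨x, rfl⟩ := hsurj y
      have : (LinearEquiv.ofBijective φ ⟨hinj, hsurj⟩).symm (φ x) = x :=
        (LinearEquiv.ofBijective φ ⟨hinj, hsurj⟩).symm_apply_apply x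
      rw [this]
      exact hb2 x⟩

theorem nonempty_equiv_lp_of_MRP [CompleteSpace X] (b : UnconditionalSchauderBasis ℕ ℂ X) {T : ℝ}
    (hT : 0 < T) (hX : MRP T X) : Nonempty (X ≃L[ℂ] lp (fun _ : ℕ => ℂ) 2) := by
  classical
  set e := normalizedBasis b with he
  obtain ⟨L, hL1, hL⟩ := exists_symmetricBound hT hX (e := e) (norm_normalizedBasis b)
  have hinf : Infinite CubeIndex :=
    Infinite.of_injective (fun n : ℕ => cubePos n 1) fun m n h => (Sigma.mk.inj h).1
  obtain ⟨σ⟩ : Nonempty (CubeIndex ≃ ℕ) := nonempty_equiv_of_countable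
  obtain ⟨K, hK1, hK⟩ := exists_multiplierBound (reindexBasis e σ)
  have hne : ∀ i, ‖reindexBasis e σ i‖ = 1 := fun i => norm_normalizedBasis b (σ i)
  have hLσ := hL.reindexBasis σ
  obtain ⟨C₁, hC₁, h1⟩ := exists_lower_bound hT hX hne hK1 hL1 hK hLσ
  obtain ⟨C₂, hC₂, h2⟩ := exists_upper_bound hT hX hne hK1 hL1 hK hLσ
  have hK0 : 0 ≤ K := zero_le_one.trans hK1
  have hL0 : 0 ≤ L := zero_le_one.trans hL1
  have key : ∀ (s : Finset ℕ) (a : ℕ → ℂ),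
      ‖∑ i ∈ s, a i • e i‖ ≤ L * (K * (C₂ * √(∑ i ∈ s, ‖a i‖ ^ 2))) ∧
      √(∑ i ∈ s, ‖a i‖ ^ 2) ≤ C₁ * (K * (L * ‖∑ i ∈ s, a i • e i‖)) := by
    intro s a
    -- The block `n` has exactly `s.card` coordinate directions, and symmetry moves the vector
    -- supported on `s` onto them.
    set n := s.card + 4 with hn
    have hcard : n - 4 = s.card := by omega
    let q : Fin (n - 4) ≃ s := (finCongr hcard).trans s.equivFin.symm
    let p : Fin (n - 4) → CubeIndex := fun k => ⟨n, Sum.inl k⟩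
    have hp : Function.Injective p := fun k l h => by simpa [p] using h
    set ρ := √(∑ i ∈ s, ‖a i‖ ^ 2) with hρ
    have hsum : ∑ k, ‖a (q k)‖ ^ 2 = ρ ^ 2 := by
      rw [hρ, Real.sq_sqrt (Finset.sum_nonneg fun _ _ => by positivity),
        ← Finset.sum_coe_sort s fun i => ‖a i‖ ^ 2]
      exact q.sum_comp fun i : s => ‖a i‖ ^ 2
    have hvec : ∑ i ∈ s, a i • e i = ∑ k, a (q k) • e (q k) := by
      rw [← Finset.sum_coe_sort s fun i => a i • e i]
      exact (q.sum_comp fun i : s => a i • e i).symm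
    have hq : Function.Injective fun k => ((q k : s) : ℕ) :=
      Subtype.val_injective.comp q.injective
    have hp' : Function.Injective fun k => σ (p k) := σ.injective.comp hp
    have hs1 := hL.sum_le hp' hq (fun k => a (q k))
    have hs2 := hL.sum_le hq hp' (fun k => a (q k))
    -- Unimodular multipliers pass between the complex coefficients and their moduli, to which the
    -- bounds for real coefficients apply. Lean's `z / 0 = 0` covers the zero coefficients.
    have hm1 := hK.sum_mul_le_mul_univ hp (fun k => a (q k) / ‖a (q k)‖)
      (fun k => (‖a (q k)‖ : ℂ)) one_pos (fun k => by
        rw [norm_div, Complex.norm_real, norm_norm]; exact div_self_le_one _)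
    have hm2 := hK.sum_mul_le_mul_univ hp (fun k => ‖a (q k)‖ / a (q k))
      (fun k => a (q k)) one_pos (fun k => by
        rw [norm_div, Complex.norm_real, norm_norm]; exact div_self_le_one _)
    have hz1 : ∀ z : ℂ, z / ‖z‖ * ‖z‖ = z := fun z => by
      by_cases hz : z = 0
      · simp [hz]
      · exact div_mul_cancel₀ _ (by simpa using hz)
    have hz2 : ∀ z : ℂ, ‖z‖ / z * z = ‖z‖ := fun z => by
      by_cases hz : z = 0
      · simp [hz]
      · exact div_mul_cancel₀ _ hz
    simp only [hz1, hz2, one_mul] at hm1 hm2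
    by_cases hρ0 : ρ = 0
    · have hz : ∀ k, a (q k) = 0 := by
        rw [hρ0, zero_pow two_ne_zero, Finset.sum_eq_zero_iff_of_nonneg fun _ _ => by positivity]
          at hsum
        intro k
        simpa using hsum k (Finset.mem_univ k)
      rw [hvec, hρ0]
      simp [hz]
    have hρpos : 0 < ρ := lt_of_le_of_ne (Real.sqrt_nonneg _) (Ne.symm hρ0)
    have hone : ∑ k, (ρ⁻¹ * ‖a (q k)‖) ^ 2 = 1 := by
      simp only [mul_pow]
      rw [← Finset.mul_sum, hsum, ← mul_pow, inv_mul_cancel₀ hρ0, one_pow]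
    have hscale : ‖∑ k, ((ρ⁻¹ * ‖a (q k)‖ : ℝ) : ℂ) • reindexBasis e σ ⟨n, Sum.inl k⟩‖ =
        ρ⁻¹ * ‖∑ k, (‖a (q k)‖ : ℂ) • reindexBasis e σ (p k)‖ := by
      simp only [Complex.ofReal_mul, mul_smul]
      rw [← Finset.smul_sum, norm_smul, Complex.norm_real, Real.norm_of_nonneg (by positivity)]
    have g1 := h1 n _ hone
    have g2 := h2 n _ hone
    rw [hscale] at g1 g2
    rw [← mul_assoc, mul_comm C₁, mul_assoc, ← div_eq_inv_mul, one_le_div hρpos] at g1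
    rw [inv_mul_le_iff₀ hρpos, mul_comm] at g2
    rw [hvec]
    constructor
    · exact hs1.trans (mul_le_mul_of_nonneg_left
        (hm1.trans (mul_le_mul_of_nonneg_left g2 hK0)) hL0)
    · exact g1.trans (mul_le_mul_of_nonneg_left
        (hm2.trans (mul_le_mul_of_nonneg_left hs2 hK0)) hC₁)
  refine exists_equiv_lp e (C := (L * K * C₂) ^ 2 + (C₁ * K * L) ^ 2) (by positivity) ?_ ?_
  · intro s a
    have hnn : 0 ≤ ∑ i ∈ s, ‖a i‖ ^ 2 := Finset.sum_nonneg fun _ _ => by positivity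
    calc _ ≤ (L * (K * (C₂ * √(∑ i ∈ s, ‖a i‖ ^ 2)))) ^ 2 := by gcongr; exact (key s a).1
      _ = (L * K * C₂) ^ 2 * √(∑ i ∈ s, ‖a i‖ ^ 2) ^ 2 := by ring
      _ = (L * K * C₂) ^ 2 * ∑ i ∈ s, ‖a i‖ ^ 2 := by rw [Real.sq_sqrt hnn]
      _ ≤ _ := by gcongr; exact le_add_of_nonneg_right (by positivity)
  · intro s a
    have hnn : 0 ≤ ∑ i ∈ s, ‖a i‖ ^ 2 := Finset.sum_nonneg fun _ _ => by positivity
    calc _ = √(∑ i ∈ s, ‖a i‖ ^ 2) ^ 2 := (Real.sq_sqrt hnn).symm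
      _ ≤ (C₁ * (K * (L * ‖∑ i ∈ s, a i • e i‖))) ^ 2 := by gcongr; exact (key s a).2
      _ = (C₁ * K * L) ^ 2 * ‖∑ i ∈ s, a i • e i‖ ^ 2 := by ring
      _ ≤ _ := by gcongr; exact le_add_of_nonneg_left (by positivity)

theorem closedComplemented_of_equiv {H : Type*} [NormedAddCommGroup H] [InnerProductSpace ℂ H]
    [CompleteSpace H] (Φ : X ≃L[ℂ] H) (V : Submodule ℂ X) (hV : IsClosed (V : Set X)) :
    V.ClosedComplemented := by
  set W : Submodule ℂ H := V.map (Φ : X →ₗ[ℂ] H) with hW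
  have hWc : IsClosed (W : Set H) := by
    rw [hW, Submodule.map_coe]
    exact Φ.toHomeomorph.isClosedMap _ hV
  have : CompleteSpace W := hWc.completeSpace_coe
  have hmem : ∀ x, Φ.symm (W.starProjection (Φ x)) ∈ V := by
    intro x
    obtain ⟨v, hv, h⟩ := W.starProjection_apply_mem (Φ x)
    rw [← h]
    simpa using hv
  refine ⟨((Φ.symm : H →L[ℂ] X) ∘L W.starProjection ∘L (Φ : X →L[ℂ] H)).codRestrict V hmem, ?_⟩
  rintro ⟨v, hv⟩
  refine Subtype.ext ?_
  have : W.starProjection (Φ v) = Φ v :=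
    Submodule.starProjection_eq_self_iff.2 ⟨v, hv, rfl⟩
  change Φ.symm (W.starProjection (Φ v)) = v
  rw [this, Φ.symm_apply_apply]

end MaxReg

/-! ### Plancherel's theorem and operator-valued convolutions. -/

namespace MaxReg

open FourierTransform Convolution

section Fourier

variable {H : Type*} [NormedAddCommGroup H] [InnerProductSpace ℂ H] [CompleteSpace H]

theorem continuous_fourier_of_integrable {E : Type*} [NormedAddCommGroup E] [NormedSpace ℂ E]
    {f : ℝ → E} (hf : Integrable f) : Continuous (𝓕 f) :=
  VectorFourier.fourierIntegral_continuous Real.continuous_fourierChar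
    (by exact continuous_inner) hf

/-- On `L¹ ∩ L²` the Fourier transform of `L²` is given by the Fourier integral. -/
theorem coeFn_fourier_toLp {f : ℝ → H} (hf1 : Integrable f) (hf2 : MemLp f 2) :
    (𝓕 (hf2.toLp f) : Lp H 2 (volume : Measure ℝ)) =ᵐ[volume] 𝓕 f := by
  refine ae_eq_of_integral_contDiff_smul_eq
    ((Lp.memLp _).locallyIntegrable (by norm_num))
    (continuous_fourier_of_integrable hf1).locallyIntegrable fun g hg1 hg2 => ?_
  have hg1' : ContDiff ℝ (↑(⊤ : ℕ∞)) (fun x => (g x : ℂ)) :=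
    Complex.ofRealCLM.contDiff.comp hg1
  have hg2' : HasCompactSupport (fun x => (g x : ℂ)) := hg2.comp_left Complex.ofReal_zero
  set G := hg2'.toSchwartzMap hg1' with hG
  have hGx : ∀ x, G x = (g x : ℂ) := fun x => rfl
  have h1 := congrArg (fun D => D G) (Lp.fourier_toTemperedDistribution_eq (hf2.toLp f))
  simp only [TemperedDistribution.fourier_apply, Lp.toTemperedDistribution_apply] at h1
  have h2 : ∫ x, (𝓕 G) x • (hf2.toLp f) x = ∫ x, (𝓕 G) x • f x := by
    refine integral_congr_ae ?_
    filter_upwards [hf2.coeFn_toLp] with x hx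
    rw [hx]
  have h3 : ∫ x, (𝓕 (G : ℝ → ℂ)) x • f x = ∫ x, G x • 𝓕 f x := by
    simpa using! VectorFourier.integral_bilin_fourierIntegral_eq_flip
      (ContinuousLinearMap.lsmul ℂ ℂ) (L := innerₗ ℝ)
      Real.continuous_fourierChar continuous_inner G.integrable hf1
  rw [h2, SchwartzMap.fourier_coe, h3] at h1
  simpa [hGx] using h1.symm

theorem eLpNorm_fourier_eq {f : ℝ → H} (hf1 : Integrable f) (hf2 : MemLp f 2) :
    eLpNorm (𝓕 f) 2 volume = eLpNorm f 2 volume := by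
  have h := Lp.norm_fourier_eq (hf2.toLp f)
  rw [Lp.norm_def, Lp.norm_def, eLpNorm_congr_ae (coeFn_fourier_toLp hf1 hf2),
    eLpNorm_congr_ae hf2.coeFn_toLp] at h
  refine (ENNReal.toReal_eq_toReal_iff' ?_ hf2.2.ne).1 h
  rw [← eLpNorm_congr_ae (coeFn_fourier_toLp hf1 hf2)]
  exact Lp.eLpNorm_ne_top _

theorem memLp_two_of_bound {E : Type*} [NormedAddCommGroup E] {f : ℝ → E} (hf : Integrable f)
    {M : ℝ} (hM : ∀ t, ‖f t‖ ≤ M) : MemLp f 2 := by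
  rw [memLp_two_iff_integrable_sq_norm hf.aestronglyMeasurable]
  refine (hf.norm.const_mul M).mono' (hf.aestronglyMeasurable.norm.pow 2)
    (Eventually.of_forall fun t => ?_)
  rw [Real.norm_of_nonneg (by positivity), sq]
  exact mul_le_mul_of_nonneg_right (hM t) (norm_nonneg _)

theorem norm_convolution_le {E : Type*} [NormedAddCommGroup E] [NormedSpace ℂ E]
    {k : ℝ → E →L[ℂ] E} {f : ℝ → E} {M : ℝ} (hM : ∀ t, ‖k t‖ ≤ M) (hf : Integrable f) (t : ℝ) :
    ‖(k ⋆[ContinuousLinearMap.id ℂ (E →L[ℂ] E)] f) t‖ ≤ M * ∫ s, ‖f s‖ := by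
  rw [convolution_eq_swap, ← integral_const_mul]
  refine norm_integral_le_of_norm_le (hf.norm.const_mul M) (Eventually.of_forall fun s => ?_)
  exact (k (t - s)).le_of_opNorm_le (hM _) _

/-- The Fourier transform turns the convolution into pointwise application of `𝓕 k ξ`. Plancherel's
theorem for `H`-valued functions is where the Hilbert structure enters. The bound `M` serves only to
place the convolution in `L²` and is absent from the estimate. -/
theorem eLpNorm_convolution_le {k : ℝ → H →L[ℂ] H} (hk : Integrable k) {M C : ℝ}
    (hM : ∀ t, ‖k t‖ ≤ M) (hC : ∀ ξ, ‖𝓕 k ξ‖ ≤ C) {f : ℝ → H} (hf1 : Integrable f)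
    (hf2 : MemLp f 2) :
    eLpNorm (k ⋆[ContinuousLinearMap.id ℂ (H →L[ℂ] H)] f) 2 volume ≤
      ENNReal.ofReal C * eLpNorm f 2 volume := by
  have h1 : Integrable (k ⋆[ContinuousLinearMap.id ℂ (H →L[ℂ] H)] f) :=
    hk.integrable_convolution _ hf1
  rw [← eLpNorm_fourier_eq h1 (memLp_two_of_bound h1 (norm_convolution_le hM hf1)),
    ← eLpNorm_fourier_eq hf1 hf2]
  refine eLpNorm_le_mul_eLpNorm_of_ae_le_mul (Eventually.of_forall fun ξ => ?_) 2
  rw [Real.fourier_bilin_convolution_eq _ hk hf1]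
  exact (𝓕 k ξ).le_of_opNorm_le (hC ξ) _

variable {X : Type*} [NormedAddCommGroup X] [NormedSpace ℂ X] [CompleteSpace X]

/-- Convolution estimate on a space isomorphic to a Hilbert space. -/
theorem exists_eLpNorm_convolution_le (Φ : X ≃L[ℂ] H) :
    ∃ c : ℝ, 0 ≤ c ∧ ∀ (k : ℝ → X →L[ℂ] X) (M C : ℝ), Integrable k → (∀ t, ‖k t‖ ≤ M) →
      (∀ ξ, ‖𝓕 k ξ‖ ≤ C) → ∀ f : ℝ → X, Integrable f → MemLp f 2 →
      eLpNorm (k ⋆[ContinuousLinearMap.id ℂ (X →L[ℂ] X)] f) 2 volume ≤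
        ENNReal.ofReal (c * C) * eLpNorm f 2 volume := by
  set a := ‖(Φ : X →L[ℂ] H)‖ with ha
  set b := ‖(Φ.symm : H →L[ℂ] X)‖ with hb
  -- Conjugation by `Φ` carries kernels on `X` to kernels on the Hilbert space; being bounded and
  -- linear, it commutes with the Fourier integral.
  let J : (X →L[ℂ] X) →L[ℂ] (H →L[ℂ] H) :=
    (ContinuousLinearMap.compL ℂ H X H (Φ : X →L[ℂ] H)) ∘L
      ((ContinuousLinearMap.compL ℂ H X X).flip (Φ.symm : H →L[ℂ] X))
  have hJ : ∀ A, J A = (Φ : X →L[ℂ] H) ∘L A ∘L (Φ.symm : H →L[ℂ] X) := fun A => rfl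
  have hJn : ∀ A, ‖J A‖ ≤ a * b * ‖A‖ := fun A => by
    rw [hJ]
    calc _ ≤ a * ‖A ∘L (Φ.symm : H →L[ℂ] X)‖ := ContinuousLinearMap.opNorm_comp_le _ _
      _ ≤ a * (‖A‖ * b) := by gcongr; exact ContinuousLinearMap.opNorm_comp_le _ _
      _ = _ := by ring
  refine ⟨b * (a * b) * a, by positivity, fun k M C hk hM hC f hf1 hf2 => ?_⟩
  have hC0 : 0 ≤ C := (norm_nonneg _).trans (hC 0)
  have h1 : Integrable fun t => J (k t) := J.integrable_comp hk
  have h2 : Integrable fun t => Φ (f t) := (Φ : X →L[ℂ] H).integrable_comp hf1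
  have h3 : MemLp (fun t => Φ (f t)) 2 := (Φ : X →L[ℂ] H).comp_memLp' hf2
  have hF : ∀ ξ, 𝓕 (fun t => J (k t)) ξ = J (𝓕 k ξ) := by
    intro ξ
    rw [Real.fourier_eq, Real.fourier_eq, ← J.integral_comp_comm
      ((Real.fourierIntegral_convergent_iff ξ).2 hk)]
    refine integral_congr_ae (Eventually.of_forall fun t => ?_)
    simp only [Circle.smul_def, map_smul]
  have h4 := eLpNorm_convolution_le h1 (M := a * b * M) (C := a * b * C)
    (fun t => (hJn _).trans (by gcongr; exact hM t))
    (fun ξ => by rw [hF]; exact (hJn _).trans (by gcongr; exact hC ξ)) h2 h3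
  have h5 : ∀ t, (k ⋆[ContinuousLinearMap.id ℂ (X →L[ℂ] X)] f) t =
      Φ.symm (((fun t => J (k t)) ⋆[ContinuousLinearMap.id ℂ (H →L[ℂ] H)] fun t => Φ (f t)) t) := by
    intro t
    rw [convolution_def, convolution_def, ← Φ.symm.integral_comp_comm]
    simp [hJ]
  calc eLpNorm (k ⋆[ContinuousLinearMap.id ℂ (X →L[ℂ] X)] f) 2 volume
      ≤ ENNReal.ofReal b * eLpNorm ((fun t => J (k t)) ⋆[ContinuousLinearMap.id ℂ (H →L[ℂ] H)]
          fun t => Φ (f t)) 2 volume := by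
        refine eLpNorm_le_mul_eLpNorm_of_ae_le_mul (Eventually.of_forall fun t => ?_) 2
        rw [h5 t]
        exact (Φ.symm : H →L[ℂ] X).le_opNorm _
    _ ≤ ENNReal.ofReal b * (ENNReal.ofReal (a * b * C) *
          (ENNReal.ofReal a * eLpNorm f 2 volume)) := by
        gcongr
        refine h4.trans ?_
        gcongr
        refine eLpNorm_le_mul_eLpNorm_of_ae_le_mul (Eventually.of_forall fun t => ?_) 2
        exact (Φ : X →L[ℂ] H).le_opNorm _
    _ = _ := by
        rw [← mul_assoc, ← mul_assoc, ← ENNReal.ofReal_mul (by positivity),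
          ← ENNReal.ofReal_mul (by positivity)]
        congr 2
        ring

end Fourier

end MaxReg

/-! ### Oscillatory integrals and Cauchy estimates for analytic semigroups. -/

namespace MaxReg

section OscillatoryIntegral

variable {E : Type*} [NormedAddCommGroup E] [NormedSpace ℂ E] [CompleteSpace E]
  {K K' K'' : ℝ → E} {C : ℝ}

theorem norm_exp_neg_mul_I (ω t : ℝ) : ‖Complex.exp (-(ω * t : ℝ) * Complex.I)‖ = 1 := by
  rw [← Complex.ofReal_neg, Complex.norm_exp_ofReal_mul_I]

/-- For small times the exponential differs from `1` by at most `|ω| t`, which compensates the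
singularity `C / t`. The integral of `K'` itself is a difference of two values of `K`. -/
theorem norm_integral_exp_smul_le_of_le {ω a : ℝ} (ha : 0 ≤ a) (hωa : |ω| * a ≤ 1) (hC : 0 ≤ C)
    (h1 : ∀ t ∈ Set.Icc 0 a, HasDerivAt K (K' t) t) (hcont : ContinuousOn K' (Set.Icc 0 a))
    (hb0 : ∀ t ∈ Set.Icc 0 a, ‖K t‖ ≤ C) (hb1 : ∀ t ∈ Set.Ioc 0 a, ‖K' t‖ ≤ C / t) :
    ‖∫ t in (0 : ℝ)..a, Complex.exp (-(ω * t : ℝ) * Complex.I) • K' t‖ ≤ 3 * C := by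
  have hu : Set.uIcc 0 a = Set.Icc 0 a := Set.uIcc_of_le ha
  have hintg : IntervalIntegrable K' volume 0 a := by
    apply ContinuousOn.intervalIntegrable; rwa [hu]
  have hintg2 : IntervalIntegrable
      (fun t : ℝ => (Complex.exp (-(ω * t : ℝ) * Complex.I) - 1) • K' t) volume 0 a := by
    apply ContinuousOn.intervalIntegrable
    rw [hu]
    exact ContinuousOn.smul (by fun_prop) hcont
  have e1 : ∫ t in (0 : ℝ)..a, Complex.exp (-(ω * t : ℝ) * Complex.I) • K' t =
      (∫ t in (0 : ℝ)..a, (Complex.exp (-(ω * t : ℝ) * Complex.I) - 1) • K' t) + (K a - K 0) := by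
    rw [← intervalIntegral.integral_eq_sub_of_hasDerivAt (by rwa [hu]) hintg,
      ← intervalIntegral.integral_add hintg2 hintg]
    congr 1
    ext t
    rw [sub_smul, one_smul, sub_add_cancel]
  have e2 : ‖∫ t in (0 : ℝ)..a, (Complex.exp (-(ω * t : ℝ) * Complex.I) - 1) • K' t‖ ≤
      |ω| * C * |a - 0| := by
    refine intervalIntegral.norm_integral_le_of_norm_le_const fun t ht => ?_
    rw [Set.uIoc_of_le ha] at ht
    rw [norm_smul]
    have h3 : ‖Complex.exp (-(ω * t : ℝ) * Complex.I) - 1‖ ≤ |ω| * t := by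
      have := @Real.norm_exp_I_mul_ofReal_sub_one_le (-(ω * t))
      rw [norm_neg, norm_mul, Real.norm_eq_abs, Real.norm_of_nonneg ht.1.le, mul_comm] at this
      rwa [Complex.ofReal_neg] at this
    calc _ ≤ |ω| * t * (C / t) := by
          gcongr
          · exact mul_nonneg (abs_nonneg _) ht.1.le
          · exact hb1 t ht
      _ = |ω| * C := by have := ht.1.ne'; field_simp
  rw [e1]
  have h4 := hb0 a (Set.right_mem_Icc.2 ha)
  have h5 := hb0 0 (Set.left_mem_Icc.2 ha)
  have h6 : |ω| * C * |a - 0| ≤ C := by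
    rw [sub_zero, abs_of_nonneg ha]; nlinarith
  calc _ ≤ _ + (‖K a‖ + ‖K 0‖) := norm_add_le_of_le e2 (norm_sub_le _ _)
    _ ≤ _ := by linarith

/-- For large times, integrating by parts gains `1 / |ω| ≤ a` and replaces `C / t` by the integrable
decay `C / t ^ 2`. -/
theorem norm_integral_exp_smul_le_of_ge {ω a T : ℝ} (ha : 0 < a) (haT : a ≤ T) (hωa : 1 ≤ |ω| * a)
    (hC : 0 ≤ C)
    (h2 : ∀ t ∈ Set.Icc a T, HasDerivAt K' (K'' t) t) (hcont : ContinuousOn K'' (Set.Icc a T))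
    (hb1 : ∀ t ∈ Set.Icc a T, ‖K' t‖ ≤ C / t) (hb2 : ∀ t ∈ Set.Icc a T, ‖K'' t‖ ≤ C / t ^ 2) :
    ‖∫ t in a..T, Complex.exp (-(ω * t : ℝ) * Complex.I) • K' t‖ ≤ 3 * C := by
  have hu : Set.uIcc a T = Set.Icc a T := Set.uIcc_of_le haT
  have hω : ω ≠ 0 := by rintro rfl; simp at hωa; linarith
  have hω' : (ω : ℂ) ≠ 0 := by exact_mod_cast hω
  have hωinv : |ω|⁻¹ ≤ a := by rwa [inv_le_iff_one_le_mul₀' (abs_pos.2 hω)]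
  set v : ℝ → ℂ := fun t => (-(ω * Complex.I))⁻¹ * Complex.exp (-(ω * t : ℝ) * Complex.I) with hv
  have hvn : ∀ t, ‖v t‖ ≤ a := fun t => by
    rw [hv, norm_mul, norm_exp_neg_mul_I, norm_inv, norm_neg, norm_mul, Complex.norm_I,
      Complex.norm_real, mul_one, mul_one]
    exact hωinv
  have hvd : ∀ t, HasDerivAt v (Complex.exp (-(ω * t : ℝ) * Complex.I)) t := by
    intro t
    have h1 : HasDerivAt (fun t : ℝ => (-(ω * t : ℝ) : ℂ) * Complex.I) (-ω * Complex.I) t := by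
      have := ((Complex.ofRealCLM.hasDerivAt (x := t)).const_mul (-(ω : ℂ))).mul_const Complex.I
      simpa using this
    have h3 := h1.cexp.const_mul (-(ω * Complex.I))⁻¹
    have h4 : (ω : ℂ) * Complex.I ≠ 0 := mul_ne_zero hω' Complex.I_ne_zero
    refine h3.congr_deriv ?_
    rw [mul_left_comm, neg_mul (ω : ℂ), inv_mul_cancel₀ (neg_ne_zero.2 h4), mul_one]
  have hK'c : ContinuousOn K' (Set.Icc a T) := fun t ht => (h2 t ht).continuousAt.continuousWithinAt
  have hparts := intervalIntegral.integral_smul_deriv_eq_deriv_smul (u := v) (v := K')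
    (a := a) (b := T) (fun t _ => hvd t) (by rwa [hu])
    (by apply Continuous.intervalIntegrable; fun_prop)
    (by apply ContinuousOn.intervalIntegrable; rwa [hu])
  have hI : ‖∫ t in a..T, v t • K'' t‖ ≤ C := by
    have hT : 0 < T := ha.trans_le haT
    have hd : ∀ t ∈ Set.uIcc a T, HasDerivAt (fun t : ℝ => -(a * C) / t) (a * (C / t ^ 2)) t := by
      intro t ht
      rw [hu] at ht
      have ht0 : t ≠ 0 := (ha.trans_le ht.1).ne'
      have := (hasDerivAt_inv ht0).const_mul (-(a * C))
      refine this.congr_deriv ?_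
      ring
    have hi : IntervalIntegrable (fun t : ℝ => a * (C / t ^ 2)) volume a T := by
      apply ContinuousOn.intervalIntegrable
      rw [hu]
      intro t ht
      have ht0 : t ^ 2 ≠ 0 := pow_ne_zero 2 (ha.trans_le ht.1).ne'
      fun_prop (disch := assumption)
    calc _ ≤ ∫ t in a..T, a * (C / t ^ 2) := by
          refine intervalIntegral.norm_integral_le_of_norm_le haT
            (Eventually.of_forall fun t ht => ?_) hi
          rw [norm_smul]
          exact mul_le_mul (hvn t) (hb2 t ⟨ht.1.le, ht.2⟩) (norm_nonneg _) ha.le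
      _ = -(a * C) / T - -(a * C) / a := intervalIntegral.integral_eq_sub_of_hasDerivAt hd hi
      _ = C - a * C / T := by field_simp; ring
      _ ≤ C := by linarith [show 0 ≤ a * C / T by positivity]
  have hT := hb1 T (Set.right_mem_Icc.2 haT)
  have ha' := hb1 a (Set.left_mem_Icc.2 haT)
  have b1 : ‖v T • K' T‖ ≤ C := by
    rw [norm_smul]
    calc _ ≤ a * (C / T) := mul_le_mul (hvn T) hT (norm_nonneg _) ha.le
      _ = a / T * C := by ring
      _ ≤ C := mul_le_of_le_one_left hC ((div_le_one (ha.trans_le haT)).2 haT)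
  have b2 : ‖v a • K' a‖ ≤ C := by
    rw [norm_smul]
    calc _ ≤ a * (C / a) := mul_le_mul (hvn a) ha' (norm_nonneg _) ha.le
      _ = C := by field_simp
  have e : ∫ t in a..T, Complex.exp (-(ω * t : ℝ) * Complex.I) • K' t =
      v T • K' T - v a • K' a - ∫ t in a..T, v t • K'' t := by
    rw [hparts]; abel
  rw [e]
  calc _ ≤ ‖v T • K' T‖ + ‖v a • K' a‖ + ‖∫ t in a..T, v t • K'' t‖ :=
        norm_sub_le_of_le (norm_sub_le _ _) le_rfl
    _ ≤ _ := by linarith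

/-- The Fourier integrals of the derivative of a bounded function `K` are bounded in terms of
bounds for `K`, `t K'` and `t² K''`. -/
theorem norm_integral_exp_smul_le {T : ℝ} (hT : 0 < T) (hC : 0 ≤ C)
    (h1 : ∀ t ∈ Set.Icc 0 T, HasDerivAt K (K' t) t) (h2 : ∀ t ∈ Set.Icc 0 T, HasDerivAt K' (K'' t) t)
    (hcont : ContinuousOn K'' (Set.Icc 0 T)) (hb0 : ∀ t ∈ Set.Icc 0 T, ‖K t‖ ≤ C)
    (hb1 : ∀ t ∈ Set.Ioc 0 T, ‖K' t‖ ≤ C / t) (hb2 : ∀ t ∈ Set.Ioc 0 T, ‖K'' t‖ ≤ C / t ^ 2)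
    (ω : ℝ) :
    ‖∫ t in (0 : ℝ)..T, Complex.exp (-(ω * t : ℝ) * Complex.I) • K' t‖ ≤ 6 * C := by
  have hK'c : ContinuousOn K' (Set.Icc 0 T) := fun t ht => (h2 t ht).continuousAt.continuousWithinAt
  by_cases hω : |ω| * T ≤ 1
  · exact (norm_integral_exp_smul_le_of_le hT.le hω hC h1 hK'c hb0 hb1).trans (by linarith)
  push Not at hω
  have hω0 : 0 < |ω| := by
    by_contra h
    have : |ω| = 0 := le_antisymm (not_lt.1 h) (abs_nonneg _)
    rw [this] at hω; linarith
  -- The splitting point is the oscillation scale, where both regimes give a bound independent of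
  -- `ω`.
  set a := |ω|⁻¹ with ha
  have ha0 : 0 < a := inv_pos.2 hω0
  have haT : a ≤ T := by rw [ha, inv_le_iff_one_le_mul₀' hω0]; exact hω.le
  have hωa : |ω| * a = 1 := mul_inv_cancel₀ hω0.ne'
  have hgc : ContinuousOn (fun t : ℝ => Complex.exp (-(ω * t : ℝ) * Complex.I) • K' t)
      (Set.Icc 0 T) := ContinuousOn.smul (by fun_prop) hK'c
  have hsub1 : Set.Icc 0 a ⊆ Set.Icc 0 T := Set.Icc_subset_Icc_right haT
  have hsub2 : Set.Icc a T ⊆ Set.Ioc 0 T := fun t ht => ⟨ha0.trans_le ht.1, ht.2⟩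
  have hsub3 : Set.Icc a T ⊆ Set.Icc 0 T := hsub2.trans Set.Ioc_subset_Icc_self
  rw [← intervalIntegral.integral_add_adjacent_intervals (b := a)
    (by apply ContinuousOn.intervalIntegrable; rw [Set.uIcc_of_le ha0.le]; exact hgc.mono hsub1)
    (by apply ContinuousOn.intervalIntegrable; rw [Set.uIcc_of_le haT]; exact hgc.mono hsub3)]
  have g1 := norm_integral_exp_smul_le_of_le ha0.le hωa.le hC (fun t ht => h1 t (hsub1 ht))
    (hK'c.mono hsub1) (fun t ht => hb0 t (hsub1 ht)) (fun t ht => hb1 t ⟨ht.1, ht.2.trans haT⟩)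
  have g2 := norm_integral_exp_smul_le_of_ge ha0 haT hωa.ge hC (fun t ht => h2 t (hsub3 ht))
    (hcont.mono hsub3) (fun t ht => hb1 t (hsub2 ht)) (fun t ht => hb2 t (hsub2 ht))
  calc _ ≤ 3 * C + 3 * C := norm_add_le_of_le g1 g2
    _ = _ := by ring

end OscillatoryIntegral

/-- The sector is a cone, so a ball around `1` scales to balls of radius proportional to `t`; these
are the discs for the Cauchy estimates. -/
theorem exists_closedBall_subset_sector {δ : ℝ} (hδ : 0 < δ) (hδ' : δ ≤ Real.pi / 2) :
    ∃ κ : ℝ, 0 < κ ∧ ∀ t : ℝ, 0 < t → Metric.closedBall (t : ℂ) (κ * t) ⊆ sector δ := by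
  obtain ⟨κ, hκ, h⟩ := Metric.nhds_basis_closedBall.mem_iff.1
    ((isOpen_sector hδ').mem_nhds (x := ((1 : ℝ) : ℂ)) (ofReal_mem_sector hδ one_pos))
  refine ⟨κ, hκ, fun t ht z hz => ?_⟩
  have ht' : (t : ℂ) ≠ 0 := by exact_mod_cast ht.ne'
  have h1 : (t : ℂ)⁻¹ * z ∈ sector δ := by
    apply h
    rw [Metric.mem_closedBall, dist_eq_norm] at hz ⊢
    have : (t : ℂ)⁻¹ * z - (1 : ℝ) = (t : ℂ)⁻¹ * (z - t) := by
      push_cast; field_simp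
    rw [this, norm_mul, norm_inv, Complex.norm_real, Real.norm_of_nonneg ht.le,
      inv_mul_le_iff₀ ht, mul_comm]
    exact hz
  have h2 : z = (t : ℂ) * ((t : ℂ)⁻¹ * z) := by field_simp
  refine ⟨fun h0 => h1.1 (by simp [h0]), ?_⟩
  rw [h2, Complex.arg_real_mul _ ht]
  exact h1.2

namespace IsBoundedAnalyticSemigroup

variable {X : Type*} [NormedAddCommGroup X] [NormedSpace ℂ X] [CompleteSpace X]
  {δ : ℝ} {S : ℂ → X →L[ℂ] X}

theorem differentiableAt (hS : IsBoundedAnalyticSemigroup δ S) {t : ℝ} (ht : 0 < t) :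
    DifferentiableAt ℂ S t :=
  hS.analytic.differentiableAt
    ((isOpen_sector hS.angle_le).mem_nhds (ofReal_mem_sector hS.angle_pos ht))

theorem hasDerivAt (hS : IsBoundedAnalyticSemigroup δ S) {t : ℝ} (ht : 0 < t) :
    HasDerivAt (fun r : ℝ => S r) (deriv S t) t := by
  have := (hS.differentiableAt ht).hasDerivAt.scomp t Complex.ofRealCLM.hasDerivAt
  simpa using! this

theorem hasDerivAt_deriv (hS : IsBoundedAnalyticSemigroup δ S) {t : ℝ} (ht : 0 < t) :
    HasDerivAt (fun r : ℝ => deriv S r) (deriv (deriv S) t) t := by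
  have h := (hS.analytic.deriv (isOpen_sector hS.angle_le)).differentiableAt
    ((isOpen_sector hS.angle_le).mem_nhds (ofReal_mem_sector hS.angle_pos ht))
  have := h.hasDerivAt.scomp t Complex.ofRealCLM.hasDerivAt
  simpa using! this

theorem continuousAt_deriv_deriv (hS : IsBoundedAnalyticSemigroup δ S) {t : ℝ} (ht : 0 < t) :
    ContinuousAt (fun r : ℝ => deriv (deriv S) r) t := by
  have ho := isOpen_sector hS.angle_le
  have h := ((hS.analytic.deriv ho).deriv ho).differentiableAt
    (ho.mem_nhds (ofReal_mem_sector hS.angle_pos ht))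
  exact ContinuousAt.comp (f := fun r : ℝ => (r : ℂ)) h.continuousAt
    Complex.continuous_ofReal.continuousAt

theorem exists_bound (hS : IsBoundedAnalyticSemigroup δ S) :
    ∃ C : ℝ, 0 < C ∧ ∀ t : ℝ, 0 < t → ‖S t‖ ≤ C ∧ ‖deriv S t‖ ≤ C / t ∧
      ‖deriv (deriv S) t‖ ≤ C / t ^ 2 := by
  obtain ⟨M, hM⟩ := hS.bounded
  obtain ⟨κ, hκ, hball⟩ := exists_closedBall_subset_sector hS.angle_pos hS.angle_le
  have hM0 : 0 ≤ M := (norm_nonneg _).trans (hM _ (ofReal_mem_sector hS.angle_pos one_pos))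
  refine ⟨M + M / κ + 2 * M / κ ^ 2 + 1, by positivity, fun t ht => ?_⟩
  have hR : 0 < κ * t := by positivity
  have hd : DiffContOnCl ℂ S (Metric.ball (t : ℂ) (κ * t)) := by
    refine DifferentiableOn.diffContOnCl ?_
    rw [closure_ball _ hR.ne']
    exact hS.analytic.mono (hball t ht)
  have hs : ∀ z ∈ Metric.sphere (t : ℂ) (κ * t), ‖S z‖ ≤ M := fun z hz =>
    hM z (hball t ht (Metric.sphere_subset_closedBall hz))
  have h1 := Complex.norm_deriv_le_of_forall_mem_sphere_norm_le hR hd hs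
  have h2 := Complex.norm_iteratedDeriv_le_of_forall_mem_sphere_norm_le 2 hR hd hs
  rw [iteratedDeriv_succ, iteratedDeriv_one] at h2
  have p1 : 0 ≤ M / κ := by positivity
  have p2 : 0 ≤ 2 * M / κ ^ 2 := by positivity
  refine ⟨?_, ?_, ?_⟩
  · have := hM _ (ofReal_mem_sector hS.angle_pos ht)
    linarith
  · refine h1.trans ?_
    rw [← div_div]
    gcongr
    linarith
  · refine h2.trans ?_
    rw [mul_pow, ← div_div]
    gcongr
    simp only [Nat.factorial_two, Nat.cast_ofNat]
    linarith

theorem map_add_ofReal (hS : IsBoundedAnalyticSemigroup δ S) {t r : ℝ} (ht : 0 < t) (hr : 0 < r) :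
    S ((t + r : ℝ) : ℂ) = S t * S r := by
  rw [Complex.ofReal_add]
  exact hS.map_add _ (ofReal_mem_sector hS.angle_pos ht) _ (ofReal_mem_sector hS.angle_pos hr)

theorem deriv_add (hS : IsBoundedAnalyticSemigroup δ S) {t r : ℝ} (ht : 0 < t) (hr : 0 < r) :
    deriv S ((t + r : ℝ) : ℂ) = deriv S t * S r := by
  have h1 : HasDerivAt (fun s : ℝ => S ((s + r : ℝ) : ℂ)) (deriv S ((t + r : ℝ) : ℂ)) t :=
    (hS.hasDerivAt (add_pos ht hr)).comp_add_const t r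
  have h2 : HasDerivAt (fun s : ℝ => S s * S r) (deriv S t * S r) t :=
    (hS.hasDerivAt ht).mul_const (S r)
  refine h1.unique (h2.congr_of_eventuallyEq ?_)
  filter_upwards [lt_mem_nhds ht] with s hs
  exact hS.map_add_ofReal hs hr

theorem deriv_add' (hS : IsBoundedAnalyticSemigroup δ S) {t r : ℝ} (ht : 0 < t) (hr : 0 < r) :
    deriv S ((t + r : ℝ) : ℂ) = S t * deriv S r := by
  have h1 : HasDerivAt (fun s : ℝ => S ((t + s : ℝ) : ℂ)) (deriv S ((t + r : ℝ) : ℂ)) r :=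
    (hS.hasDerivAt (add_pos ht hr)).comp_const_add t r
  have h2 : HasDerivAt (fun s : ℝ => S t * S s) (S t * deriv S r) r :=
    (hS.hasDerivAt hr).const_mul (S t)
  refine h1.unique (h2.congr_of_eventuallyEq ?_)
  filter_upwards [lt_mem_nhds hr] with s hs
  exact hS.map_add_ofReal ht hs

theorem tendsto_ofReal (hS : IsBoundedAnalyticSemigroup δ S) (x : X) :
    Tendsto (fun t : ℝ => S t x) (𝓝[>] 0) (𝓝 x) := by
  refine (hS.tendsto_zero x).comp ?_
  refine tendsto_nhdsWithin_iff.2 ⟨?_, ?_⟩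
  · have : Tendsto (fun t : ℝ => (t : ℂ)) (𝓝 0) (𝓝 0) := by
      simpa using Complex.continuous_ofReal.tendsto 0
    exact this.mono_left nhdsWithin_le_nhds
  · filter_upwards [self_mem_nhdsWithin] with t ht
    exact ofReal_mem_sector hS.angle_pos ht

theorem hasDerivAt_apply (hS : IsBoundedAnalyticSemigroup δ S) (x : X) {t : ℝ} (ht : 0 < t) :
    HasDerivAt (fun r : ℝ => S r x) (deriv S t x) t :=
  (ContinuousLinearMap.apply ℂ X x).restrictScalars ℝ |>.hasFDerivAt.comp_hasDerivAt t
    (hS.hasDerivAt ht)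

theorem deriv_apply_of_mem_graph (hS : IsBoundedAnalyticSemigroup δ S) {A : X →ₗ.[ℂ] X}
    (hA : IsGenerator A S) {x y : X} (h : (x, y) ∈ A.graph) {t : ℝ} (ht : 0 < t) :
    deriv S t x = S t y := by
  have h1 := ((S t).continuous.tendsto y).comp ((hA x y).1 h)
  have h2 := (hasDerivAt_iff_tendsto_slope_zero.1 (hS.hasDerivAt_apply x ht)).mono_left
    (nhdsWithin_mono (s := Set.Ioi 0) 0 fun r hr => ne_of_gt hr)
  refine tendsto_nhds_unique (h2.congr' ?_) h1
  filter_upwards [self_mem_nhdsWithin] with r hr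
  rw [Function.comp_apply, map_smul, map_sub, hS.map_add_ofReal ht hr, mul_apply_eq_comp,
    ← Complex.ofReal_inv, Complex.coe_smul]

/-- The function `s ↦ S s x - s • y` has derivative `S s y - y`, which is small near `0`. The mean
value inequality on `(s, t)` followed by `s → 0` gives the difference quotient without assuming
differentiability at `0`. -/
theorem mem_graph_of_deriv_apply (hS : IsBoundedAnalyticSemigroup δ S) {A : X →ₗ.[ℂ] X}
    (hA : IsGenerator A S) {x y : X} (h : ∀ t : ℝ, 0 < t → deriv S t x = S t y) :
    (x, y) ∈ A.graph := by
  rw [hA, Metric.tendsto_nhds]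
  intro η hη
  obtain ⟨ρ, hρ, hρη⟩ := mem_nhdsGT_iff_exists_Ioo_subset.1
    (Metric.tendsto_nhds.1 (hS.tendsto_ofReal y) (η / 2) (by positivity))
  have hρ : 0 < ρ := hρ
  filter_upwards [Ioo_mem_nhdsGT hρ] with t ht
  set g : ℝ → X := fun s => S s x - s • y with hg
  have hgd : ∀ s ∈ Set.Ioo 0 ρ, HasDerivWithinAt g (S s y - y) (Set.Ioo 0 ρ) s := by
    intro s hs
    rw [← h s hs.1]
    refine HasDerivAt.hasDerivWithinAt ?_
    simpa using! (hS.hasDerivAt_apply x hs.1).sub ((hasDerivAt_id s).smul_const y)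
  have h1 : ∀ s ∈ Set.Ioo 0 t, ‖g t - g s‖ ≤ η / 2 * (t - s) := by
    intro s hs
    have := (convex_Ioo 0 ρ).norm_image_sub_le_of_norm_hasDerivWithin_le hgd (C := η / 2)
      (fun s hs => by
        have := hρη hs
        rw [Set.mem_ofPred_eq, dist_eq_norm] at this
        exact this.le) ⟨hs.1, hs.2.trans ht.2⟩ ht
    rwa [Real.norm_of_nonneg (sub_nonneg.2 hs.2.le)] at this
  have hg0 : Tendsto g (𝓝[>] 0) (𝓝 x) := by
    have h2 : Tendsto (fun s : ℝ => s • y) (𝓝[>] 0) (𝓝 ((0 : ℝ) • y)) :=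
      (tendsto_id.mono_left nhdsWithin_le_nhds).smul_const y
    simpa using (hS.tendsto_ofReal x).sub h2
  have h3 : ‖g t - x‖ ≤ η / 2 * t := by
    refine le_of_tendsto (hg0.const_sub (g t)).norm ?_
    filter_upwards [Ioo_mem_nhdsGT ht.1] with s hs
    refine (h1 s hs).trans ?_
    gcongr
    linarith [hs.1]
  have h4 : (t : ℂ)⁻¹ • (S t x - x) - y = t⁻¹ • (g t - x) := by
    rw [← Complex.ofReal_inv, Complex.coe_smul, hg]
    simp only [smul_sub, smul_smul]
    rw [inv_mul_cancel₀ ht.1.ne', one_smul]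
    abel
  rw [dist_eq_norm, h4, norm_smul, norm_inv, Real.norm_of_nonneg ht.1.le, inv_mul_lt_iff₀ ht.1]
  have := mul_pos hη ht.1
  linarith

/-- Points of the graph of the generator can be recognized after applying `S`. -/
theorem mem_graph_of_forall_nat (hS : IsBoundedAnalyticSemigroup δ S) {A : X →ₗ.[ℂ] X}
    (hA : IsGenerator A S) {τ : ℕ → ℝ} (hτ : ∀ n, 0 < τ n) (hτ0 : Tendsto τ atTop (𝓝 0)) {x y : X}
    (h : ∀ n, deriv S (τ n) x = S (τ n) y) : (x, y) ∈ A.graph := by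
  refine hS.mem_graph_of_deriv_apply hA fun t ht => ?_
  obtain ⟨n, hn⟩ := (hτ0.eventually (gt_mem_nhds ht)).exists
  have h0 : t = (t - τ n) + τ n := by ring
  rw [h0, hS.deriv_add' (sub_pos.2 hn) (hτ n), hS.map_add_ofReal (sub_pos.2 hn) (hτ n),
    mul_apply_eq_comp, mul_apply_eq_comp, h n]

end IsBoundedAnalyticSemigroup

end MaxReg

/-! ### Convolution operators on the finite interval. -/

namespace MaxReg

open FourierTransform Convolution

section ConvolutionOperator

variable {X : Type*} [NormedAddCommGroup X] [NormedSpace ℂ X]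

theorem integrable_clm_apply {k : ℝ → X →L[ℂ] X} {μ : Measure ℝ} {f : ℝ → X} {M : ℝ}
    (hk : AEStronglyMeasurable k μ) (hM : ∀ᵐ t ∂μ, ‖k t‖ ≤ M) (hf : Integrable f μ) :
    Integrable (fun t => k t (f t)) μ := by
  refine (hf.norm.const_mul M).mono' 
    ((ContinuousLinearMap.id ℂ (X →L[ℂ] X)).aestronglyMeasurable_comp₂ hk hf.aestronglyMeasurable) ?_
  filter_upwards [hM] with t ht
  exact (k t).le_of_opNorm_le ht _

theorem aestronglyMeasurable_comp_const_sub {E : Type*} [NormedAddCommGroup E] {k : ℝ → E}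
    (hk : AEStronglyMeasurable k volume) (t : ℝ) :
    AEStronglyMeasurable (fun s => k (t - s)) volume :=
  hk.comp_quasiMeasurePreserving (quasiMeasurePreserving_sub_left volume t)

theorem integrableOn_of_continuousOn_Ioo {E : Type*} [NormedAddCommGroup E] {k : ℝ → E} {T M : ℝ}
    (hk : ContinuousOn k (Set.Ioo 0 T)) (hM : ∀ t ∈ Set.Ioo 0 T, ‖k t‖ ≤ M) :
    IntegrableOn k (Set.Ioo 0 T) := by
  refine Integrable.of_bound (hk.aestronglyMeasurable measurableSet_Ioo) M ?_
  exact (ae_restrict_iff' measurableSet_Ioo).2 (Eventually.of_forall hM)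

theorem integrable_L2 {X : Type*} [NormedAddCommGroup X] {T : ℝ} (f : L2 T X) :
    Integrable f (volume.restrict (Set.Ico (0 : ℝ) T)) :=
  (Lp.memLp f).integrable (by norm_num)

theorem setIntegral_indicator_eq {T : ℝ} {k : ℝ → X →L[ℂ] X} (f : ℝ → X) {t : ℝ}
    (ht : t ∈ Set.Ico 0 T) :
    ∫ s in Set.Ico (0 : ℝ) T, (Set.Ioo 0 T).indicator k (t - s) (f s) =
      ∫ s in (0 : ℝ)..t, k (t - s) (f s) := by
  rw [intervalIntegral.integral_of_le ht.1, integral_Ico_eq_integral_Ioo,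
    integral_Ioc_eq_integral_Ioo, ← integral_indicator measurableSet_Ioo,
    ← integral_indicator measurableSet_Ioo]
  congr 1
  ext s
  by_cases h1 : s ∈ Set.Ioo 0 t
  · have h2 : s ∈ Set.Ioo 0 T := ⟨h1.1, h1.2.trans ht.2⟩
    have h3 : t - s ∈ Set.Ioo 0 T := ⟨sub_pos.2 h1.2, by linarith [h1.1, ht.2]⟩
    rw [Set.indicator_of_mem h1, Set.indicator_of_mem h2, Set.indicator_of_mem h3]
  · rw [Set.indicator_of_notMem h1]
    by_cases h2 : s ∈ Set.Ioo 0 T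
    · rw [Set.indicator_of_mem h2, Set.indicator_of_notMem, zero_apply]
      exact fun h3 => h1 ⟨h2.1, sub_pos.1 h3.1⟩
    · rw [Set.indicator_of_notMem h2]

variable {H : Type*} [NormedAddCommGroup H] [InnerProductSpace ℂ H] [CompleteSpace H]
  [CompleteSpace X]

/-- Cutting the kernel off outside `(0,T)` and extending `f` by zero gives a convolution on the line
with the same values on `[0,T)`. The operator norm depends only on the Fourier bound `C`, not on the
size `M` of the kernel, which blows up for singular kernels. -/
theorem exists_convolution_operator (Φ : X ≃L[ℂ] H) {T : ℝ} (hT : 0 < T) :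
    ∃ c : ℝ, 0 ≤ c ∧ ∀ (k : ℝ → X →L[ℂ] X) (M C : ℝ), ContinuousOn k (Set.Ioo 0 T) →
      (∀ t ∈ Set.Ioo 0 T, ‖k t‖ ≤ M) →
      (∀ ω : ℝ, ‖∫ t in (0 : ℝ)..T, Complex.exp (-(ω * t : ℝ) * Complex.I) • k t‖ ≤ C) →
      ∃ 𝒦 : L2 T X →L[ℂ] L2 T X, ‖𝒦‖ ≤ c * C ∧
        ∀ f : L2 T X, ∀ᵐ t ∂(volume.restrict (Set.Ico (0 : ℝ) T)),
          𝒦 f t = ∫ s in (0 : ℝ)..t, k (t - s) (f s) := by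
  obtain ⟨c, hc, H⟩ := exists_eLpNorm_convolution_le Φ
  refine ⟨c, hc, fun k M C hkc hM hC => ?_⟩
  have hM0 : 0 ≤ M := (norm_nonneg _).trans (hM (T / 2) ⟨by linarith, by linarith⟩)
  have hC0 : 0 ≤ C := (norm_nonneg _).trans (hC 0)
  set κ : ℝ → X →L[ℂ] X := (Set.Ioo 0 T).indicator k with hκ
  have hκi : Integrable κ :=
    (integrable_indicator_iff measurableSet_Ioo).2 (integrableOn_of_continuousOn_Ioo hkc hM)
  have hκM : ∀ t, ‖κ t‖ ≤ M := fun t => by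
    by_cases ht : t ∈ Set.Ioo 0 T
    · rw [hκ, Set.indicator_of_mem ht]; exact hM t ht
    · rw [hκ, Set.indicator_of_notMem ht, norm_zero]; exact hM0
  have hκF : ∀ ξ, ‖𝓕 κ ξ‖ ≤ C := fun ξ => by
    refine le_trans (le_of_eq ?_) (hC (2 * Real.pi * ξ))
    rw [Real.fourier_real_eq_integral_exp_smul, intervalIntegral.integral_of_le hT.le,
      integral_Ioc_eq_integral_Ioo, ← integral_indicator measurableSet_Ioo]
    congr 2
    ext1 t
    by_cases ht : t ∈ Set.Ioo 0 T
    · rw [hκ, Set.indicator_of_mem ht, Set.indicator_of_mem ht]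
      congr 2
      push_cast
      ring
    · rw [hκ, Set.indicator_of_notMem ht, Set.indicator_of_notMem ht, smul_zero]
  set μ := volume.restrict (Set.Ico (0 : ℝ) T) with hμ
  let g : L2 T X → ℝ → X := fun f t => ∫ s in Set.Ico (0 : ℝ) T, κ (t - s) (f s)
  have hintg : ∀ (f : L2 T X) t, Integrable (fun s => κ (t - s) (f s)) μ := fun f t =>
    integrable_clm_apply (aestronglyMeasurable_comp_const_sub hκi.aestronglyMeasurable t).restrict
      (Eventually.of_forall fun s => hκM _) (integrable_L2 f)
  have hF1 : ∀ f : L2 T X, Integrable ((Set.Ico 0 T).indicator f) := fun f =>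
    (integrable_indicator_iff measurableSet_Ico).2 (integrable_L2 f)
  have hF2 : ∀ f : L2 T X, MemLp ((Set.Ico 0 T).indicator f) 2 volume := fun f =>
    (memLp_indicator_iff_restrict measurableSet_Ico).2 (Lp.memLp f)
  have hconv : ∀ f : L2 T X,
      (κ ⋆[ContinuousLinearMap.id ℂ (X →L[ℂ] X)] (Set.Ico 0 T).indicator f) = g f := by
    intro f
    ext1 t
    rw [convolution_eq_swap]
    simp only [g]
    rw [← integral_indicator measurableSet_Ico]
    congr 1
    ext1 s
    by_cases hs : s ∈ Set.Ico 0 T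
    · rw [Set.indicator_of_mem hs, Set.indicator_of_mem hs]; rfl
    · rw [Set.indicator_of_notMem hs, Set.indicator_of_notMem hs, map_zero]
  have hg : ∀ f, MemLp (g f) 2 μ := fun f => by
    have h1 : Integrable (g f) := by
      rw [← hconv]; exact hκi.integrable_convolution _ (hF1 f)
    refine (memLp_two_of_bound h1 (M := M * ∫ s, ‖(Set.Ico 0 T).indicator f s‖)
      fun t => ?_).restrict _
    rw [← hconv]
    exact norm_convolution_le hκM (hF1 f) t
  have hgn : ∀ f : L2 T X, ‖(hg f).toLp (g f)‖ ≤ c * C * ‖f‖ := fun f => by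
    have h1 := H κ M C hκi hκM hκF _ (hF1 f) (hF2 f)
    rw [hconv, eLpNorm_indicator_eq_eLpNorm_restrict measurableSet_Ico] at h1
    have h2 : eLpNorm (g f) 2 μ ≤ ENNReal.ofReal (c * C) * eLpNorm f 2 μ :=
      (eLpNorm_mono_measure _ Measure.restrict_le_self).trans h1
    rw [Lp.norm_toLp, Lp.norm_def]
    refine (ENNReal.toReal_mono (ENNReal.mul_ne_top ENNReal.ofReal_ne_top
      (Lp.eLpNorm_ne_top f)) h2).trans ?_
    rw [ENNReal.toReal_mul, ENNReal.toReal_ofReal (by positivity)]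
  let 𝒦 : L2 T X →ₗ[ℂ] L2 T X :=
    { toFun := fun f => (hg f).toLp (g f)
      map_add' := fun f₁ f₂ => by
        rw [← MemLp.toLp_add]
        refine MemLp.toLp_congr _ _ (Eventually.of_forall fun t => ?_)
        simp only [g, Pi.add_apply]
        rw [← integral_add (hintg f₁ t) (hintg f₂ t)]
        refine integral_congr_ae ?_
        filter_upwards [Lp.coeFn_add f₁ f₂] with s hs
        rw [hs, Pi.add_apply, map_add]
      map_smul' := fun a f => by
        rw [RingHom.id_apply, ← MemLp.toLp_const_smul]
        refine MemLp.toLp_congr _ _ (Eventually.of_forall fun t => ?_)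
        simp only [g, Pi.smul_apply]
        rw [← integral_smul]
        refine integral_congr_ae ?_
        filter_upwards [Lp.coeFn_smul a f] with s hs
        rw [hs, Pi.smul_apply, map_smul] }
  refine ⟨𝒦.mkContinuous (c * C) hgn, 𝒦.mkContinuous_norm_le (by positivity) _, fun f => ?_⟩
  filter_upwards [(hg f).coeFn_toLp, ae_restrict_mem measurableSet_Ico] with t ht hmem
  exact ht.trans (setIntegral_indicator_eq f hmem)

end ConvolutionOperator

end MaxReg

/-! ### Fubini identities for shifted semigroup kernels. -/

namespace MaxReg

section Triangle

variable {X : Type*} [NormedAddCommGroup X] [NormedSpace ℂ X]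

theorem ae_uIoc_of_ae {T t : ℝ} (ht : t ∈ Set.Ico 0 T) {p : ℝ → Prop}
    (h : ∀ᵐ s ∂(volume.restrict (Set.Ico (0 : ℝ) T)), p s) :
    ∀ᵐ s, s ∈ Set.uIoc 0 t → p s := by
  rw [ae_restrict_iff' measurableSet_Ico] at h
  filter_upwards [h] with s hs hst
  rw [Set.uIoc_of_le ht.1] at hst
  exact hs ⟨hst.1.le, hst.2.trans_lt ht.2⟩

theorem intervalIntegrable_of_integrable {E : Type*} [NormedAddCommGroup E] {T t : ℝ}
    (ht : t ∈ Set.Ico 0 T) {f : ℝ → E}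
    (hf : Integrable f (volume.restrict (Set.Ico (0 : ℝ) T))) : IntervalIntegrable f volume 0 t := by
  rw [intervalIntegrable_iff_integrableOn_Ioc_of_le ht.1]
  exact IntegrableOn.mono_set hf fun s hs => ⟨hs.1.le, hs.2.trans_lt ht.2⟩

theorem intervalIntegrable_kernel {k : ℝ → X →L[ℂ] X} {t M : ℝ} (ht : 0 ≤ t)
    (hk : ContinuousOn k (Set.Ioo 0 t)) (hM : ∀ r ∈ Set.Ioo 0 t, ‖k r‖ ≤ M) {f : ℝ → X}
    (hf : IntervalIntegrable f volume 0 t) :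
    IntervalIntegrable (fun s => k (t - s) (f s)) volume 0 t := by
  rw [intervalIntegrable_iff_integrableOn_Ioo_of_le ht] at hf ⊢
  have hmaps : ∀ s ∈ Set.Ioo 0 t, t - s ∈ Set.Ioo 0 t := fun s hs =>
    ⟨sub_pos.2 hs.2, by linarith [hs.1]⟩
  refine integrable_clm_apply (M := M) ?_ ?_ hf
  · exact ContinuousOn.aestronglyMeasurable
      (hk.comp (by fun_prop) hmaps) measurableSet_Ioo
  · exact (ae_restrict_iff' measurableSet_Ioo).2
      (Eventually.of_forall fun s hs => hM _ (hmaps s hs))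

theorem integral_integral_swap_triangle {D : ℝ → ℝ → X →L[ℂ] X} {M t : ℝ} (ht : 0 ≤ t)
    (hD : Continuous (Function.uncurry D)) (hM : ∀ r s, ‖D r s‖ ≤ M) {f : ℝ → X}
    (hf : IntervalIntegrable f volume 0 t) :
    ∫ r in (0 : ℝ)..t, ∫ s in (0 : ℝ)..r, D r s (f s) =
      ∫ s in (0 : ℝ)..t, ∫ r in s..t, D r s (f s) := by
  rw [intervalIntegrable_iff_integrableOn_Ioc_of_le ht] at hf
  set ν := volume.restrict (Set.Ioc 0 t) with hν
  set G : ℝ → ℝ → X := fun r s => {p : ℝ × ℝ | p.2 ≤ p.1}.indicator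
    (fun p => D p.1 p.2 (f p.2)) (r, s) with hG
  have hGi : Integrable (Function.uncurry G) (ν.prod ν) := by
    have h1 : Integrable (fun p : ℝ × ℝ => D p.1 p.2 (f p.2)) (ν.prod ν) := by
      have h2 : Integrable (fun p : ℝ × ℝ => f p.2) (ν.prod ν) := Integrable.comp_snd hf ν
      refine (h2.norm.const_mul M).mono' ((ContinuousLinearMap.id ℂ
        (X →L[ℂ] X)).aestronglyMeasurable_comp₂ hD.aestronglyMeasurable
        h2.aestronglyMeasurable) (Eventually.of_forall fun p => ?_)
      exact (D p.1 p.2).le_of_opNorm_le (hM _ _) _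
    exact h1.indicator (measurableSet_le measurable_snd measurable_fst)
  have hswap := integral_integral_swap hGi
  rw [intervalIntegral.integral_of_le ht, intervalIntegral.integral_of_le ht]
  refine Eq.trans ?_ (hswap.trans ?_)
  · refine setIntegral_congr_fun measurableSet_Ioc fun r hr => ?_
    rw [intervalIntegral.integral_of_le hr.1.le, hν, ← integral_indicator measurableSet_Ioc,
      ← integral_indicator measurableSet_Ioc]
    congr 1
    ext1 s
    simp only [hG, Set.indicator_apply, Set.mem_Ioc, Set.mem_ofPred_eq]
    by_cases hs : s ≤ r
    · have : s ≤ t := hs.trans hr.2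
      simp [hs, this]
    · simp [hs]
  · refine setIntegral_congr_fun measurableSet_Ioc fun s hs => ?_
    have hIcc : ∫ r in Set.Ioc s t, D r s (f s) = ∫ r in Set.Icc s t, D r s (f s) :=
      integral_Icc_eq_integral_Ioc.symm
    rw [intervalIntegral.integral_of_le hs.2, hIcc, hν,
      ← integral_indicator measurableSet_Ioc, ← integral_indicator measurableSet_Icc]
    congr 1
    ext1 r
    simp only [hG, Set.indicator_apply, Set.mem_Ioc, Set.mem_Icc, Set.mem_ofPred_eq]
    by_cases hr : s ≤ r
    · have : 0 < r := hs.1.trans_le hr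
      simp [hr, this]
    · simp [hr]

end Triangle

namespace IsBoundedAnalyticSemigroup

variable {X : Type*} [NormedAddCommGroup X] [NormedSpace ℂ X] [CompleteSpace X]
  {δ : ℝ} {S : ℂ → X →L[ℂ] X}

theorem continuousOn_shift (hS : IsBoundedAnalyticSemigroup δ S) {τ : ℝ} (hτ : 0 ≤ τ) :
    ContinuousOn (fun r : ℝ => S ((τ + r : ℝ) : ℂ)) (Set.Ioi 0) := fun r hr =>
  ((hS.hasDerivAt (add_pos_of_nonneg_of_pos hτ hr)).comp_const_add
    τ r).continuousAt.continuousWithinAt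

theorem continuousOn_deriv_shift (hS : IsBoundedAnalyticSemigroup δ S) {τ : ℝ} (hτ : 0 ≤ τ) :
    ContinuousOn (fun r : ℝ => deriv S ((τ + r : ℝ) : ℂ)) (Set.Ioi 0) := fun r hr =>
  ((hS.hasDerivAt_deriv (add_pos_of_nonneg_of_pos hτ hr)).comp_const_add
    τ r).continuousAt.continuousWithinAt

/-- Replacing `r` by `max r 0` extends the kernel continuously to the whole line, as the Fubini
lemma on the triangle requires, without changing it where it is integrated. -/
theorem continuous_deriv_shift (hS : IsBoundedAnalyticSemigroup δ S) {τ : ℝ} (hτ : 0 < τ) :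
    Continuous fun r : ℝ => deriv S ((τ + max r 0 : ℝ) : ℂ) := by
  rw [continuous_iff_continuousAt]
  intro r
  have h1 : 0 < τ + max r 0 := add_pos_of_pos_of_nonneg hτ (le_max_right _ _)
  exact ContinuousAt.comp (f := fun r : ℝ => τ + max r 0)
    (g := fun r : ℝ => deriv S (r : ℂ)) (hS.hasDerivAt_deriv h1).continuousAt (by fun_prop)

theorem exists_norm_deriv_shift_le (hS : IsBoundedAnalyticSemigroup δ S) {τ : ℝ} (hτ : 0 < τ) :
    ∃ M : ℝ, ∀ r : ℝ, 0 ≤ r → ‖deriv S ((τ + r : ℝ) : ℂ)‖ ≤ M := by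
  obtain ⟨C, hC, h⟩ := hS.exists_bound
  refine ⟨C / τ, fun r hr => (h _ (add_pos_of_pos_of_nonneg hτ hr)).2.1.trans ?_⟩
  gcongr
  linarith

theorem intervalIntegrable_shift (hS : IsBoundedAnalyticSemigroup δ S) {τ t : ℝ} (hτ : 0 ≤ τ)
    (ht : 0 ≤ t) {f : ℝ → X} (hf : IntervalIntegrable f volume 0 t) :
    IntervalIntegrable (fun s => S ((τ + (t - s) : ℝ) : ℂ) (f s)) volume 0 t := by
  obtain ⟨C, hC, h⟩ := hS.exists_bound
  exact intervalIntegrable_kernel (k := fun r : ℝ => S ((τ + r : ℝ) : ℂ)) ht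
    ((hS.continuousOn_shift hτ).mono fun r hr => hr.1)
    (fun r hr => (h _ (add_pos_of_nonneg_of_pos hτ hr.1)).1) hf

theorem intervalIntegrable_deriv_shift (hS : IsBoundedAnalyticSemigroup δ S) {τ t : ℝ} (hτ : 0 < τ)
    (ht : 0 ≤ t) {f : ℝ → X} (hf : IntervalIntegrable f volume 0 t) :
    IntervalIntegrable (fun s => deriv S ((τ + (t - s) : ℝ) : ℂ) (f s)) volume 0 t := by
  obtain ⟨M, hM⟩ := hS.exists_norm_deriv_shift_le hτ
  exact intervalIntegrable_kernel (k := fun r : ℝ => deriv S ((τ + r : ℝ) : ℂ)) ht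
    ((hS.continuousOn_deriv_shift hτ.le).mono fun r hr => hr.1)
    (fun r hr => hM r hr.1.le) hf

theorem integral_deriv_shift (hS : IsBoundedAnalyticSemigroup δ S) {τ s t : ℝ} (hτ : 0 < τ)
    (hst : s ≤ t) (x : X) :
    ∫ r in s..t, deriv S ((τ + (r - s) : ℝ) : ℂ) x = S ((τ + (t - s) : ℝ) : ℂ) x - S τ x := by
  have hpos : ∀ r ∈ Set.uIcc s t, 0 < τ + (r - s) := fun r hr => by
    rw [Set.uIcc_of_le hst] at hr
    linarith [hr.1]
  have hd : ∀ r ∈ Set.uIcc s t, HasDerivAt (fun r : ℝ => S ((τ + (r - s) : ℝ) : ℂ) x)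
      (deriv S ((τ + (r - s) : ℝ) : ℂ) x) r := fun r hr =>
    ((hS.hasDerivAt_apply x (hpos r hr)).comp_const_add τ (r - s)).comp_sub_const r s
  rw [intervalIntegral.integral_eq_sub_of_hasDerivAt hd]
  · simp
  · refine ContinuousOn.intervalIntegrable fun r hr => ContinuousAt.continuousWithinAt ?_
    have := ((hS.hasDerivAt_deriv (hpos r hr)).comp_const_add τ (r - s)).comp_sub_const r s
    exact this.continuousAt.clm_apply continuousAt_const

theorem integral_deriv_shift' (hS : IsBoundedAnalyticSemigroup δ S) {τ s t : ℝ} (hτ : 0 < τ)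
    (hst : s ≤ t) (x : X) :
    ∫ r in s..t, deriv S ((τ + (t - r) : ℝ) : ℂ) x = S ((τ + (t - s) : ℝ) : ℂ) x - S τ x := by
  rw [← hS.integral_deriv_shift hτ hst x]
  have := intervalIntegral.integral_comp_sub_left
    (fun r => deriv S ((τ + (r - s) : ℝ) : ℂ) x) (a := s) (b := t) (s + t)
  rw [add_sub_cancel_right, add_sub_cancel_left] at this
  rw [← this]
  congr 1
  ext r
  congr 4
  ring

theorem integral_integral_deriv_shift (hS : IsBoundedAnalyticSemigroup δ S) {τ t : ℝ} (hτ : 0 < τ)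
    (ht : 0 ≤ t) {f : ℝ → X} (hf : IntervalIntegrable f volume 0 t) :
    ∫ r in (0 : ℝ)..t, ∫ s in (0 : ℝ)..r, deriv S ((τ + (r - s) : ℝ) : ℂ) (f s) =
      ∫ s in (0 : ℝ)..t, (S ((τ + (t - s) : ℝ) : ℂ) (f s) - S τ (f s)) := by
  obtain ⟨M, hM⟩ := hS.exists_norm_deriv_shift_le hτ
  have h := integral_integral_swap_triangle (D := fun r s => deriv S ((τ + max (r - s) 0 : ℝ) : ℂ))
    (M := M) ht ((hS.continuous_deriv_shift hτ).comp (continuous_fst.sub continuous_snd))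
    (fun r s => hM _ (le_max_right _ _)) hf
  refine Eq.trans ?_ (h.trans ?_)
  · refine intervalIntegral.integral_congr fun r hr => intervalIntegral.integral_congr fun s hs => ?_
    rw [Set.uIcc_of_le ht] at hr
    rw [Set.uIcc_of_le hr.1] at hs
    simp only [max_eq_left (sub_nonneg.2 hs.2)]
  · refine intervalIntegral.integral_congr fun s hs => ?_
    rw [Set.uIcc_of_le ht] at hs
    rw [← hS.integral_deriv_shift hτ hs.2 (f s)]
    refine intervalIntegral.integral_congr fun r hr => ?_
    rw [Set.uIcc_of_le hs.2] at hr
    simp only [max_eq_left (sub_nonneg.2 hr.1)]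

/-- This is integration by parts against a primitive of an integrable function, obtained by
exchanging the order of integration. -/
theorem integral_deriv_shift_integral (hS : IsBoundedAnalyticSemigroup δ S) {τ t : ℝ} (hτ : 0 < τ)
    (ht : 0 ≤ t) {f : ℝ → X} (hf : IntervalIntegrable f volume 0 t) :
    ∫ r in (0 : ℝ)..t, deriv S ((τ + (t - r) : ℝ) : ℂ) (∫ s in (0 : ℝ)..r, f s) =
      ∫ s in (0 : ℝ)..t, (S ((τ + (t - s) : ℝ) : ℂ) (f s) - S τ (f s)) := by
  obtain ⟨M, hM⟩ := hS.exists_norm_deriv_shift_le hτ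
  have h := integral_integral_swap_triangle (D := fun r _ => deriv S ((τ + max (t - r) 0 : ℝ) : ℂ))
    (M := M) ht ((hS.continuous_deriv_shift hτ).comp (continuous_const.sub continuous_fst))
    (fun r s => hM _ (le_max_right _ _)) hf
  refine Eq.trans ?_ (h.trans ?_)
  · refine intervalIntegral.integral_congr fun r hr => ?_
    rw [Set.uIcc_of_le ht] at hr
    simp only [max_eq_left (sub_nonneg.2 hr.2)]
    rw [ContinuousLinearMap.intervalIntegral_comp_comm]
    exact hf.mono_set (by
      rw [Set.uIcc_of_le ht, Set.uIcc_of_le hr.1]; exact Set.Icc_subset_Icc_right hr.2)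
  · refine intervalIntegral.integral_congr fun s hs => ?_
    rw [Set.uIcc_of_le ht] at hs
    rw [← hS.integral_deriv_shift' hτ hs.2 (f s)]
    refine intervalIntegral.integral_congr fun r hr => ?_
    rw [Set.uIcc_of_le hs.2] at hr
    simp only [max_eq_left (sub_nonneg.2 hr.2)]

end IsBoundedAnalyticSemigroup

end MaxReg

/-! ### Strong solutions and maximal regularity on Hilbert spaces. -/

namespace MaxReg

namespace IsBoundedAnalyticSemigroup

variable {X : Type*} [NormedAddCommGroup X] [NormedSpace ℂ X] [CompleteSpace X]
  {δ : ℝ} {S : ℂ → X →L[ℂ] X}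

theorem tendsto_compLpL (hS : IsBoundedAnalyticSemigroup δ S) {T : ℝ} {τ : ℕ → ℝ}
    (hτ : ∀ n, 0 < τ n) (hτ0 : Tendsto τ atTop (𝓝 0)) (f : L2 T X) :
    Tendsto (fun n => (S (τ n)).compLpL 2 (volume.restrict (Set.Ico (0 : ℝ) T)) f) atTop
      (𝓝 f) := by
  obtain ⟨C, hC, hb⟩ := hS.exists_bound
  rw [Lp.tendsto_Lp_iff_tendsto_eLpNorm']
  simp only [eLpNorm_eq_lintegral_rpow_enorm_toReal two_ne_zero ENNReal.ofNat_ne_top]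
  have hτ0' : Tendsto τ atTop (𝓝[>] 0) :=
    tendsto_nhdsWithin_iff.2 ⟨hτ0, Eventually.of_forall hτ⟩
  have hmain : Tendsto (fun n => ∫⁻ t, ‖((S (τ n)).compLpL 2
      (volume.restrict (Set.Ico (0 : ℝ) T)) f - f : ℝ → X) t‖ₑ ^ (2 : ENNReal).toReal
      ∂(volume.restrict (Set.Ico (0 : ℝ) T))) atTop (𝓝 0) := by
    have h0 : ∫⁻ _, (0 : ENNReal) ∂(volume.restrict (Set.Ico (0 : ℝ) T)) = 0 := by simp
    rw [← h0]
    refine tendsto_lintegral_of_dominated_convergence'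
      (fun t => ‖(C + 1) • f t‖ₑ ^ (2 : ENNReal).toReal) ?_ ?_ ?_ ?_
    · intro n
      exact (((Lp.aestronglyMeasurable _).sub (Lp.aestronglyMeasurable _)).enorm).pow_const _
    · intro n
      filter_upwards [(S (τ n)).coeFn_compLpL (p := 2) f] with t ht
      refine ENNReal.rpow_le_rpow (enorm_le_iff_norm_le.2 ?_) (by simp)
      rw [Pi.sub_apply, ht, norm_smul, Real.norm_of_nonneg (by positivity), add_mul, one_mul]
      exact norm_sub_le_of_le ((S (τ n)).le_of_opNorm_le (hb _ (hτ n)).1 _) le_rfl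
    · exact (lintegral_rpow_enorm_lt_top_of_eLpNorm_lt_top two_ne_zero ENNReal.ofNat_ne_top
        ((Lp.memLp f).const_smul (C + 1)).2).ne
    · have := ae_all_iff.2 fun n => (S (τ n)).coeFn_compLpL (p := 2) f
      filter_upwards [this] with t ht
      have h1 : Tendsto (fun n => S (τ n) (f t) - f t) atTop (𝓝 0) := by
        simpa using ((hS.tendsto_ofReal (f t)).comp hτ0').sub_const (f t)
      have h2 := ((ENNReal.continuous_rpow_const (y := (2 : ENNReal).toReal)).tendsto _).comp
        h1.enorm
      simp only [enorm_zero] at h2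
      rw [ENNReal.zero_rpow_of_pos (by simp)] at h2
      refine h2.congr fun n => ?_
      simp only [Function.comp_apply, Pi.sub_apply, ht n]
  have h3 := ((ENNReal.continuous_rpow_const (y := 1 / (2 : ENNReal).toReal)).tendsto _).comp hmain
  rw [ENNReal.zero_rpow_of_pos (by simp)] at h3
  exact h3

/-- Uniformly bounded regularizations of the singular integral operator with kernel `S'`. -/
theorem exists_singular_operators {H : Type*} [NormedAddCommGroup H] [InnerProductSpace ℂ H]
    [CompleteSpace H] (Φ : X ≃L[ℂ] H) (hS : IsBoundedAnalyticSemigroup δ S) {T : ℝ} (hT : 0 < T) :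
    ∃ (C : ℝ) (𝒱 : ℝ → L2 T X →L[ℂ] L2 T X), 0 ≤ C ∧ ∀ τ : ℝ, 0 < τ → ‖𝒱 τ‖ ≤ C ∧
      ∀ f : L2 T X, ∀ᵐ t ∂(volume.restrict (Set.Ico (0 : ℝ) T)),
        𝒱 τ f t = ∫ s in (0 : ℝ)..t, deriv S ((τ + (t - s) : ℝ) : ℂ) (f s) := by
  obtain ⟨c, hc, H⟩ := exists_convolution_operator Φ hT
  obtain ⟨C, hC, hb⟩ := hS.exists_bound
  have key : ∀ τ : ℝ, ∃ 𝒱 : L2 T X →L[ℂ] L2 T X, 0 < τ → ‖𝒱‖ ≤ c * (6 * C) ∧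
      ∀ f : L2 T X, ∀ᵐ t ∂(volume.restrict (Set.Ico (0 : ℝ) T)),
        𝒱 f t = ∫ s in (0 : ℝ)..t, deriv S ((τ + (t - s) : ℝ) : ℂ) (f s) := by
    intro τ
    by_cases hτ : 0 < τ
    · obtain ⟨M, hM⟩ := hS.exists_norm_deriv_shift_le hτ
      obtain ⟨𝒱, h1, h2⟩ := H (fun r => deriv S ((τ + r : ℝ) : ℂ)) M (6 * C)
        ((hS.continuousOn_deriv_shift hτ.le).mono fun r hr => hr.1) (fun r hr => hM r hr.1.le)
        (by
          -- The estimates of `exists_bound` at time `τ + t` imply those at time `t`, so the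
          -- resulting constant does not depend on `τ`.
          refine norm_integral_exp_smul_le (K := fun r => S ((τ + r : ℝ) : ℂ))
            (K'' := fun r => deriv (deriv S) ((τ + r : ℝ) : ℂ)) hT hC.le ?_ ?_ ?_ ?_ ?_ ?_
          · exact fun t ht => (hS.hasDerivAt (add_pos_of_pos_of_nonneg hτ ht.1)).comp_const_add τ t
          · exact fun t ht =>
              (hS.hasDerivAt_deriv (add_pos_of_pos_of_nonneg hτ ht.1)).comp_const_add τ t
          · intro t ht
            have h3 := hS.continuousAt_deriv_deriv (add_pos_of_pos_of_nonneg hτ ht.1)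
            exact (ContinuousAt.comp (f := fun r => τ + r) h3 (by fun_prop)).continuousWithinAt
          · exact fun t ht => (hb _ (add_pos_of_pos_of_nonneg hτ ht.1)).1
          · intro t ht
            refine (hb _ (add_pos hτ ht.1)).2.1.trans ?_
            have := ht.1
            gcongr
            linarith
          · intro t ht
            refine (hb _ (add_pos hτ ht.1)).2.2.trans ?_
            have := ht.1
            gcongr
            linarith)
      exact ⟨𝒱, fun _ => ⟨h1, h2⟩⟩
    · exact ⟨0, fun h => absurd h hτ⟩
  choose 𝒱 h𝒱 using key
  exact ⟨c * (6 * C), 𝒱, by positivity, h𝒱⟩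

/-- The operator mapping `f` to the mild solution `∫₀ᵗ S (t - s) f s ds`. -/
theorem exists_mild_operator {H : Type*} [NormedAddCommGroup H] [InnerProductSpace ℂ H]
    [CompleteSpace H] (Φ : X ≃L[ℂ] H) (hS : IsBoundedAnalyticSemigroup δ S) {T : ℝ} (hT : 0 < T) :
    ∃ R : L2 T X →L[ℂ] L2 T X, ∀ f : L2 T X, ∀ᵐ t ∂(volume.restrict (Set.Ico (0 : ℝ) T)),
      R f t = ∫ s in (0 : ℝ)..t, S ((t - s : ℝ) : ℂ) (f s) := by
  obtain ⟨c, hc, H⟩ := exists_convolution_operator Φ hT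
  obtain ⟨C, hC, hb⟩ := hS.exists_bound
  obtain ⟨R, -, hR⟩ := H (fun r => S (r : ℂ)) C (C * |T - 0|)
    (fun r hr => (hS.hasDerivAt hr.1).continuousAt.continuousWithinAt) (fun r hr => (hb r hr.1).1)
    (fun ω => intervalIntegral.norm_integral_le_of_norm_le_const fun t ht => by
      rw [Set.uIoc_of_le hT.le] at ht
      rw [norm_smul, norm_exp_neg_mul_I, one_mul]
      exact (hb t ht.1).1)
  exact ⟨R, hR⟩

section Solution

variable {T : ℝ} {𝒱 : ℝ → L2 T X →L[ℂ] L2 T X} {C : ℝ}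

theorem compLpL_singular (hS : IsBoundedAnalyticSemigroup δ S)
    (h𝒱 : ∀ τ : ℝ, 0 < τ → ∀ f : L2 T X, ∀ᵐ t ∂(volume.restrict (Set.Ico (0 : ℝ) T)),
      𝒱 τ f t = ∫ s in (0 : ℝ)..t, deriv S ((τ + (t - s) : ℝ) : ℂ) (f s))
    {σ τ : ℝ} (hσ : 0 < σ) (hτ : 0 < τ) (f : L2 T X) :
    (S σ).compLpL 2 (volume.restrict (Set.Ico (0 : ℝ) T)) (𝒱 τ f) =
      𝒱 τ ((S σ).compLpL 2 (volume.restrict (Set.Ico (0 : ℝ) T)) f) := by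
  refine Lp.ext ?_
  filter_upwards [(S σ).coeFn_compLpL (p := 2) (𝒱 τ f), h𝒱 τ hτ f,
    h𝒱 τ hτ ((S σ).compLpL 2 (volume.restrict (Set.Ico (0 : ℝ) T)) f),
    ae_restrict_mem measurableSet_Ico] with t h1 h2 h3 ht
  rw [h1, h2, h3, ← ContinuousLinearMap.intervalIntegral_comp_comm _
    (hS.intervalIntegrable_deriv_shift hτ ht.1
      (intervalIntegrable_of_integrable ht (integrable_L2 f)))]
  refine intervalIntegral.integral_congr_ae ?_
  filter_upwards [ae_uIoc_of_ae ht ((S σ).coeFn_compLpL (p := 2) f)] with s hs hst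
  rw [hs hst]
  rw [Set.uIoc_of_le ht.1] at hst
  have hpos : 0 < τ + (t - s) := by linarith [hst.2]
  rw [← mul_apply_eq_comp, ← mul_apply_eq_comp, ← hS.deriv_add hpos hσ, ← hS.deriv_add' hσ hpos,
    add_comm σ]

/-- Both sides have the kernel `S' (σ + τ + (t - s))`, which is symmetric in `σ` and `τ`. -/
theorem compLpL_singular_swap (hS : IsBoundedAnalyticSemigroup δ S)
    (h𝒱 : ∀ τ : ℝ, 0 < τ → ∀ f : L2 T X, ∀ᵐ t ∂(volume.restrict (Set.Ico (0 : ℝ) T)),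
      𝒱 τ f t = ∫ s in (0 : ℝ)..t, deriv S ((τ + (t - s) : ℝ) : ℂ) (f s))
    {σ τ : ℝ} (hσ : 0 < σ) (hτ : 0 < τ) (f : L2 T X) :
    (S σ).compLpL 2 (volume.restrict (Set.Ico (0 : ℝ) T)) (𝒱 τ f) =
      𝒱 σ ((S τ).compLpL 2 (volume.restrict (Set.Ico (0 : ℝ) T)) f) := by
  rw [compLpL_singular hS h𝒱 hσ hτ]
  refine Lp.ext ?_
  filter_upwards [h𝒱 τ hτ ((S σ).compLpL 2 _ f), h𝒱 σ hσ ((S τ).compLpL 2 _ f),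
    ae_restrict_mem measurableSet_Ico] with t h1 h2 ht
  rw [h1, h2]
  refine intervalIntegral.integral_congr_ae ?_
  filter_upwards [ae_uIoc_of_ae ht ((S σ).coeFn_compLpL (p := 2) f),
    ae_uIoc_of_ae ht ((S τ).coeFn_compLpL (p := 2) f)] with s hs hs' hst
  rw [hs hst, hs' hst]
  rw [Set.uIoc_of_le ht.1] at hst
  have hp1 : 0 < τ + (t - s) := by linarith [hst.2]
  have hp2 : 0 < σ + (t - s) := by linarith [hst.2]
  rw [← mul_apply_eq_comp, ← mul_apply_eq_comp, ← hS.deriv_add hp1 hσ, ← hS.deriv_add hp2 hτ]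
  congr 3
  ring

/-- The limit `v` of `𝒱 τ f` as `τ → 0` gives meaning to the singular integral `∫₀ᵗ S' (t - s) f s
ds`; the identity with `S τ` records it without any singularity. -/
theorem exists_limit_singular (hS : IsBoundedAnalyticSemigroup δ S) (hC : 0 ≤ C)
    (hn : ∀ τ : ℝ, 0 < τ → ‖𝒱 τ‖ ≤ C)
    (h𝒱 : ∀ τ : ℝ, 0 < τ → ∀ f : L2 T X, ∀ᵐ t ∂(volume.restrict (Set.Ico (0 : ℝ) T)),
      𝒱 τ f t = ∫ s in (0 : ℝ)..t, deriv S ((τ + (t - s) : ℝ) : ℂ) (f s))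
    (f : L2 T X) :
    ∃ v : L2 T X, ∀ τ : ℝ, 0 < τ →
      (S τ).compLpL 2 (volume.restrict (Set.Ico (0 : ℝ) T)) v = 𝒱 τ f := by
  set μ := volume.restrict (Set.Ico (0 : ℝ) T) with hμ
  set τ : ℕ → ℝ := fun n => 1 / ((n : ℝ) + 1) with hτdef
  have hτ : ∀ n, 0 < τ n := fun n => by simp only [hτdef]; positivity
  have hτ0 : Tendsto τ atTop (𝓝 0) := tendsto_one_div_add_atTop_nhds_zero_nat
  have hcauchy : CauchySeq fun n => 𝒱 (τ n) f := by
    rw [Metric.cauchySeq_iff']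
    intro η hη
    obtain ⟨m, hm⟩ := ((Metric.tendsto_atTop.1 (hS.tendsto_compLpL hτ hτ0 f))
      (η / (4 * (C + 1))) (by positivity))
    have hm := hm m le_rfl
    rw [dist_comm, dist_eq_norm, lt_div_iff₀ (by positivity)] at hm
    obtain ⟨N, hN⟩ := Metric.tendsto_atTop.1 (hS.tendsto_compLpL hτ hτ0 (𝒱 (τ m) f)) (η / 4)
      (by positivity)
    have hest : ∀ n ≥ N, dist (𝒱 (τ n) f) (𝒱 (τ m) f) < η / 2 := by
      intro n hn'
      -- The first term is small uniformly in `n` by the operator bound, and the second converges as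
      -- `n → ∞` since `𝒱 (τ m) f` is fixed.
      have h1 : 𝒱 (τ n) f = 𝒱 (τ n) (f - (S (τ m)).compLpL 2 μ f) +
          (S (τ n)).compLpL 2 μ (𝒱 (τ m) f) := by
        rw [compLpL_singular_swap hS h𝒱 (hτ n) (hτ m), ← _root_.map_add, sub_add_cancel]
      have h2 := hN n hn'
      have h3 := (𝒱 (τ n)).le_of_opNorm_le (hn _ (hτ n)) (f - (S (τ m)).compLpL 2 μ f)
      rw [dist_eq_norm] at h2 ⊢
      rw [h1, add_sub_assoc]
      refine (norm_add_le _ _).trans_lt ?_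
      have h4 := norm_nonneg (f - (S (τ m)).compLpL 2 μ f)
      nlinarith
    exact ⟨N, fun n hn' => (dist_triangle_right _ _ (𝒱 (τ m) f)).trans_lt (by
      linarith [hest n hn', hest N le_rfl])⟩
  obtain ⟨v, hv⟩ := cauchySeq_tendsto_of_complete hcauchy
  refine ⟨v, fun σ hσ => ?_⟩
  refine tendsto_nhds_unique ((((S σ).compLpL 2 μ).continuous.tendsto v).comp hv) ?_
  have h5 : Tendsto (fun n => (S (τ n)).compLpL 2 μ (𝒱 σ f)) atTop (𝓝 (𝒱 σ f)) :=
    hS.tendsto_compLpL hτ hτ0 _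
  refine h5.congr fun n => ?_
  rw [compLpL_singular hS h𝒱 (hτ n) hσ, Function.comp_apply,
    compLpL_singular_swap hS h𝒱 hσ (hτ n)]

/-- After applying `S τ` all kernels are regular: integrating the smoothed `v` gives `∫ (S (τ + (t -
s)) f s - S τ (f s)) ds`, the smoothed mild solution minus the smoothed primitive of `f`. Strong
continuity at `0` then removes `S τ`. -/
theorem derivRel_mild (hS : IsBoundedAnalyticSemigroup δ S) {R : L2 T X →L[ℂ] L2 T X}
    (hR : ∀ f : L2 T X, ∀ᵐ t ∂(volume.restrict (Set.Ico (0 : ℝ) T)),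
      R f t = ∫ s in (0 : ℝ)..t, S ((t - s : ℝ) : ℂ) (f s)) {f v : L2 T X}
    (hv : ∀ τ : ℝ, 0 < τ → ∀ᵐ t ∂(volume.restrict (Set.Ico (0 : ℝ) T)),
      S τ (v t) = ∫ s in (0 : ℝ)..t, deriv S ((τ + (t - s) : ℝ) : ℂ) (f s)) :
    DerivRel T (R f) (f + v) := by
  filter_upwards [hR f, ae_restrict_mem measurableSet_Ico] with t hu ht
  have hfi := intervalIntegrable_of_integrable ht (integrable_L2 f)
  have hvi := intervalIntegrable_of_integrable ht (integrable_L2 v)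
  have hsum : ∫ s in (0 : ℝ)..t, (f + v : L2 T X) s = (∫ s in (0 : ℝ)..t, f s) +
      ∫ s in (0 : ℝ)..t, v s := by
    rw [← intervalIntegral.integral_add hfi hvi]
    exact intervalIntegral.integral_congr_ae (ae_uIoc_of_ae ht (Lp.coeFn_add f v))
  have hfi' : IntervalIntegrable (fun s => S ((t - s : ℝ) : ℂ) (f s)) volume 0 t := by
    simpa using hS.intervalIntegrable_shift le_rfl ht.1 hfi
  have key : ∀ τ : ℝ, 0 < τ → S τ (R f t) = S τ (∫ s in (0 : ℝ)..t, (f + v : L2 T X) s) := by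
    intro τ hτ
    have h1 : S τ (R f t) = ∫ s in (0 : ℝ)..t, S ((τ + (t - s) : ℝ) : ℂ) (f s) := by
      rw [hu, ← ContinuousLinearMap.intervalIntegral_comp_comm _ hfi',
        intervalIntegral.integral_of_le ht.1, intervalIntegral.integral_of_le ht.1,
        integral_Ioc_eq_integral_Ioo, integral_Ioc_eq_integral_Ioo]
      refine setIntegral_congr_fun measurableSet_Ioo fun s hs => ?_
      rw [hS.map_add_ofReal hτ (sub_pos.2 hs.2), mul_apply_eq_comp]
    have h2 : S τ (∫ s in (0 : ℝ)..t, v s) =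
        ∫ r in (0 : ℝ)..t, ∫ s in (0 : ℝ)..r, deriv S ((τ + (r - s) : ℝ) : ℂ) (f s) := by
      rw [← ContinuousLinearMap.intervalIntegral_comp_comm _ hvi]
      exact intervalIntegral.integral_congr_ae (ae_uIoc_of_ae ht (hv τ hτ))
    rw [h1, hsum, _root_.map_add, h2, hS.integral_integral_deriv_shift hτ ht.1 hfi,
      intervalIntegral.integral_sub (hS.intervalIntegrable_shift hτ.le ht.1 hfi)
        ⟨(S τ).integrable_comp hfi.1, (S τ).integrable_comp hfi.2⟩,
      ContinuousLinearMap.intervalIntegral_comp_comm _ hfi, add_sub_cancel]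
  refine tendsto_nhds_unique ((hS.tendsto_ofReal (R f t)).congr' ?_) (hS.tendsto_ofReal _)
  filter_upwards [self_mem_nhdsWithin] with τ hτ
  exact key τ hτ

theorem pointwiseRel_mild (hS : IsBoundedAnalyticSemigroup δ S) {B : X →ₗ.[ℂ] X}
    (hB : IsGenerator (-B) S) {R : L2 T X →L[ℂ] L2 T X}
    (hR : ∀ f : L2 T X, ∀ᵐ t ∂(volume.restrict (Set.Ico (0 : ℝ) T)),
      R f t = ∫ s in (0 : ℝ)..t, S ((t - s : ℝ) : ℂ) (f s)) {f v : L2 T X}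
    (hv : ∀ τ : ℝ, 0 < τ → ∀ᵐ t ∂(volume.restrict (Set.Ico (0 : ℝ) T)),
      S τ (v t) = ∫ s in (0 : ℝ)..t, deriv S ((τ + (t - s) : ℝ) : ℂ) (f s)) :
    PointwiseRel T B (R f) (-v) := by
  set τ : ℕ → ℝ := fun n => 1 / ((n : ℝ) + 1) with hτdef
  have hτ : ∀ n, 0 < τ n := fun n => by simp only [hτdef]; positivity
  have hτ0 : Tendsto τ atTop (𝓝 0) := tendsto_one_div_add_atTop_nhds_zero_nat
  filter_upwards [hR f, ae_restrict_mem measurableSet_Ico, ae_all_iff.2 fun n => hv (τ n) (hτ n),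
    Lp.coeFn_neg v] with t hu ht hvt hneg
  have hfi := intervalIntegrable_of_integrable ht (integrable_L2 f)
  have hfi' : IntervalIntegrable (fun s => S ((t - s : ℝ) : ℂ) (f s)) volume 0 t := by
    simpa using hS.intervalIntegrable_shift le_rfl ht.1 hfi
  rw [hneg, Pi.neg_apply, ← mem_graph_neg]
  refine hS.mem_graph_of_forall_nat hB hτ hτ0 fun n => ?_
  rw [hvt n, hu, ← ContinuousLinearMap.intervalIntegral_comp_comm _ hfi',
    intervalIntegral.integral_of_le ht.1, intervalIntegral.integral_of_le ht.1,
    integral_Ioc_eq_integral_Ioo, integral_Ioc_eq_integral_Ioo]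
  refine setIntegral_congr_fun measurableSet_Ioo fun s hs => ?_
  rw [hS.deriv_add (hτ n) (sub_pos.2 hs.2), mul_apply_eq_comp]

/-- Uniqueness by variation of constants: since `w = B u`, one has `S (τ + r) w = -S' (τ + r) u`.
Writing `u` as the primitive of `v` and exchanging integrals leaves exactly `S τ (u t)`. -/
theorem eq_mild (hS : IsBoundedAnalyticSemigroup δ S) {B : X →ₗ.[ℂ] X}
    (hB : IsGenerator (-B) S) {R : L2 T X →L[ℂ] L2 T X}
    (hR : ∀ f : L2 T X, ∀ᵐ t ∂(volume.restrict (Set.Ico (0 : ℝ) T)),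
      R f t = ∫ s in (0 : ℝ)..t, S ((t - s : ℝ) : ℂ) (f s)) {u v w : L2 T X}
    (hd : DerivRel T u v) (hp : PointwiseRel T B u w) : u = R (v + w) := by
  refine Lp.ext ?_
  filter_upwards [hR (v + w), ae_restrict_mem measurableSet_Ico, hd] with t hu ht hut
  have hvi := intervalIntegrable_of_integrable ht (integrable_L2 v)
  have hui := intervalIntegrable_of_integrable ht (integrable_L2 u)
  have hfi := intervalIntegrable_of_integrable ht (integrable_L2 (v + w))
  have hfi' : IntervalIntegrable (fun s => S ((t - s : ℝ) : ℂ) ((v + w : L2 T X) s)) volume 0 t := by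
    simpa using hS.intervalIntegrable_shift le_rfl ht.1 hfi
  have key : ∀ τ : ℝ, 0 < τ → S τ (u t) = S τ (R (v + w) t) := by
    intro τ hτ
    have h1 : S τ (R (v + w) t) =
        ∫ s in (0 : ℝ)..t, S ((τ + (t - s) : ℝ) : ℂ) ((v + w : L2 T X) s) := by
      rw [hu, ← ContinuousLinearMap.intervalIntegral_comp_comm _ hfi',
        intervalIntegral.integral_of_le ht.1, intervalIntegral.integral_of_le ht.1,
        integral_Ioc_eq_integral_Ioo, integral_Ioc_eq_integral_Ioo]
      refine setIntegral_congr_fun measurableSet_Ioo fun s hs => ?_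
      rw [hS.map_add_ofReal hτ (sub_pos.2 hs.2), mul_apply_eq_comp]
    have h2 : ∫ s in (0 : ℝ)..t, S ((τ + (t - s) : ℝ) : ℂ) ((v + w : L2 T X) s) =
        ∫ s in (0 : ℝ)..t, (S ((τ + (t - s) : ℝ) : ℂ) (v s) -
          deriv S ((τ + (t - s) : ℝ) : ℂ) (u s)) := by
      refine intervalIntegral.integral_congr_ae ?_
      filter_upwards [ae_uIoc_of_ae ht (Lp.coeFn_add v w), ae_uIoc_of_ae ht hp] with s h3 h4 hs
      rw [h3 hs, Pi.add_apply, _root_.map_add]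
      have h5 : (u s, -w s) ∈ (-B).graph := by
        rw [mem_graph_neg, neg_neg]; exact h4 hs
      rw [Set.uIoc_of_le ht.1] at hs
      rw [hS.deriv_apply_of_mem_graph hB h5 (show 0 < τ + (t - s) by linarith [hs.2]), map_neg,
        sub_neg_eq_add]
    have h6 : ∫ s in (0 : ℝ)..t, deriv S ((τ + (t - s) : ℝ) : ℂ) (u s) =
        ∫ r in (0 : ℝ)..t, deriv S ((τ + (t - r) : ℝ) : ℂ) (∫ s in (0 : ℝ)..r, v s) := by
      refine intervalIntegral.integral_congr_ae ?_
      filter_upwards [ae_uIoc_of_ae ht hd] with s h3 hs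
      rw [h3 hs]
    rw [h1, h2, intervalIntegral.integral_sub (hS.intervalIntegrable_shift hτ.le ht.1 hvi)
      (hS.intervalIntegrable_deriv_shift hτ ht.1 hui), h6,
      hS.integral_deriv_shift_integral hτ ht.1 hvi,
      intervalIntegral.integral_sub (hS.intervalIntegrable_shift hτ.le ht.1 hvi)
        ⟨(S τ).integrable_comp hvi.1, (S τ).integrable_comp hvi.2⟩,
      ContinuousLinearMap.intervalIntegral_comp_comm _ hvi, sub_sub_cancel, hut]
  refine tendsto_nhds_unique ((hS.tendsto_ofReal (u t)).congr' ?_) (hS.tendsto_ofReal _)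
  filter_upwards [self_mem_nhdsWithin] with τ hτ
  exact key τ hτ

end Solution

end IsBoundedAnalyticSemigroup

/-- Spaces isomorphic to a Hilbert space have the maximal regularity property. -/
theorem MRP_of_equiv {X H : Type*} [NormedAddCommGroup X] [NormedSpace ℂ X] [CompleteSpace X]
    [NormedAddCommGroup H] [InnerProductSpace ℂ H] [CompleteSpace H] (Φ : X ≃L[ℂ] H) {T : ℝ}
    (hT : 0 < T) : MRP T X := by
  rintro B ⟨δ, S, hS, hB⟩
  obtain ⟨R, hR⟩ := hS.exists_mild_operator Φ hT
  obtain ⟨C, 𝒱, hC, h𝒱⟩ := hS.exists_singular_operators Φ hT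
  refine ⟨R, fun u f => ⟨?_, ?_⟩⟩
  · rintro ⟨v, w, hd, hp, rfl⟩
    exact hS.eq_mild hB hR hd hp
  · rintro rfl
    obtain ⟨v, hv⟩ := hS.exists_limit_singular hC (fun τ hτ => (h𝒱 τ hτ).1)
      (fun τ hτ => (h𝒱 τ hτ).2) f
    have hv' : ∀ τ : ℝ, 0 < τ → ∀ᵐ t ∂(volume.restrict (Set.Ico (0 : ℝ) T)),
        S τ (v t) = ∫ s in (0 : ℝ)..t, deriv S ((τ + (t - s) : ℝ) : ℂ) (f s) := by
      intro τ hτ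
      filter_upwards [(S τ).coeFn_compLpL (p := 2) v, (h𝒱 τ hτ).2 f] with t h1 h2
      rw [← h1, hv τ hτ, h2]
    exact ⟨f + v, -v, hS.derivRel_mild hR hv', hS.pointwiseRel_mild hB hR hv',
      add_neg_cancel_right f v⟩

end MaxReg

end

theorem theorem3p3 {X : Type*} [NormedAddCommGroup X] [NormedSpace ℂ X] [CompleteSpace X]
    (b : UnconditionalSchauderBasis ℕ ℂ X) (T : ℝ) (hT : 0 < T) :
    (MaxReg.MRP T X ↔ Nonempty (X ≃L[ℂ] lp (fun _ : ℕ => ℂ) 2)) ∧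
    (MaxReg.MRP T X → ∀ (π : Equiv.Perm ℕ) (u : ℕ → X),
      MaxReg.IsBlockBasis (fun n => b (π n)) u →
        (Submodule.span ℂ (Set.range u)).topologicalClosure.ClosedComplemented) := by
  refine ⟨⟨MaxReg.nonempty_equiv_lp_of_MRP b hT, ?_⟩, ?_⟩
  · rintro ⟨Φ⟩
    exact MaxReg.MRP_of_equiv Φ hT
  · intro hX π u _
    obtain ⟨Φ⟩ := MaxReg.nonempty_equiv_lp_of_MRP b hT hX
    exact MaxReg.closedComplemented_of_equiv Φ _ (Submodule.isClosed_topologicalClosure _)
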